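/- All graphs are finite and simple. For a graph $G$, the distinguishing chromatic number $\chi_D(G)$ is the minimum number of colours in a proper vertex colouring of $G$ such that the identity is the only automorphism of $G$ preserving the colouring; $\Delta(G)$, $\alpha(G)$, $\omega(G)$ denote the maximum degree, the independence number and the clique number. A graph is chordal if it has no induced cycle of length at least $4$. For vertex-disjoint graphs $G,H$, the join $G+H$ is obtained from their disjoint union by adding all edges between $V(G)$ and $V(H)$; $mK_1$ is the edgeless graph on $m$ vertices and $K_m$ the complete graph on $m$ vertices. A leaf is a vertex of degree $1$, and a support is a vertex with at least one leaf in its neighbourhood. A root of $G$ is a vertex $r$ that has the same distance to all vertices of $V(G)\setminus\{r\}$ of degree at most $\Delta(G)-1$. A tree $T_s$ is symmetric if all its non-leaves have degree $\Delta(T_s)$, one of these non-leaves is a root, and every leaf has the same distance to this root. A graph is symmetric if it is isomorphic to one of the following: - a symmetric tree $T_s$; - a graph $T_A$ obtained from a symmetric tree $T_s$ by adding, for each support $v$ of $T_s$, all edges between the leaves in $N_{T_s}(v)$; - a graph $T_B$ obtained from a symmetric tree $T_s$ by adding, for each support $v$ of $T_s$, all edges between the leaves in $N_{T_s}(v)$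 and a new vertex $v'$ adjacent exactly to the leaves in $N_{T_s}(v)$. **Theorem.** If $G$ is a connected chordal graph, then $$\chi_D(G)\le \Delta(G)+1,$$ with equality if and only if $G$ is a symmetric graph or $G\cong \alpha(G)K_1+K_{\omega(G)-1}$. -/

import Mathlib

open SimpleGraph

universe u

namespace ChordalDist

/-- A proper vertex colouring is distinguishing if the identity is the only automorphism of the
graph that preserves it. -/
def IsDistinguishing {V : Type u} {G : SimpleGraph V} {κ : Type*} (c : G.Coloring κ) : Prop :=
  ∀ φ : G ≃g G, (∀ v, c (φ v) = c v) → ∀ v, φ v = v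

/-- The distinguishing chromatic number: the minimum number of colours in a proper distinguishing
vertex colouring (for a finite graph such a colouring exists, see below). -/
noncomputable def distChromaticNumber {V : Type u} (G : SimpleGraph V) : ℕ :=
  sInf {n : ℕ | ∃ c : G.Coloring (Fin n), IsDistinguishing c}

theorem exists_isDistinguishing {V : Type u} [Fintype V] (G : SimpleGraph V) :
    ∃ c : G.Coloring (Fin (Fintype.card V)), IsDistinguishing c :=
  ⟨Coloring.mk (Fintype.equivFin V) fun h e => h.ne ((Fintype.equivFin V).injective e),
    fun _ h v => (Fintype.equivFin V).injective (h v)⟩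

/-- A graph is chordal if it has no induced cycle of length at least four. -/
def IsChordal {V : Type u} (G : SimpleGraph V) : Prop :=
  ∀ k : ℕ, 4 ≤ k → ¬ (cycleGraph k).IsIndContained G

/-- The join of two vertex-disjoint graphs. -/
def join {V W : Type*} (G : SimpleGraph V) (H : SimpleGraph W) : SimpleGraph (V ⊕ W) :=
  (G ⊕g H) ⊔ completeBipartiteGraph V W

open scoped Classical in
/-- A leaf is a vertex of degree one. -/
def IsLeaf {V : Type u} [Fintype V] (G : SimpleGraph V) (v : V) : Prop :=
  G.degree v = 1

/-- A support (vertex) is a vertex with at least one leaf in its neighbourhood. -/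
def IsSupport {V : Type u} [Fintype V] (G : SimpleGraph V) (v : V) : Prop :=
  ∃ u, G.Adj v u ∧ IsLeaf G u

open scoped Classical in
/-- A root is a vertex having the same distance to all other vertices of degree at most `Δ - 1`. -/
def IsRoot {V : Type u} [Fintype V] (G : SimpleGraph V) (r : V) : Prop :=
  ∃ d : ℕ, ∀ v, v ≠ r → G.degree v < G.maxDegree → G.dist r v = d

open scoped Classical in
/-- A tree is symmetric if all its non-leaves have maximum degree, one of these non-leaves is a
root, and all leaves have the same distance to this root. -/
def IsSymmetricTree {V : Type u} [Fintype V] (T : SimpleGraph V) : Prop :=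
  T.IsTree ∧
  (∀ v, ¬ IsLeaf T v → T.degree v = T.maxDegree) ∧
  ∃ r, ¬ IsLeaf T r ∧ IsRoot T r ∧ ∃ d : ℕ, ∀ v, IsLeaf T v → T.dist r v = d

/-- `T_A`: for each support `v` of `T`, add all edges between the leaves in `N_T(v)`. -/
def graphA {V : Type u} [Fintype V] (T : SimpleGraph V) : SimpleGraph V where
  Adj x y := T.Adj x y ∨
    (x ≠ y ∧ IsLeaf T x ∧ IsLeaf T y ∧ ∃ v, T.Adj v x ∧ T.Adj v y)
  symm := ⟨by
    rintro x y (h | ⟨hne, hx, hy, v, hvx, hvy⟩)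
    · exact Or.inl h.symm
    · exact Or.inr ⟨hne.symm, hy, hx, v, hvy, hvx⟩⟩
  loopless := ⟨by
    rintro x (h | ⟨hne, -⟩)
    · exact h.ne rfl
    · exact hne rfl⟩

/-- `T_B`: for each support `v` of `T`, add all edges between the leaves in `N_T(v)`, and add a
new vertex `v'` (here `Sum.inr v`) that is adjacent exactly to the leaves in `N_T(v)`. -/
def graphB {V : Type u} [Fintype V] (T : SimpleGraph V) :
    SimpleGraph (V ⊕ {v : V // IsSupport T v}) where
  Adj
    | Sum.inl x, Sum.inl y => (graphA T).Adj x y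
    | Sum.inl x, Sum.inr v => T.Adj v.1 x ∧ IsLeaf T x
    | Sum.inr v, Sum.inl x => T.Adj v.1 x ∧ IsLeaf T x
    | Sum.inr _, Sum.inr _ => False
  symm := ⟨by
    rintro (x | v) (y | w) h
    · exact (graphA T).adj_symm h
    · exact h
    · exact h
    · exact h⟩
  loopless := ⟨by
    rintro (x | v) h
    · exact h.ne rfl
    · exact h⟩

/-- A graph is symmetric if it is (isomorphic to) a symmetric tree `T_s`, or one of the graphs
`T_A`, `T_B` constructed from a symmetric tree `T_s`. -/
def IsSymmetricGraph {V : Type u} [Fintype V] (G : SimpleGraph V) : Prop :=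
  IsSymmetricTree G ∨
  ∃ (W : Type u) (_ : Fintype W) (T : SimpleGraph W), IsSymmetricTree T ∧
    (Nonempty (G ≃g graphA T) ∨ Nonempty (G ≃g graphB T))

end ChordalDist

/-!
Let `G` be a connected chordal graph of maximum degree `Δ`. The proof studies when `G` has a proper
distinguishing colouring with `k` colours, for `k = Δ + 1` and `k = Δ`. Vertices may carry labels,
which automorphisms have to preserve as well; this is what makes an induction possible.

*Colouring level by level.* Fix a vertex `r` of degree less than `k` and process the vertices in the
order of their distance from `r`. Processing `v` colours the uncoloured neighbours of `v`, with
distinct colours that do not occur on the coloured, unprocessed vertices of the closed neighbourhood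
of `v`. Chordality makes this colouring proper, and `v` has a processed neighbour, so `k` colours
suffice. An automorphism that preserves the colours and fixes `r` is then the identity. It has to
fix `r` if every other vertex with the colour of `r` in the orbit of `r` has two neighbours of the
same colour, as `r` has none. A vertex that has neighbours in the next level can be given two such
neighbours when it is processed. Hence the colouring only fails if it meets a *pendant part*
(`IsPiece`, `labColorable_or_isPiece`): a clique `D` of vertices of degree `k` and a set `U` of
vertices in the orbit of `r`, attached to the rest of the graph by a single vertex `p`. With `Δ + 1`
colours there are no vertices of degree `k`, whence the bound `Δ + 1`.

*Pruning.* If `G` has no colouring with `k = Δ` colours, then either `G` is a complete split graph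
`mK₁ + Kₙ`, or every vertex of degree less than `k` lies in the set `U` of a pendant part
(`isSplit_or_inPiece`). In the latter case remove these vertices and label the others by their
orbits. The colours missing on `D` are just enough for `U`, so a colouring of the remaining graph
would extend to `G` (`labColorable_of_core`). By induction the remaining graph is a complete split
graph, a symmetric tree, or one of the graphs `T_A`, `T_B`, and all its vertices of degree less than
`k` have the same label, that is, all pendant parts of `G` are equivalent under automorphisms.
Putting them back turns a symmetric tree into a higher one or into `T_A`, turns `T_A` into `T_B`,
and is impossible for `T_B` (`exceptional_of_not_labColorable`). Symmetric trees are handled through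
their distance levels (`IsLevelTree`).

*Lower bound.* In a complete split graph two vertices have the same colour, and they can be
exchanged. For the other graphs the removal of the outermost vertices is reversed
(`NoDist.extend`): either two of the outermost vertices with the same inner neighbours have the same
colour and can be exchanged, or the colours on each set `U` are precisely those missing on the
corresponding clique `D`, and then any colour-preserving automorphism of the inner graph extends.
-/

namespace ChordalDist

/-! ### Chordal graphs -/

section Chordal

variable {V : Type*} {G : SimpleGraph V}

theorem cycleGraph_adj_iff {n : ℕ} (hn : 3 ≤ n) (s t : Fin n) :
    (cycleGraph n).Adj s t ↔ s.val + 1 = t.val ∨ t.val + 1 = s.val ∨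
      (s.val = 0 ∧ t.val + 1 = n) ∨ (t.val = 0 ∧ s.val + 1 = n) := by
  have hs := s.2
  have ht := t.2
  have key : ∀ a b : Fin n, (a - b).val = 1 ↔
      b.val + 1 = a.val ∨ (a.val = 0 ∧ b.val + 1 = n) := by
    intro a b
    have ha := a.2
    have hb := b.2
    rw [Fin.sub_def]
    simp only
    rcases le_or_gt b.val a.val with h | h
    · rw [show n - b.val + a.val = (a.val - b.val) + n by omega, Nat.add_mod_right,
        Nat.mod_eq_of_lt (by omega)]
      omega
    · rw [Nat.mod_eq_of_lt (by omega)]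
      omega
  rw [cycleGraph_adj', key, key]
  tauto

/-- A shortest path inside a vertex set is an induced path. -/
theorem exists_induced_path {x y : V} {A : Set V} (p : G.Walk x y)
    (hp : ∀ z ∈ p.support, z = x ∨ z = y ∨ z ∈ A) :
    ∃ (a : ℕ) (f : ℕ → V), f 0 = x ∧ f a = y ∧
      (∀ i ≤ a, f i = x ∨ f i = y ∨ f i ∈ A) ∧
      (∀ i j, i ≤ a → j ≤ a → f i = f j → i = j) ∧
      ∀ i j, i ≤ a → j ≤ a → (G.Adj (f i) (f j) ↔ i + 1 = j ∨ j + 1 = i) := by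
  let S : Set V := {z | z = x ∨ z = y ∨ z ∈ A}
  have hr : (G.induce S).Reachable ⟨x, Or.inl rfl⟩ ⟨y, Or.inr (Or.inl rfl)⟩ :=
    ⟨p.induce S hp⟩
  obtain ⟨q, hq⟩ := hr.exists_walk_length_eq_dist
  have hlen : ∀ i, i ≤ q.length → (q.take i).length = i := by
    intro i hi; rw [Walk.take_length]; omega
  have hlen' : ∀ i, (q.drop i).length = q.length - i := by
    intro i; rw [Walk.drop_length]
  have hinj : ∀ i j, i < j → j ≤ q.length → q.getVert i ≠ q.getVert j := by
    intro i j hij hj he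
    have h := dist_le ((q.take i).append ((q.drop j).copy he.symm rfl))
    rw [Walk.length_append, Walk.length_copy, hlen i (by omega), hlen'] at h
    omega
  have hadj : ∀ i j, i < j → j ≤ q.length → (G.induce S).Adj (q.getVert i) (q.getVert j) →
      i + 1 = j := by
    intro i j hij hj he
    have h := dist_le ((q.take i).append (Walk.cons he (q.drop j)))
    rw [Walk.length_append, Walk.length_cons, hlen i (by omega), hlen'] at h
    omega
  refine ⟨q.length, fun i => (q.getVert i).1, by simp, by simp, fun i _ => (q.getVert i).2, ?_, ?_⟩
  · intro i j hi hj he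
    have he' : q.getVert i = q.getVert j := Subtype.ext he
    rcases lt_trichotomy i j with h | h | h
    · exact absurd he' (hinj i j h hj)
    · exact h
    · exact absurd he'.symm (hinj j i h hi)
  · intro i j hi hj
    constructor
    · intro h
      have h' : (G.induce S).Adj (q.getVert i) (q.getVert j) := h
      rcases lt_trichotomy i j with h1 | h1 | h1
      · exact Or.inl (hadj i j h1 hj h')
      · subst h1; exact absurd h' (SimpleGraph.irrefl _)
      · exact Or.inr (hadj j i h1 hi h'.symm)
    · rintro (rfl | rfl)
      · exact q.adj_getVert_succ (by omega)
      · exact (q.adj_getVert_succ (by omega)).symm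

/-- In a chordal graph, two vertices joined through each of two disjoint, mutually nonadjacent
vertex sets are adjacent: otherwise shortest connections through the two sets close up to an
induced cycle. -/
theorem IsChordal.adj_of_two_sides (hch : IsChordal G) {x y : V} (hne : x ≠ y) {A B : Set V}
    (p : G.Walk x y) (hp : ∀ z ∈ p.support, z = x ∨ z = y ∨ z ∈ A)
    (q : G.Walk x y) (hq : ∀ z ∈ q.support, z = x ∨ z = y ∨ z ∈ B)
    (hAB : ∀ a ∈ A, ∀ b ∈ B, a ≠ b ∧ ¬ G.Adj a b) : G.Adj x y := by
  by_contra hxy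
  obtain ⟨a, f, f0, fa, fA, finj, fadj⟩ := exists_induced_path p hp
  obtain ⟨b, g, g0, gb, gB, ginj, gadj⟩ := exists_induced_path q hq
  have len2 : ∀ (n : ℕ) (h : ℕ → V), h 0 = x → h n = y →
      (∀ i j, i ≤ n → j ≤ n → (G.Adj (h i) (h j) ↔ i + 1 = j ∨ j + 1 = i)) → 2 ≤ n := by
    intro n h h0 hn hadj
    rcases n with _ | _ | n
    · exact absurd (h0.symm.trans hn) hne
    · exact absurd (h0 ▸ hn ▸ (hadj 0 1 (by omega) le_rfl).2 (Or.inl rfl)) hxy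
    · omega
  have ha := len2 a f f0 fa fadj
  have hb := len2 b g g0 gb gadj
  have fint : ∀ i, 0 < i → i < a → f i ∈ A := by
    intro i h1 h2
    rcases fA i h2.le with h | h | h
    · have := finj i 0 h2.le (by omega) (h.trans f0.symm); omega
    · have := finj i a h2.le le_rfl (h.trans fa.symm); omega
    · exact h
  have gint : ∀ i, 0 < i → i < b → g i ∈ B := by
    intro i h1 h2
    rcases gB i h2.le with h | h | h
    · have := ginj i 0 h2.le (by omega) (h.trans g0.symm); omega
    · have := ginj i b h2.le le_rfl (h.trans gb.symm); omega
    · exact h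
  -- relation between the two paths
  have cross : ∀ i j, i ≤ a → 0 < j → j < b →
      f i ≠ g j ∧ (G.Adj (f i) (g j) ↔ (i = 0 ∧ j = 1) ∨ (i = a ∧ j + 1 = b)) := by
    intro i j hi hj1 hj2
    rcases Nat.eq_zero_or_pos i with rfl | hi0
    · rw [f0, ← g0]
      refine ⟨fun h => ?_, ?_⟩
      · have := ginj 0 j (by omega) hj2.le h; omega
      · rw [gadj 0 j (by omega) hj2.le]; omega
    · rcases hi.lt_or_eq with hi1 | rfl
      · have := hAB _ (fint i hi0 hi1) _ (gint j hj1 hj2)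
        refine ⟨this.1, iff_of_false this.2 (by omega)⟩
      · rw [fa, ← gb]
        refine ⟨fun h => ?_, ?_⟩
        · have := ginj b j le_rfl hj2.le h; omega
        · rw [gadj b j le_rfl hj2.le]; omega
  let h : Fin (a + b) → V := fun t => if t.val ≤ a then f t.val else g (a + b - t.val)
  have hlo : ∀ t : Fin (a + b), t.val ≤ a → h t = f t.val := fun t ht => if_pos ht
  have hhi : ∀ t : Fin (a + b), ¬ t.val ≤ a → h t = g (a + b - t.val) := fun t ht => if_neg ht
  have hinj : Function.Injective h := by
    intro s t hst
    have hs := s.2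
    have ht := t.2
    ext
    by_cases h1 : s.val ≤ a <;> by_cases h2 : t.val ≤ a
    · rw [hlo s h1, hlo t h2] at hst
      exact finj _ _ h1 h2 hst
    · rw [hlo s h1, hhi t h2] at hst
      exact absurd hst (cross _ _ h1 (by omega) (by omega)).1
    · rw [hhi s h1, hlo t h2] at hst
      exact absurd hst.symm (cross _ _ h2 (by omega) (by omega)).1
    · rw [hhi s h1, hhi t h2] at hst
      have := ginj _ _ (by omega) (by omega) hst
      omega
  refine hch (a + b) (by omega) ⟨⟨⟨h, hinj⟩, ?_⟩⟩
  intro s t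
  have hs := s.2
  have ht := t.2
  change G.Adj (h s) (h t) ↔ _
  rw [cycleGraph_adj_iff (by omega)]
  by_cases h1 : s.val ≤ a <;> by_cases h2 : t.val ≤ a
  · rw [hlo s h1, hlo t h2, fadj _ _ h1 h2]; omega
  · rw [hlo s h1, hhi t h2, (cross _ _ h1 (by omega) (by omega)).2]; omega
  · rw [hhi s h1, hlo t h2, G.adj_comm, (cross _ _ h2 (by omega) (by omega)).2]; omega
  · rw [hhi s h1, hhi t h2, gadj _ _ (by omega) (by omega)]; omega

/-- A four-cycle in a chordal graph has a chord. -/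
theorem IsChordal.four_cycle (hch : IsChordal G) {a b c d : V} (hab : G.Adj a b) (hbc : G.Adj b c)
    (hcd : G.Adj c d) (hda : G.Adj d a) (hac : a ≠ c) (hbd : b ≠ d) :
    G.Adj a c ∨ G.Adj b d := by
  by_contra! h
  refine h.1 (hch.adj_of_two_sides hac (A := {b}) (B := {d})
    (Walk.cons hab (Walk.cons hbc Walk.nil)) ?_
    (Walk.cons hda.symm (Walk.cons hcd.symm Walk.nil)) ?_ ?_)
  · simp
  · simp
  · rintro _ rfl _ rfl
    exact ⟨hbd, h.2⟩

theorem IsChordal.of_embedding {W : Type*} {H : SimpleGraph W} (hch : IsChordal G) (f : H ↪g G) :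
    IsChordal H :=
  fun k hk ⟨e⟩ => hch k hk ⟨f.comp e⟩

theorem IsChordal.induce (hch : IsChordal G) (S : Set V) : IsChordal (G.induce S) :=
  hch.of_embedding (Embedding.induce S)

/-- A walk towards the root along which the distance decreases. -/
theorem exists_walk_down (hc : G.Connected) (r : V) (n : ℕ) (x : V) (hx : G.dist r x = n) :
    ∃ p : G.Walk x r, ∀ z ∈ p.support, z = x ∨ G.dist r z < n := by
  induction n generalizing x with
  | zero =>
    have : r = x := hc.dist_eq_zero_iff.1 hx
    subst this
    exact ⟨Walk.nil, by simp⟩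
  | succ n ih =>
    obtain ⟨q, hq⟩ := hc.exists_walk_length_eq_dist r x
    have hne : q.length ≠ 0 := by omega
    have hadj := q.adj_getVert_succ (i := n) (by omega)
    have hend : q.getVert (n + 1) = x := by
      rw [show n + 1 = q.length by omega]; exact q.getVert_length
    rw [hend] at hadj
    have hd : G.dist r (q.getVert n) = n := by
      have h1 := dist_le (q.take n)
      rw [Walk.take_length] at h1
      have h2 := hadj.diff_dist_adj (u := r)
      omega
    obtain ⟨p, hp⟩ := ih _ hd
    refine ⟨Walk.cons hadj.symm p, ?_⟩
    intro z hz
    rw [Walk.support_cons, List.mem_cons] at hz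
    rcases hz with rfl | hz
    · exact Or.inl rfl
    · right
      rcases hp z hz with rfl | h <;> omega

theorem exists_parent (hc : G.Connected) {r x : V} (hx : x ≠ r) :
    ∃ p, G.Adj x p ∧ G.dist r x = G.dist r p + 1 := by
  obtain ⟨q, hq⟩ := hc.exists_walk_length_eq_dist r x
  have hpos := hc.pos_dist_of_ne hx.symm
  obtain ⟨n, hn⟩ : ∃ n, q.length = n + 1 := ⟨q.length - 1, by omega⟩
  have hadj := q.adj_getVert_succ (i := n) (by omega)
  rw [← hn, q.getVert_length] at hadj
  refine ⟨_, hadj.symm, ?_⟩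
  have h1 := dist_le (q.take n)
  rw [Walk.take_length] at h1
  have h2 := hadj.diff_dist_adj (u := r)
  omega

/-- Two vertices at the same distance from `r` which are joined through a set of vertices farther
away from `r` are adjacent. -/
theorem IsChordal.adj_of_upper_walk (hch : IsChordal G) (hc : G.Connected) {r x y : V}
    (hne : x ≠ y) (hxy : G.dist r x = G.dist r y) (p : G.Walk x y)
    (hp : ∀ z ∈ p.support, z = x ∨ z = y ∨ G.dist r x < G.dist r z) : G.Adj x y := by
  obtain ⟨px, hpx⟩ := exists_walk_down hc r _ x rfl
  obtain ⟨py, hpy⟩ := exists_walk_down hc r _ y hxy.symm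
  refine hch.adj_of_two_sides hne (A := {z | G.dist r x < G.dist r z})
    (B := {z | G.dist r z < G.dist r x}) p hp (px.append py.reverse) ?_ ?_
  · intro z hz
    rw [Walk.mem_support_append_iff, Walk.support_reverse, List.mem_reverse] at hz
    rcases hz with hz | hz
    · rcases hpx z hz with h | h
      · exact Or.inl h
      · exact Or.inr (Or.inr h)
    · rcases hpy z hz with h | h
      · exact Or.inr (Or.inl h)
      · exact Or.inr (Or.inr h)
  · intro a ha b hb
    have ha' : G.dist r x < G.dist r a := ha
    have hb' : G.dist r b < G.dist r x := hb
    refine ⟨fun h => by subst h; omega, fun h => ?_⟩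
    have := h.diff_dist_adj (u := r)
    omega

theorem IsChordal.parents_adj (hch : IsChordal G) (hc : G.Connected) {r u x y : V}
    (hx : G.Adj u x) (hy : G.Adj u y) (hdx : G.dist r u = G.dist r x + 1)
    (hdy : G.dist r u = G.dist r y + 1) : x = y ∨ G.Adj x y := by
  by_cases hne : x = y
  · exact Or.inl hne
  refine Or.inr (hch.adj_of_upper_walk hc (r := r) hne (by omega)
    (Walk.cons hx.symm (Walk.cons hy Walk.nil)) ?_)
  intro z hz
  simp only [Walk.support_cons, Walk.support_nil, List.mem_cons, List.not_mem_nil, or_false] at hz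
  rcases hz with rfl | rfl | rfl
  · simp
  · right; right; omega
  · simp

theorem IsChordal.parents_adj_of_adj (hch : IsChordal G) (hc : G.Connected) {r u w x y : V}
    (huw : G.Adj u w) (hd : G.dist r u = G.dist r w)
    (hx : G.Adj u x) (hy : G.Adj w y) (hdx : G.dist r u = G.dist r x + 1)
    (hdy : G.dist r w = G.dist r y + 1) : x = y ∨ G.Adj x y := by
  by_cases hne : x = y
  · exact Or.inl hne
  refine Or.inr (hch.adj_of_upper_walk hc (r := r) hne (by omega)
    (Walk.cons hx.symm (Walk.cons huw (Walk.cons hy Walk.nil))) ?_)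
  intro z hz
  simp only [Walk.support_cons, Walk.support_nil, List.mem_cons, List.not_mem_nil, or_false] at hz
  rcases hz with rfl | rfl | rfl | rfl
  · simp
  · right; right; omega
  · right; right; omega
  · simp

/-- A vertex is simplicial if its neighbours are pairwise adjacent. -/
def IsSimplicial (G : SimpleGraph V) (s : V) : Prop :=
  ∀ ⦃a b⦄, G.Adj s a → G.Adj s b → a ≠ b → G.Adj a b

theorem mem_of_connected_of_closed (hc : G.Connected) {S : Set V}
    (hS : ∀ a ∈ S, ∀ b, G.Adj a b → b ∈ S) {x : V} (hx : x ∈ S) (y : V) : y ∈ S := by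
  obtain ⟨p⟩ := hc.preconnected x y
  induction p with
  | nil => exact hx
  | cons h p ih => exact ih (hS _ hx _ h)

/-- Every vertex `z` of a chordal graph that is not adjacent to all others has a simplicial
non-neighbour. A component `H` of the graph without the closed neighbourhood of `z` is
attached to a clique, so a simplicial vertex of the smaller graph induced by `H` and this clique
that lies in `H` is simplicial in the whole graph. -/
theorem IsChordal.exists_isSimplicial (n : ℕ) : ∀ {V : Type u} [Fintype V] {G : SimpleGraph V},
    Fintype.card V = n → IsChordal G → ∀ {z y : V}, y ≠ z → ¬ G.Adj z y →
    ∃ s, s ≠ z ∧ ¬ G.Adj z s ∧ IsSimplicial G s := by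
  induction n using Nat.strong_induction_on with
  | _ n ih =>
  intro V _ G hn hch z y hyz hzy
  classical
  let A : Set V := {w | w ≠ z ∧ ¬ G.Adj z w}
  let H : Set V := {h | ∃ p : G.Walk y h, ∀ w ∈ p.support, w ∈ A}
  let K : Set V := {x | G.Adj z x ∧ ∃ h ∈ H, G.Adj x h}
  have hyH : y ∈ H := ⟨Walk.nil, by simp [A, hyz, hzy]⟩
  have hHA : ∀ h ∈ H, h ∈ A := fun h ⟨p, hp⟩ => hp h p.end_mem_support
  have hN : ∀ h ∈ H, ∀ x, G.Adj h x → x ∈ H ∪ K := by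
    intro h hh x hx
    by_cases hzx : G.Adj z x
    · exact Or.inr ⟨hzx, h, hh, hx.symm⟩
    · left
      have hxA : x ∈ A := ⟨fun e => (hHA h hh).2 (e ▸ hx).symm, hzx⟩
      obtain ⟨p, hp⟩ := hh
      refine ⟨p.concat hx, fun w hw => ?_⟩
      rw [Walk.support_concat, List.mem_append, List.mem_singleton] at hw
      rcases hw with hw | rfl
      · exact hp w hw
      · exact hxA
  have hK : ∀ a ∈ K, ∀ b ∈ K, a ≠ b → G.Adj a b := by
    rintro a ⟨hza, h₁, ⟨p₁, hp₁⟩, ha⟩ b ⟨hzb, h₂, ⟨p₂, hp₂⟩, hb⟩ hab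
    refine hch.adj_of_two_sides hab (A := A) (B := {z})
      (Walk.cons ha ((p₁.reverse.append p₂).concat hb.symm)) ?_
      (Walk.cons hza.symm (Walk.cons hzb Walk.nil)) (by simp) ?_
    · intro w hw
      rw [Walk.support_cons, List.mem_cons, Walk.support_concat,
        List.mem_append,
        List.mem_singleton, Walk.mem_support_append_iff, Walk.support_reverse,
        List.mem_reverse] at hw
      rcases hw with h | (h | h) | h
      · exact Or.inl h
      · exact Or.inr (Or.inr (hp₁ w h))
      · exact Or.inr (Or.inr (hp₂ w h))
      · exact Or.inr (Or.inl h)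
    · rintro x hx _ rfl
      exact ⟨hx.1, fun h => hx.2 h.symm⟩
  by_cases hall : ∀ a ∈ H ∪ K, ∀ b ∈ H ∪ K, a ≠ b → G.Adj a b
  · exact ⟨y, hyz, hzy, fun a b ha hb hab => hall a (hN y hyH a ha) b (hN y hyH b hb) hab⟩
  push Not at hall
  obtain ⟨a, ha, b, hb, hab, hnab⟩ := hall
  have hzW : z ∉ H ∪ K := by
    rintro (h | h)
    · exact (hHA z h).1 rfl
    · exact h.1.ne rfl
  have hcard : Fintype.card (H ∪ K : Set V) < n := by
    rw [← hn]
    exact Fintype.card_subtype_lt (x := z) hzW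
  have hchW := hch.induce (H ∪ K)
  obtain ⟨s₁, hs₁a, hs₁, hsim₁⟩ := ih _ hcard rfl hchW (z := ⟨a, ha⟩) (y := ⟨b, hb⟩)
    (fun h => hab (congrArg Subtype.val h).symm) hnab
  obtain ⟨s₂, hs₂a, hs₂, hsim₂⟩ := ih _ hcard rfl hchW (z := s₁) (y := ⟨a, ha⟩)
    hs₁a.symm (fun h => hs₁ h.symm)
  have lift : ∀ s : (H ∪ K : Set V), s.1 ∈ H → IsSimplicial (G.induce (H ∪ K)) s →
      ∃ s, s ≠ z ∧ ¬ G.Adj z s ∧ IsSimplicial G s := by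
    intro s hs hsim
    refine ⟨s, (hHA s hs).1, (hHA s hs).2, fun x x' hx hx' hne => ?_⟩
    exact hsim (a := ⟨x, hN s hs x hx⟩) (b := ⟨x', hN s hs x' hx'⟩) hx hx'
      (fun h => hne (congrArg Subtype.val h))
  rcases s₁.2 with h₁ | h₁
  · exact lift s₁ h₁ hsim₁
  rcases s₂.2 with h₂ | h₂
  · exact lift s₂ h₂ hsim₂
  · exact absurd (hK s₁ h₁ s₂ h₂ fun h => hs₂a (Subtype.ext h.symm)) hs₂

/-- The degree of a vertex as a natural number, without decidability assumptions. -/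
noncomputable def deg (G : SimpleGraph V) (v : V) : ℕ := (G.neighborSet v).ncard

/-- A connected chordal regular graph is complete: the closed neighbourhood of a simplicial vertex
is closed under adjacency. -/
theorem IsChordal.adj_of_regular {V : Type u} [Fintype V] {G : SimpleGraph V} (hc : G.Connected)
    (hch : IsChordal G) {k : ℕ} (hreg : ∀ v, deg G v = k) {x y : V} (hxy : x ≠ y) :
    G.Adj x y := by
  by_contra hn
  obtain ⟨s, hsx, hxs, hsim⟩ := hch.exists_isSimplicial _ rfl hxy.symm hn
  have hclosed : ∀ a ∈ insert s (G.neighborSet s), ∀ b, G.Adj a b →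
      b ∈ insert s (G.neighborSet s) := by
    rintro a (rfl | ha) b hab
    · exact Or.inr hab
    · have ha' : G.Adj s a := ha
      have hsub : insert s (G.neighborSet s \ {a}) ⊆ G.neighborSet a := by
        rintro b (rfl | ⟨hb, hba⟩)
        · exact ha'.symm
        · exact hsim ha' hb (fun h => hba h.symm)
      have hcard : (insert s (G.neighborSet s \ {a})).ncard = k := by
        rw [Set.ncard_insert_of_notMem (by simp), Set.ncard_sdiff_singleton_add_one ha]
        exact hreg s
      have heq := Set.eq_of_subset_of_ncard_le hsub (by rw [hcard]; exact (hreg a).le)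
      have hb : b ∈ insert s (G.neighborSet s \ {a}) := heq ▸ hab
      rcases hb with h | h
      · exact Or.inl h
      · exact Or.inr h.1
  rcases mem_of_connected_of_closed hc hclosed (Set.mem_insert s _) x with h | h
  · exact hsx h.symm
  · exact hxs (G.adj_symm h)

end Chordal

/-! ### Colouring level by level -/

section Colouring

variable {V L : Type*} {G : SimpleGraph V} {lab : V → L} {k : ℕ}

/-- The vertices that are images of `r` under automorphisms of the labelled graph. -/
def InOrbit (G : SimpleGraph V) (lab : V → L) (r w : V) : Prop :=
  ∃ γ : G ≃g G, (∀ v, lab (γ v) = lab v) ∧ γ r = w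

/-- The labelled graph has a proper colouring with `k` colours which, together with the labels, is
preserved by no automorphism but the identity. -/
def LabColorable (G : SimpleGraph V) (lab : V → L) (k : ℕ) : Prop :=
  ∃ c : V → Fin k, (∀ a b, G.Adj a b → c a ≠ c b) ∧
    ∀ φ : G ≃g G, (∀ v, lab (φ v) = lab v) → (∀ v, c (φ v) = c v) → ∀ v, φ v = v

theorem exists_injOn_avoid [Finite V] (z : Fin k) (U : Set V) (F : Set (Fin k))
    (h : U.ncard + F.ncard ≤ k) : ∃ f : V → Fin k, Set.InjOn f U ∧ ∀ u ∈ U, f u ∉ F := by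
  classical
  have hF : F.ncard + Fᶜ.ncard = k := by
    rw [Set.ncard_add_ncard_compl]; simp
  have hle : U.ncard ≤ Fᶜ.ncard := by omega
  have : Fintype V := Fintype.ofFinite V
  obtain ⟨e⟩ : Nonempty (U ↪ (Fᶜ : Set (Fin k))) := by
    refine Function.Embedding.nonempty_of_card_le ?_
    rwa [← Nat.card_eq_fintype_card, ← Nat.card_eq_fintype_card, Nat.card_coe_set_eq,
      Nat.card_coe_set_eq]
  refine ⟨fun x => if hx : x ∈ U then (e ⟨x, hx⟩).1 else z, ?_, ?_⟩
  · intro a ha b hb hab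
    simp only [dif_pos ha, dif_pos hb] at hab
    exact congrArg Subtype.val (e.injective (Subtype.ext hab))
  · intro a ha
    simp only [dif_pos ha]
    exact (e ⟨a, ha⟩).2

theorem exists_injOn_avoid_of_mem [Finite V] {a : Fin k} {U : Set V} {F : Set (Fin k)} {u : V}
    (h : U.ncard + F.ncard ≤ k) (hu : u ∈ U) (ha : a ∉ F) :
    ∃ f : V → Fin k, f u = a ∧ Set.InjOn f U ∧ ∀ u ∈ U, f u ∉ F := by
  classical
  have h1 := Set.ncard_sdiff_singleton_add_one hu (Set.toFinite U)
  have h2 : (insert a F).ncard = F.ncard + 1 := Set.ncard_insert_of_notMem ha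
  obtain ⟨f, hf, hf'⟩ := exists_injOn_avoid a (U \ {u}) (insert a F) (by omega)
  have key : ∀ x ∈ U, x ≠ u → f x ≠ a ∧ f x ∉ F := fun x hx hxu => by
    have := hf' x ⟨hx, hxu⟩
    rw [Set.mem_insert_iff] at this
    tauto
  refine ⟨Function.update f u a, Function.update_self .., ?_, ?_⟩
  · intro x hx y hy hxy
    by_cases hxu : x = u <;> by_cases hyu : y = u
    · rw [hxu, hyu]
    · subst hxu
      rw [Function.update_self, Function.update_of_ne hyu] at hxy
      exact absurd hxy.symm (key y hy hyu).1
    · subst hyu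
      rw [Function.update_self, Function.update_of_ne hxu] at hxy
      exact absurd hxy (key x hx hxu).1
    · rw [Function.update_of_ne hxu, Function.update_of_ne hyu] at hxy
      exact hf ⟨hx, hxu⟩ ⟨hy, hyu⟩ hxy
  · intro x hx
    by_cases hxu : x = u
    · subst hxu; rwa [Function.update_self]
    · rw [Function.update_of_ne hxu]; exact (key x hx hxu).2

/-- The vertices that are coloured once the vertices in `P` have been processed. -/
def coloured (G : SimpleGraph V) (P : Set V) : Set V := {x | ∃ q ∈ P, x = q ∨ G.Adj q x}

/-- The neighbours of `v` that receive their colour when `v` is processed. -/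
def fresh (G : SimpleGraph V) (P : Set V) (v : V) : Set V := {u | G.Adj v u ∧ u ∉ coloured G P}

/-- The vertices in the closed neighbourhood of `v` that are coloured but not processed. -/
def pending (G : SimpleGraph V) (P : Set V) (v : V) : Set V :=
  {x | (x = v ∨ G.Adj v x) ∧ x ∈ coloured G P ∧ x ∉ P}

/-- A partial colouring, defined on the closed neighbourhood of a set `P` of processed vertices
that consists of all vertices up to some distance from the root `r`, except that the last level may
be incomplete. The colour `z` of `r` may occur again on vertices in the orbit of `r`, but such a
vertex has, or will get, two neighbours of the same colour, while `r` has no such neighbours. -/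
structure State (G : SimpleGraph V) (lab : V → L) (r : V) (z : Fin k) (P : Set V)
    (c : V → Fin k) : Prop where
  root_mem : r ∈ P
  down : ∀ v ∈ P, ∀ u, G.dist r u < G.dist r v → u ∈ P
  proper : ∀ x ∈ coloured G P, ∀ y ∈ coloured G P, G.Adj x y → c x ≠ c y
  root_color : c r = z
  root_inj : ∀ a b, G.Adj r a → G.Adj r b → c a = c b → a = b
  fix : ∀ φ : G ≃g G, φ r = r →
    (∀ x ∈ coloured G P, φ x ∈ coloured G P → c (φ x) = c x) → ∀ x ∈ coloured G P, φ x = x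
  processed : ∀ x ∈ P, x ≠ r → c x = z → InOrbit G lab r x →
    ∃ a b, a ≠ b ∧ G.Adj x a ∧ G.Adj x b ∧ c a = c b
  unprocessed : ∀ x ∈ coloured G P, x ∉ P → c x = z → InOrbit G lab r x →
    ∃ y, G.Adj x y ∧ G.dist r y = G.dist r x + 1 ∧ y ∉ coloured G P

theorem mem_coloured_of_mem {P : Set V} {x : V} (hx : x ∈ P) : x ∈ coloured G P :=
  ⟨x, hx, Or.inl rfl⟩

theorem mem_coloured_of_adj {P : Set V} {q x : V} (hq : q ∈ P) (h : G.Adj q x) :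
    x ∈ coloured G P :=
  ⟨q, hq, Or.inr h⟩

/-- The vertex `v` is a possible next vertex: unprocessed, and closest to the root with this
property. -/
structure IsNext (G : SimpleGraph V) (r : V) (P : Set V) (v : V) : Prop where
  root_mem : r ∈ P
  down : ∀ v ∈ P, ∀ u, G.dist r u < G.dist r v → u ∈ P
  notMem : v ∉ P
  le : ∀ u, u ∉ P → G.dist r v ≤ G.dist r u

namespace IsNext

variable {P : Set V} {r v : V}

theorem dist_le_of_mem (h : IsNext G r P v) {q : V} (hq : q ∈ P) : G.dist r q ≤ G.dist r v := by
  by_contra hlt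
  exact h.notMem (h.down q hq v (by omega))

theorem exists_parent_mem (h : IsNext G r P v) (hc : G.Connected) :
    ∃ p ∈ P, G.Adj v p ∧ G.dist r v = G.dist r p + 1 := by
  obtain ⟨p, hp, hd⟩ := exists_parent hc (r := r) (x := v) fun e => h.notMem (e ▸ h.root_mem)
  refine ⟨p, ?_, hp, hd⟩
  by_contra hn
  have := h.le p hn
  omega

theorem mem_coloured (h : IsNext G r P v) (hc : G.Connected) : v ∈ coloured G P := by
  obtain ⟨p, hp, hvp, -⟩ := h.exists_parent_mem hc
  exact mem_coloured_of_adj hp hvp.symm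

theorem of_dist_eq (h : IsNext G r P v) {x : V} (hx : x ∉ P) (hd : G.dist r x = G.dist r v) :
    IsNext G r P x :=
  ⟨h.root_mem, h.down, hx, fun u hu => hd ▸ h.le u hu⟩

theorem dist_le_of_mem_coloured (h : IsNext G r P v) {x : V} (hx : x ∈ coloured G P) :
    G.dist r x ≤ G.dist r v + 1 := by
  obtain ⟨q, hq, rfl | hqx⟩ := hx
  · have := h.dist_le_of_mem hq; omega
  · have := h.dist_le_of_mem hq
    have := hqx.diff_dist_adj (u := r)
    omega

theorem dist_fresh (h : IsNext G r P v) (hc : G.Connected) {u : V} (hu : u ∈ fresh G P v) :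
    G.dist r u = G.dist r v + 1 := by
  have huP : u ∉ P := fun hP => hu.2 (mem_coloured_of_mem hP)
  have h1 := h.le u huP
  have h2 := hu.1.diff_dist_adj (u := r)
  rcases h1.lt_or_eq with h3 | h3
  · omega
  · exact absurd ((h.of_dist_eq huP h3.symm).mem_coloured hc) hu.2

/-- The coloured neighbours of a vertex that is about to be coloured are pending neighbours of the
vertex being processed. -/
theorem mem_pending (h : IsNext G r P v) (hc : G.Connected) (hch : IsChordal G) {u x : V}
    (hu : u ∈ fresh G P v) (hx : x ∈ coloured G P) (hux : G.Adj u x) : x ∈ pending G P v := by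
  have hdu := h.dist_fresh hc hu
  have hxP : x ∉ P := fun hP => hu.2 (mem_coloured_of_adj hP hux.symm)
  refine ⟨?_, hx, hxP⟩
  have h1 := h.le x hxP
  have h2 := h.dist_le_of_mem_coloured hx
  rcases h1.lt_or_eq with h3 | h3
  · obtain ⟨q, hq, rfl | hqx⟩ := hx
    · exact absurd hq hxP
    have hdq := h.dist_le_of_mem hq
    have hdq' := hqx.diff_dist_adj (u := r)
    have hqu : ¬ G.Adj q u := fun hqu => hu.2 (mem_coloured_of_adj hq hqu)
    rcases hch.parents_adj_of_adj hc hux (by omega) hu.1.symm hqx.symm hdu (by omega) with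
      rfl | hvq
    · exact absurd hq h.notMem
    · by_cases hvx : v = x
      · exact Or.inl hvx.symm
      rcases hch.four_cycle hvq hqx hux.symm hu.1.symm hvx
        (fun e => hu.2 (e ▸ mem_coloured_of_mem hq)) with h5 | h5
      · exact Or.inr h5
      · exact absurd h5 hqu
  · rcases hch.parents_adj hc hux hu.1.symm (by omega) hdu with rfl | h4
    · exact Or.inl rfl
    · exact Or.inr h4.symm

theorem card_add_card [Finite V] (h : IsNext G r P v) (hc : G.Connected) :
    (fresh G P v).ncard + (pending G P v).ncard + (G.neighborSet v ∩ P).ncard = deg G v + 1 := by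
  have hv := h.mem_coloured hc
  have hU : insert v (G.neighborSet v) = (fresh G P v ∪ pending G P v) ∪ (G.neighborSet v ∩ P) := by
    ext x
    have hP : x ∈ P → x ∈ coloured G P := mem_coloured_of_mem
    have hvP := h.notMem
    simp only [Set.mem_insert_iff, mem_neighborSet, fresh, pending, Set.mem_union,
      Set.mem_inter_iff,
      Set.mem_ofPred_eq]
    constructor
    · rintro (rfl | hx)
      · tauto
      · tauto
    · tauto
  have hd1 : Disjoint (fresh G P v ∪ pending G P v) (G.neighborSet v ∩ P) := by
    rw [Set.disjoint_left]
    rintro x (hx | hx) hx'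
    · exact hx.2 (mem_coloured_of_mem hx'.2)
    · exact hx.2.2 hx'.2
  have hd2 : Disjoint (fresh G P v) (pending G P v) := by
    rw [Set.disjoint_left]
    exact fun x hx hx' => hx.2 hx'.2.1
  rw [deg, ← Set.ncard_union_eq hd2, ← Set.ncard_union_eq hd1, ← hU,
    Set.ncard_insert_of_notMem (by simp)]

/-- At most `k` colours are needed around `v`: its parent is processed and not counted. -/
theorem card_le [Finite V] (h : IsNext G r P v) (hc : G.Connected) (hk : deg G v ≤ k) :
    (fresh G P v).ncard + (pending G P v).ncard ≤ k := by
  have h1 := h.card_add_card hc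
  obtain ⟨p, hp, hvp, -⟩ := h.exists_parent_mem hc
  have h2 : 0 < (G.neighborSet v ∩ P).ncard := (Set.ncard_pos (Set.toFinite _)).2 ⟨p, hvp, hp⟩
  omega

theorem coloured_insert (h : IsNext G r P v) (hc : G.Connected) :
    coloured G (insert v P) = coloured G P ∪ fresh G P v := by
  ext x
  constructor
  · rintro ⟨q, rfl | hq, hx⟩
    · rcases hx with rfl | hx
      · exact Or.inl (h.mem_coloured hc)
      · by_cases hxC : x ∈ coloured G P
        · exact Or.inl hxC
        · exact Or.inr ⟨hx, hxC⟩
    · exact Or.inl ⟨q, hq, hx⟩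
  · rintro (⟨q, hq, hx⟩ | hx)
    · exact ⟨q, Or.inr hq, hx⟩
    · exact ⟨v, Or.inl rfl, Or.inr hx.1⟩

end IsNext

open Classical in
/-- Processing a vertex `v`: sufficient conditions on the colours `f` of its fresh neighbours. They
are a proper colouring (`hf1`, `hf2`) that breaks all symmetries fixing the coloured vertices
(`hf3`), uses the colour of the root for a vertex of its orbit only if this vertex has a neighbour
in the next level (`hf4`), and gives two neighbours of `v` the same colour if `v` itself could be
mistaken for the root (`hf5`). Other such vertices keep their uncoloured neighbours (`hf6`). -/
theorem State.step {r v : V} {z : Fin k} {P : Set V} {c : V → Fin k}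
    (hs : State G lab r z P c) (hc : G.Connected) (hch : IsChordal G)
    (hle : ∀ u, u ∉ P → G.dist r v ≤ G.dist r u) (hv : v ∉ P) (f : V → Fin k)
    (hf1 : ∀ u ∈ fresh G P v, ∀ w ∈ fresh G P v, G.Adj u w → f u ≠ f w)
    (hf2 : ∀ u ∈ fresh G P v, ∀ y ∈ pending G P v, G.Adj u y → f u ≠ c y)
    (hf3 : ∀ φ : G ≃g G, (∀ x ∈ coloured G P, φ x = x) →
      (∀ u ∈ fresh G P v, φ u ∈ fresh G P v ∧ f (φ u) = f u) → ∀ u ∈ fresh G P v, φ u = u)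
    (hf4 : ∀ u ∈ fresh G P v, f u = z → InOrbit G lab r u →
      ∃ y, G.Adj u y ∧ G.dist r y = G.dist r u + 1)
    (hf5 : c v = z → InOrbit G lab r v → ∃ a b, a ≠ b ∧ G.Adj v a ∧ G.Adj v b ∧
      (if a ∈ fresh G P v then f a else c a) = if b ∈ fresh G P v then f b else c b)
    (hf6 : ∀ x ∈ coloured G P, x ∉ P → x ≠ v → G.dist r x = G.dist r v → c x = z →
      InOrbit G lab r x → ∀ u ∈ fresh G P v, ¬ G.Adj x u) :
    ∃ c', State G lab r z (insert v P) c' := by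
  have hn : IsNext G r P v := ⟨hs.root_mem, hs.down, hv, hle⟩
  set U := fresh G P v with hU
  have hUC : ∀ u ∈ U, u ∉ coloured G P := fun u hu => hu.2
  let c' : V → Fin k := fun x => if x ∈ U then f x else c x
  have hc'U : ∀ u ∈ U, c' u = f u := fun u hu => if_pos hu
  have hc'C : ∀ x ∈ coloured G P, c' x = c x := fun x hx => if_neg fun h => hUC x h hx
  have hCol := hn.coloured_insert hc
  have hrC : r ∈ coloured G P := mem_coloured_of_mem hs.root_mem
  have hrN : ∀ a, G.Adj r a → a ∈ coloured G P := fun a ha => mem_coloured_of_adj hs.root_mem ha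
  refine ⟨c', ⟨Or.inr hs.root_mem, ?_, ?_, ?_, ?_, ?_, ?_, ?_⟩⟩
  · rintro x (rfl | hx) u hu
    · by_contra hun
      have := hle u fun h => hun (Or.inr h)
      omega
    · exact Or.inr (hs.down x hx u hu)
  · rw [hCol]
    rintro x (hx | hx) y (hy | hy) hxy
    · rw [hc'C x hx, hc'C y hy]; exact hs.proper x hx y hy hxy
    · rw [hc'C x hx, hc'U y hy]
      exact (hf2 y hy x (hn.mem_pending hc hch hy hx hxy.symm) hxy.symm).symm
    · rw [hc'U x hx, hc'C y hy]
      exact hf2 x hx y (hn.mem_pending hc hch hx hy hxy) hxy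
    · rw [hc'U x hx, hc'U y hy]; exact hf1 x hx y hy hxy
  · rw [hc'C r hrC]; exact hs.root_color
  · intro a b ha hb hab
    rw [hc'C a (hrN a ha), hc'C b (hrN b hb)] at hab
    exact hs.root_inj a b ha hb hab
  · rw [hCol]
    intro φ hφr hφ
    have hfixC : ∀ x ∈ coloured G P, φ x = x := by
      refine hs.fix φ hφr fun x hx hx' => ?_
      have := hφ x (Or.inl hx) (Or.inl hx')
      rwa [hc'C x hx, hc'C _ hx'] at this
    have hUU : ∀ u ∈ U, φ u ∈ U := by
      intro u hu
      refine ⟨?_, fun hφu => ?_⟩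
      · rw [← hfixC v (hn.mem_coloured hc)]
        exact φ.map_adj_iff.2 hu.1
      · exact hUC u hu (φ.injective (hfixC _ hφu) ▸ hφu)
    have hfixU := hf3 φ hfixC fun u hu => ⟨hUU u hu, by
      have := hφ u (Or.inr hu) (Or.inr (hUU u hu))
      rwa [hc'U u hu, hc'U _ (hUU u hu)] at this⟩
    rintro x (hx | hx)
    · exact hfixC x hx
    · exact hfixU x hx
  · rintro x (rfl | hx) hxr hxz hxo
    · exact hf5 (by rwa [hc'C x (hn.mem_coloured hc)] at hxz) hxo
    · rw [hc'C x (mem_coloured_of_mem hx)] at hxz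
      obtain ⟨a, b, hab, ha, hb, heq⟩ := hs.processed x hx hxr hxz hxo
      refine ⟨a, b, hab, ha, hb, ?_⟩
      rwa [hc'C a (mem_coloured_of_adj hx ha), hc'C b (mem_coloured_of_adj hx hb)]
  · rw [hCol]
    rintro x (hx | hx) hxP hxz hxo
    · rw [hc'C x hx] at hxz
      have hxv : x ≠ v := fun e => hxP (Or.inl e)
      have hxP' : x ∉ P := fun h => hxP (Or.inr h)
      obtain ⟨y, hxy, hy, hyC⟩ := hs.unprocessed x hx hxP' hxz hxo
      refine ⟨y, hxy, hy, ?_⟩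
      rintro (h | h)
      · exact hyC h
      · have hd := hn.dist_fresh hc h
        exact hf6 x hx hxP' hxv (by omega) hxz hxo y h hxy
    · rw [hc'U x hx] at hxz
      obtain ⟨y, hxy, hy⟩ := hf4 x hx hxz hxo
      have hd := hn.dist_fresh hc hx
      refine ⟨y, hxy, hy, ?_⟩
      rintro (h | h)
      · have := hn.dist_le_of_mem_coloured h; omega
      · have := hn.dist_fresh hc h; omega

end Colouring

/-! ### Where the colouring gets stuck -/

section Stuck

variable {V L : Type*} {G : SimpleGraph V} {lab : V → L} {k : ℕ}

theorem deg_map {W : Type*} {H : SimpleGraph W} (γ : G ≃g H) (v : V) :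
    deg H (γ v) = deg G v := by
  have : H.neighborSet (γ v) = γ '' G.neighborSet v := by
    ext x
    rw [mem_neighborSet]
    constructor
    · intro h
      refine ⟨γ.symm x, ?_, γ.apply_symm_apply x⟩
      rw [mem_neighborSet, ← γ.map_adj_iff, γ.apply_symm_apply]; exact h
    · rintro ⟨y, hy, rfl⟩
      exact γ.map_adj_iff.2 hy
  rw [deg, deg, this, Set.ncard_image_of_injective _ γ.injective]

theorem InOrbit.deg_eq {r w : V} (h : InOrbit G lab r w) : deg G w = deg G r := by
  obtain ⟨γ, -, rfl⟩ := h
  exact deg_map γ r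

/-- A pendant part of a graph: `D` is a clique, `U` is a clique (if `τ` holds) or independent
(otherwise), all vertices in `D` are adjacent to all in `U`, and `p` is the only other vertex
with neighbours in `D ∪ U`, being adjacent to `D` only. -/
structure IsPiece (G : SimpleGraph V) (k : ℕ) (p : V) (D U : Set V) (τ : Prop) : Prop where
  nonempty_D : D.Nonempty
  nonempty_U : U.Nonempty
  notMem_D : p ∉ D
  notMem_U : p ∉ U
  disj : Disjoint D U
  adj_D : ∀ x ∈ D, ∀ y, G.Adj x y ↔ y ≠ x ∧ (y = p ∨ y ∈ D ∨ y ∈ U)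
  adj_U : ∀ w ∈ U, ∀ y, G.Adj w y ↔ y ∈ D ∨ (y ∈ U ∧ y ≠ w ∧ τ)
  card : D.ncard + U.ncard = k

/-- A vertex of the orbit of `r` with the colour of `r` is processed so that it gets two neighbours
of the same colour: one of its fresh neighbours can take the colour of its parent. -/
theorem State.step_of_eq [Finite V] {r v : V} {z : Fin k} {P : Set V} {c : V → Fin k}
    (hs : State G lab r z P c) (hc : G.Connected) (hch : IsChordal G)
    (hdeg : ∀ v, deg G v ≤ k) (hn : IsNext G r P v) (hvz : c v = z) (hvo : InOrbit G lab r v) :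
    ∃ c', State G lab r z (insert v P) c' := by
  have hvC := hn.mem_coloured hc
  have hcard := hn.card_le hc (hdeg v)
  have himg : (c '' pending G P v).ncard ≤ (pending G P v).ncard :=
    Set.ncard_image_le (Set.toFinite _)
  have hvQ : v ∈ pending G P v := ⟨Or.inl rfl, hvC, hn.notMem⟩
  obtain ⟨p, hpP, hvp, -⟩ := hn.exists_parent_mem hc
  have hpC : p ∈ coloured G P := mem_coloured_of_mem hpP
  have hpU : p ∉ fresh G P v := fun h => h.2 hpC
  obtain ⟨y, hvy, -, hyC⟩ := hs.unprocessed v hvC hn.notMem hvz hvo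
  have hyU : y ∈ fresh G P v := ⟨hvy, hyC⟩
  classical
  obtain ⟨f, hinj, hav, h5⟩ : ∃ f : V → Fin k, Set.InjOn f (fresh G P v) ∧
      (∀ u ∈ fresh G P v, f u ∉ c '' pending G P v) ∧
      ∃ a b, a ≠ b ∧ G.Adj v a ∧ G.Adj v b ∧
      (if a ∈ fresh G P v then f a else c a) = if b ∈ fresh G P v then f b else c b := by
    by_cases hp : c p ∈ c '' pending G P v
    · obtain ⟨f, hinj, hav⟩ := exists_injOn_avoid z (fresh G P v) (c '' pending G P v) (by omega)
      refine ⟨f, hinj, hav, ?_⟩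
      obtain ⟨q, hq, hqp⟩ := hp
      have hqv : q ≠ v := by
        rintro rfl
        exact hs.proper _ hvC _ hpC hvp hqp
      have hvq : G.Adj v q := hq.1.resolve_left hqv
      refine ⟨p, q, fun e => hq.2.2 (e ▸ hpP), hvp, hvq, ?_⟩
      rw [if_neg hpU, if_neg fun h => h.2 hq.2.1, hqp]
    · obtain ⟨f, hfy, hinj, hav⟩ := exists_injOn_avoid_of_mem (U := fresh G P v)
        (F := c '' pending G P v) (by omega) hyU hp
      refine ⟨f, hinj, hav, p, y, fun e => hyC (e ▸ hpC), hvp, hvy, ?_⟩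
      rw [if_neg hpU, if_pos hyU, hfy]
  refine hs.step hc hch hn.le hn.notMem f ?_ ?_ ?_ ?_ (fun _ _ => h5) ?_
  · intro u hu w hw huw h
    exact huw.ne (hinj hu hw h)
  · intro u hu y hy _ h
    exact hav u hu ⟨y, hy, h.symm⟩
  · intro φ _ hφ u hu
    exact hinj (hφ u hu).1 hu (hφ u hu).2
  · intro u hu hfz
    exact absurd ⟨v, hvQ, hvz.trans hfz.symm⟩ (hav u hu)
  · intro x hx hxP hxv hxd hxz _ u hu hxu
    have hd := hn.dist_fresh hc hu
    rcases hch.parents_adj hc (r := r) hxu.symm hu.1.symm (by omega) hd with h | h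
    · exact hxv h
    · exact hs.proper x hx v hvC h (hxz.trans hvz.symm)

/-- The situation in which the colour of the root cannot be avoided when `v` is processed: every
colour is needed on the fresh neighbours of `v` or occurs on a pending one, and all fresh neighbours
are vertices of the orbit of `r` without neighbours in the next level. -/
structure Troubled (G : SimpleGraph V) (lab : V → L) (k : ℕ) (r : V) (P : Set V) (v : V) :
    Prop where
  nonempty : (fresh G P v).Nonempty
  card : (fresh G P v).ncard + (pending G P v).ncard = k
  orbit : ∀ u ∈ fresh G P v, InOrbit G lab r u
  terminal : ∀ u ∈ fresh G P v, ∀ y, G.Adj u y → G.dist r y ≠ G.dist r u + 1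
  adj : ∀ y ∈ pending G P v, ∀ w ∈ fresh G P v, G.Adj y w
  twin : ∀ w₁ ∈ fresh G P v, ∀ w₂ ∈ fresh G P v, ∀ w₃ ∈ fresh G P v, w₁ ≠ w₂ → ¬ G.Adj w₁ w₂ →
    G.Adj w₁ w₃ → G.Adj w₂ w₃

/-- If no next vertex could be mistaken for the root, then `v` can be processed unless it is in
trouble. Distinct colours off the pending ones are available for the fresh neighbours, and one
colour to spare is enough to avoid the colour of the root. -/
theorem State.step_or_troubled [Finite V] {r v : V} {z : Fin k} {P : Set V} {c : V → Fin k}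
    (hs : State G lab r z P c) (hc : G.Connected) (hch : IsChordal G)
    (hdeg : ∀ v, deg G v ≤ k) (hn : IsNext G r P v)
    (hno : ∀ x, IsNext G r P x → c x = z → ¬ InOrbit G lab r x) :
    (∃ c', State G lab r z (insert v P) c') ∨ Troubled G lab k r P v := by
  by_contra! hcon
  obtain ⟨hstep, htr⟩ := hcon
  have hcard := hn.card_le hc (hdeg v)
  have himg : (c '' (pending G P v)).ncard ≤ (pending G P v).ncard :=
    Set.ncard_image_le (Set.toFinite _)
  -- no colouring of the fresh vertices satisfies the conditions of `State.step`; the remaining two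
  -- of these conditions hold by `hno`
  have step' : ∀ f : V → Fin k, (∀ u ∈ (fresh G P v), ∀ w ∈ (fresh G P v), G.Adj u w → f u ≠ f w) →
      (∀ u ∈ (fresh G P v), ∀ y ∈ (pending G P v), G.Adj u y → f u ≠ c y) →
      (∀ φ : G ≃g G, (∀ x ∈ coloured G P, φ x = x) →
        (∀ u ∈ (fresh G P v), φ u ∈ (fresh G P v) ∧ f (φ u) = f u) → ∀ u ∈ (fresh G P v), φ u = u) →
      (∀ u ∈ (fresh G P v), f u = z → InOrbit G lab r u →
        ∃ y, G.Adj u y ∧ G.dist r y = G.dist r u + 1) →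
      False := by
    intro f h1 h2 h3 h4
    obtain ⟨c', hc'⟩ := hs.step hc hch hn.le hn.notMem f h1 h2 h3 h4
      (fun h h' => absurd h' (hno v hn h))
      (fun x _ hxP _ hxd hxz hxo => absurd hxo (hno x (hn.of_dist_eq hxP hxd) hxz))
    exact hstep c' hc'
  have stepInj : ∀ f : V → Fin k, Set.InjOn f (fresh G P v) →
      (∀ u ∈ (fresh G P v), ∀ y ∈ (pending G P v), G.Adj u y → f u ≠ c y) →
      (∀ u ∈ (fresh G P v), f u = z → InOrbit G lab r u →
        ∃ y, G.Adj u y ∧ G.dist r y = G.dist r u + 1) →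
      False := by
    intro f h1 h2 h4
    exact step' f (fun u hu w hw huw h => huw.ne (h1 hu hw h)) h2
      (fun φ _ hφ u hu => h1 (hφ u hu).1 hu (hφ u hu).2) h4
  have hz : z ∉ c '' (pending G P v) := by
    intro hz
    obtain ⟨f, hinj, hav⟩ := exists_injOn_avoid z (fresh G P v) (c '' (pending G P v)) (by omega)
    exact stepInj f hinj (fun u hu y hy _ h => hav u hu ⟨y, hy, h.symm⟩)
      fun u hu hfz => absurd (hfz ▸ hz) (hav u hu)
  have hins : (insert z (c '' (pending G P v))).ncard = (c '' (pending G P v)).ncard + 1 :=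
    Set.ncard_insert_of_notMem hz
  -- there is no spare colour
  have hk : k ≤ (fresh G P v).ncard + (c '' (pending G P v)).ncard := by
    by_contra hlt
    obtain ⟨f, hinj, hav⟩ := exists_injOn_avoid z (fresh G P v)
      (insert z (c '' (pending G P v))) (by omega)
    exact stepInj f hinj (fun u hu y hy _ h => hav u hu (Or.inr ⟨y, hy, h.symm⟩))
      fun u hu hfz => absurd (Or.inl hfz) (hav u hu)
  have hQinj : Set.InjOn c (pending G P v) := Set.injOn_of_ncard_image_eq (by omega)
  -- otherwise `u₀` takes the colour of the root
  have hterm : ∀ u ∈ (fresh G P v), InOrbit G lab r u ∧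
      ∀ y, G.Adj u y → G.dist r y ≠ G.dist r u + 1 := by
    intro u₀ hu₀
    by_contra hbad
    obtain ⟨f, hfu, hinj, hav⟩ :=
      exists_injOn_avoid_of_mem (F := c '' (pending G P v)) (by omega) hu₀ hz
    refine stepInj f hinj (fun u hu y hy _ h => hav u hu ⟨y, hy, h.symm⟩) fun u hu hfz ho => ?_
    have : u = u₀ := hinj hu hu₀ (hfz.trans hfu.symm)
    subst this
    by_contra! hne
    exact hbad ⟨ho, hne⟩
  have hne : (fresh G P v).Nonempty := by
    rw [Set.nonempty_iff_ne_empty]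
    intro he
    rw [he, Set.ncard_empty, zero_add] at hk
    have h := Set.eq_univ_of_univ_subset ((Set.eq_of_subset_of_ncard_le
      (Set.subset_univ (c '' (pending G P v))) (by simpa using hk)).ge)
    exact hz (h ▸ Set.mem_univ z)
  refine htr ⟨hne, by omega, fun u hu => (hterm u hu).1, fun u hu => (hterm u hu).2, ?_, ?_⟩
  · -- a fresh vertex not adjacent to a pending one can take its colour
    intro y hy w hw
    by_contra hyw
    have hcy : c y ∈ c '' (pending G P v) := ⟨y, hy, rfl⟩
    have h1 := Set.ncard_sdiff_singleton_add_one hcy (Set.toFinite _)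
    have h2 := Set.ncard_insert_le z (c '' (pending G P v) \ {c y})
    have hnot : c y ∉ insert z (c '' (pending G P v) \ {c y}) := by
      rintro (h | h)
      · exact hz (h ▸ hcy)
      · exact h.2 rfl
    obtain ⟨f, hfw, hinj, hav⟩ := exists_injOn_avoid_of_mem
      (F := insert z (c '' (pending G P v) \ {c y})) (by omega) hw hnot
    refine stepInj f hinj (fun u hu y' hy' huy' h => ?_)
      fun u hu hfz => absurd (Or.inl hfz) (hav u hu)
    by_cases hyy : c y' = c y
    · have : u = w := hinj hu hw (by rw [hfw, h, hyy])
      subst this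
      rw [hQinj hy' hy hyy] at huy'
      exact hyw huy'.symm
    · exact hav u hu (Or.inr ⟨⟨y', hy', h.symm⟩, by rw [h]; exact hyy⟩)
  · -- two nonadjacent fresh vertices that a third one distinguishes can have the same colour
    intro w₁ h₁ w₂ h₂ w₃ h₃ hne hnadj h₁₃
    by_contra h₂₃
    have hU1 := Set.ncard_sdiff_singleton_add_one h₁ (Set.toFinite (fresh G P v))
    obtain ⟨f, hinj, hav⟩ := exists_injOn_avoid z ((fresh G P v) \ {w₁})
      (insert z (c '' (pending G P v))) (by omega)
    classical
    let f' : V → Fin k := Function.update f w₁ (f w₂)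
    have hf1 : f' w₁ = f w₂ := Function.update_self ..
    have hf2 : ∀ u, u ≠ w₁ → f' u = f u := fun u hu => Function.update_of_ne hu ..
    have hw2 : w₂ ∈ (fresh G P v) \ {w₁} := ⟨h₂, fun h => hne h.symm⟩
    have hav' : ∀ u ∈ (fresh G P v), f' u ∉ insert z (c '' (pending G P v)) := by
      intro u hu
      by_cases h : u = w₁
      · subst h; rw [hf1]; exact hav w₂ hw2
      · rw [hf2 u h]; exact hav u ⟨hu, h⟩
    have hinj' : ∀ u ∈ (fresh G P v), ∀ w ∈ (fresh G P v), f' u = f' w → u = w ∨ (u = w₁ ∧ w = w₂) ∨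
        (u = w₂ ∧ w = w₁) := by
      intro u hu w hw h
      by_cases hu1 : u = w₁ <;> by_cases hw1 : w = w₁
      · exact Or.inl (hu1.trans hw1.symm)
      · rw [hu1, hf1, hf2 w hw1] at h
        exact Or.inr (Or.inl ⟨hu1, (hinj hw2 ⟨hw, hw1⟩ h).symm⟩)
      · rw [hw1, hf1, hf2 u hu1] at h
        exact Or.inr (Or.inr ⟨hinj ⟨hu, hu1⟩ hw2 h, hw1⟩)
      · rw [hf2 u hu1, hf2 w hw1] at h
        exact Or.inl (hinj ⟨hu, hu1⟩ ⟨hw, hw1⟩ h)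
    refine step' f' ?_ (fun u hu y hy _ h => hav' u hu (Or.inr ⟨y, hy, h.symm⟩)) ?_
      fun u hu hfz => absurd (Or.inl hfz) (hav' u hu)
    · intro u hu w hw huw h
      rcases hinj' u hu w hw h with rfl | ⟨rfl, rfl⟩ | ⟨rfl, rfl⟩
      · exact huw.ne rfl
      · exact hnadj huw
      · exact hnadj huw.symm
    · intro φ _ hφ
      have h3 : φ w₃ = w₃ := by
        rcases hinj' _ (hφ w₃ h₃).1 _ h₃ (hφ w₃ h₃).2 with h | ⟨-, h⟩ | ⟨-, h⟩
        · exact h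
        · exact absurd (h ▸ h₁₃) hnadj
        · exact absurd h h₁₃.ne'
      have h1 : φ w₁ = w₁ := by
        rcases hinj' _ (hφ w₁ h₁).1 _ h₁ (hφ w₁ h₁).2 with h | ⟨-, h⟩ | ⟨h, -⟩
        · exact h
        · exact absurd h hne
        · exact absurd (h3 ▸ h ▸ φ.map_adj_iff.2 h₁₃) h₂₃
      intro u hu
      rcases hinj' _ (hφ u hu).1 _ hu (hφ u hu).2 with h | ⟨h, h'⟩ | ⟨h, h'⟩
      · exact h
      · exact absurd (φ.injective (h.trans h1.symm) ▸ h') hne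
      · exact h' ▸ h1

/-- If all next vertices are in trouble, then the pending and the fresh vertices around one of them
are the sets `D` and `U` of a pendant part. As these are `k` vertices and the degree of `v` is at
most `k`, the vertex `v` has only one processed neighbour, and the same is true for all vertices
of `D`. -/
theorem IsNext.isPiece_of_troubled [Finite V] {r v : V} {P : Set V}
    (hc : G.Connected) (hch : IsChordal G)
    (hdeg : ∀ v, deg G v ≤ k) (hn : IsNext G r P v)
    (htr : ∀ x, IsNext G r P x → Troubled G lab k r P x) :
    ∃ p D U τ, IsPiece G k p D U τ ∧ (∀ w ∈ U, InOrbit G lab r w) ∧ r ∉ D ∧ r ∉ U := by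
  have hvC := hn.mem_coloured hc
  have hT := htr v hn
  have huniq : ∀ x, IsNext G r P x → ∀ p q, p ∈ P → q ∈ P → G.Adj x p → G.Adj x q → p = q := by
    intro x hx p q hp hq hxp hxq
    have h1 := hx.card_add_card hc
    have h2 := (htr x hx).card
    have h3 := hdeg x
    exact (Set.ncard_le_one (Set.toFinite _)).1
      (show (G.neighborSet x ∩ P).ncard ≤ 1 by omega) p ⟨hxp, hp⟩ q ⟨hxq, hq⟩
  -- pending vertices are in the level of `v`: a processed parent of one in the next level would be
  -- a second processed neighbour of `x`
  have hlev : ∀ x, IsNext G r P x → ∀ y ∈ pending G P x, IsNext G r P y := by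
    intro x hx y hy
    refine hx.of_dist_eq hy.2.2 ?_
    rcases hy.1 with rfl | hxy
    · rfl
    have h1 := hx.le y hy.2.2
    have h2 := hx.dist_le_of_mem_coloured hy.2.1
    by_contra hne
    obtain ⟨q, hq, rfl | hqy⟩ := hy.2.1
    · exact hy.2.2 hq
    have h3 := hx.dist_le_of_mem hq
    have h4 := hqy.diff_dist_adj (u := r)
    obtain ⟨p, hp, hxp, hdp⟩ := hx.exists_parent_mem hc
    rcases hch.parents_adj hc (r := r) hqy.symm hxy.symm (by omega) (by omega) with h | h
    · exact hx.notMem (h ▸ hq)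
    · have := huniq x hx p q hp hq hxp h.symm
      subst this
      omega
  have hdv : ∀ x, IsNext G r P x → G.dist r x = G.dist r v := fun x hx =>
    le_antisymm (hx.le v hn.notMem) (hn.le x hx.notMem)
  have hsymm : ∀ x, IsNext G r P x → ∀ y ∈ pending G P x, x ∈ pending G P y := by
    intro x hx y hy
    refine ⟨?_, hx.mem_coloured hc, hx.notMem⟩
    rcases hy.1 with h | h
    · exact Or.inl h.symm
    · exact Or.inr h.symm
  have hUsub : ∀ x, IsNext G r P x → ∀ y ∈ pending G P x, fresh G P x ⊆ fresh G P y :=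
    fun x hx y hy u hu => ⟨(htr x hx).adj y hy u hu, hu.2⟩
  have hUeq : ∀ y ∈ pending G P v, fresh G P y = fresh G P v := fun y hy =>
    (hUsub y (hlev v hn y hy) v (hsymm v hn y hy)).antisymm (hUsub v hn y hy)
  obtain ⟨w₀, hw₀⟩ := hT.nonempty
  have hQsub : ∀ x, IsNext G r P x → ∀ y ∈ pending G P x, pending G P y ⊆ pending G P x := by
    intro x hx y hy q hq
    obtain ⟨w, hw⟩ := (htr x hx).nonempty
    have hy' := hlev x hx y hy
    have hq' := hlev y hy' q hq
    have hwq := (htr y hy').adj q hq w (hUsub x hx y hy hw)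
    have hdw := hx.dist_fresh hc hw
    have h1 := hdv x hx
    have h2 := hdv q hq'
    refine ⟨?_, hq.2⟩
    rcases hch.parents_adj hc (r := r) hw.1.symm hwq.symm hdw (by omega) with h | h
    · exact Or.inl h.symm
    · exact Or.inr h
  obtain ⟨p, hpP, hvp, hdp⟩ := hn.exists_parent_mem hc
  have hpC : p ∈ coloured G P := mem_coloured_of_mem hpP
  have hparent : ∀ x ∈ pending G P v, ∀ q ∈ P, G.Adj x q → q = p := by
    intro x hx q hq hxq
    have hx' := hlev v hn x hx
    obtain ⟨q', hq', hxq', hdq'⟩ := hx'.exists_parent_mem hc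
    rw [huniq x hx' q q' hq hq' hxq hxq']
    rcases hx.1 with rfl | hvx
    · exact huniq _ hn _ _ hq' hpP hxq' hvp
    have hdx := hdv x hx'
    rcases hch.parents_adj_of_adj hc (r := r) hvx hdx.symm hvp hxq' hdp (by omega) with h | h
    · exact h.symm
    rcases hch.four_cycle hvx hxq' h.symm hvp.symm
        (fun e => hn.notMem (e ▸ hq')) (fun e => hx'.notMem (e ▸ hpP)) with h | h
    · exact huniq v hn _ _ hq' hpP h hvp
    · exact huniq x hx' _ _ hq' hpP hxq' h
  have hxp : ∀ x ∈ pending G P v, G.Adj x p := by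
    intro x hx
    obtain ⟨q', hq', hxq', -⟩ := (hlev v hn x hx).exists_parent_mem hc
    exact hparent x hx q' hq' hxq' ▸ hxq'
  -- fresh vertices have no neighbours outside the pendant part
  have hNU : ∀ w ∈ fresh G P v, ∀ y, G.Adj w y → y ∈ pending G P v ∨ y ∈ fresh G P v := by
    intro w hw y hwy
    by_cases hyC : y ∈ coloured G P
    · exact Or.inl (hn.mem_pending hc hch hw hyC hwy)
    right
    have hyP : y ∉ P := fun h => hyC (mem_coloured_of_mem h)
    have h1 := hn.le y hyP
    have h2 := hn.dist_fresh hc hw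
    have h3 := hT.terminal w hw y hwy
    have h4 := hwy.diff_dist_adj (u := r)
    have h5 : G.dist r y ≠ G.dist r v := fun h =>
      hyC ((hn.of_dist_eq hyP h).mem_coloured hc)
    obtain ⟨v', hyv', hdv'⟩ := exists_parent hc (r := r) (x := y) fun e => by
      rw [e, dist_self] at h1 h5; omega
    have hv'P : v' ∉ P := fun h => hyC (mem_coloured_of_adj h hyv'.symm)
    have hv' := hn.of_dist_eq hv'P (by omega)
    have hv'Q : v' ∈ pending G P v := by
      refine ⟨?_, hv'.mem_coloured hc, hv'P⟩
      rcases hch.parents_adj_of_adj hc (r := r) hwy (by omega) hw.1.symm hyv' h2 (by omega)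
        with h | h
      · exact Or.inl h.symm
      · exact Or.inr h
    rw [← hUeq v' hv'Q]
    exact ⟨hyv'.symm, hyC⟩
  have hdisj : Disjoint (pending G P v) (fresh G P v) := by
    rw [Set.disjoint_left]
    exact fun x hx hx' => hx'.2 hx.2.1
  -- the graph induced by the fresh vertices is regular, as these are in one orbit
  have hdegU : ∀ w ∈ fresh G P v,
      (pending G P v).ncard + (G.neighborSet w ∩ fresh G P v).ncard = deg G r := by
    intro w hw
    rw [← (hT.orbit w hw).deg_eq, deg,
      ← Set.ncard_union_eq (hdisj.mono_right Set.inter_subset_right)]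
    congr 1
    ext y
    constructor
    · rintro (h | h)
      · exact (hT.adj y h w hw).symm
      · exact h.1
    · intro h
      rcases hNU w hw y h with h' | h'
      · exact Or.inl h'
      · exact Or.inr ⟨h, h'⟩
  -- if there is an edge between fresh vertices, they form a clique: otherwise they would induce
  -- a complete multipartite graph whose parts have the same size, at least two
  have hclique : ∀ a ∈ fresh G P v, ∀ b ∈ fresh G P v, G.Adj a b →
      ∀ w ∈ fresh G P v, ∀ y ∈ fresh G P v, y ≠ w → G.Adj w y := by
    intro a ha b hb hab w hw y hy hyw
    by_contra hwy
    have hda := hdegU a ha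
    have hdw := hdegU w hw
    have hpos : 0 < (G.neighborSet a ∩ fresh G P v).ncard :=
      (Set.ncard_pos (Set.toFinite _)).2 ⟨b, hab, hb⟩
    obtain ⟨w₃, hww₃, hw₃⟩ := (Set.ncard_pos (Set.toFinite _)).1
      (show 0 < (G.neighborSet w ∩ fresh G P v).ncard by omega)
    have hww₃' : G.Adj w w₃ := hww₃
    have hyw₃ := hT.twin w hw y hy w₃ hw₃ hyw.symm hwy hww₃'
    have hd₃ := hdegU w₃ hw₃
    obtain ⟨w₄, hw₄, hw₄₃, hn₄⟩ : ∃ w₄ ∈ fresh G P v, w₃ ≠ w₄ ∧ ¬ G.Adj w₃ w₄ := by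
      by_contra! hall
      have hsub : fresh G P v \ {w₃} ⊆ G.neighborSet w₃ ∩ fresh G P v := fun x hx =>
        ⟨hall x hx.1 fun e => hx.2 e.symm, hx.1⟩
      have h1 := Set.ncard_le_ncard hsub (Set.toFinite _)
      have h2 := Set.ncard_sdiff_singleton_add_one hw₃ (Set.toFinite _)
      have h3 := Set.ncard_sdiff_singleton_add_one hw (Set.toFinite _)
      have h4 : G.neighborSet w ∩ fresh G P v ⊆ (fresh G P v \ {w}) \ {y} := by
        rintro x ⟨hx, hxU⟩
        have hx' : G.Adj w x := hx
        exact ⟨⟨hxU, hx'.ne'⟩, fun e => hwy (e ▸ hx')⟩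
      have h5 := Set.ncard_le_ncard h4 (Set.toFinite _)
      have h6 := Set.ncard_sdiff_singleton_add_one (show y ∈ fresh G P v \ {w} from ⟨hy, hyw⟩)
        (Set.toFinite _)
      omega
    have hw₄w := hT.twin w₃ hw₃ w₄ hw₄ w hw hw₄₃ hn₄ hww₃'.symm
    have hw₄y := hT.twin w₃ hw₃ w₄ hw₄ y hy hw₄₃ hn₄ hyw₃.symm
    rcases hch.four_cycle hww₃' hyw₃.symm hw₄y.symm hw₄w hyw.symm hw₄₃ with h | h
    · exact hwy h
    · exact hn₄ h
  have hrC : r ∈ coloured G P := mem_coloured_of_mem hn.root_mem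
  refine ⟨p, pending G P v, fresh G P v, ∃ a ∈ fresh G P v, ∃ b ∈ fresh G P v, G.Adj a b,
    ⟨⟨v, Or.inl rfl, hvC, hn.notMem⟩, hT.nonempty, fun h => h.2.2 hpP, fun h => h.2 hpC, hdisj,
      ?_, ?_, by have := hT.card; omega⟩, hT.orbit, fun h => h.2.2 hn.root_mem, fun h => h.2 hrC⟩
  · intro x hx y
    constructor
    · intro hxy
      refine ⟨hxy.ne', ?_⟩
      by_cases hyP : y ∈ P
      · exact Or.inl (hparent x hx y hyP hxy)
      · by_cases hyC : y ∈ coloured G P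
        · exact Or.inr (Or.inl (hQsub v hn x hx ⟨Or.inr hxy, hyC, hyP⟩))
        · right; right
          rw [← hUeq x hx]
          exact ⟨hxy, hyC⟩
    · rintro ⟨hyx, rfl | hy | hy⟩
      · exact hxp x hx
      · have hd := hn.dist_fresh hc hw₀
        have h1 := hdv x (hlev v hn x hx)
        have h2 := hdv y (hlev v hn y hy)
        exact (hch.parents_adj hc (r := r) (hT.adj x hx w₀ hw₀).symm (hT.adj y hy w₀ hw₀).symm
          (by omega) (by omega)).resolve_left hyx.symm
      · exact hT.adj x hx y hy
  · intro w hw y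
    constructor
    · intro hwy
      rcases hNU w hw y hwy with h | h
      · exact Or.inl h
      · exact Or.inr ⟨h, hwy.ne', w, hw, y, h, hwy⟩
    · rintro (h | ⟨hy, hyw, a, ha, b, hb, hab⟩)
      · exact (hT.adj y h w hw).symm
      · exact hclique a ha b hb hab w hw y hy hyw

/-- The root gets the colour `z`, its neighbours get distinct other colours. -/
theorem exists_initial_state [Finite V] (z : Fin k) {r : V} (hr : deg G r < k) :
    ∃ c, State G lab r z {r} c := by
  obtain ⟨f, hinj, hav⟩ := exists_injOn_avoid z (G.neighborSet r) {z}
    (by rw [Set.ncard_singleton]; exact hr)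
  classical
  let c : V → Fin k := fun x => if x = r then z else f x
  have hcr : c r = z := if_pos rfl
  have hcN : ∀ x, G.Adj r x → c x = f x := fun x hx => if_neg hx.ne'
  have hcz : ∀ x, G.Adj r x → c x ≠ z := fun x hx => by rw [hcN x hx]; exact hav x hx
  have hinj' : ∀ a b, G.Adj r a → G.Adj r b → c a = c b → a = b := by
    intro a b ha hb h
    rw [hcN a ha, hcN b hb] at h
    exact hinj ha hb h
  have hC : ∀ x ∈ coloured G {r}, x = r ∨ G.Adj r x := by
    rintro x ⟨q, rfl, h⟩; exact h
  refine ⟨c, ⟨rfl, ?_, ?_, hcr, hinj', ?_, ?_, ?_⟩⟩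
  · rintro v rfl u hu
    rw [dist_self] at hu; omega
  · intro x hx y hy hxy
    rcases hC x hx with rfl | hx' <;> rcases hC y hy with rfl | hy'
    · exact absurd hxy (SimpleGraph.irrefl _)
    · rw [hcr]; exact (hcz y hy').symm
    · rw [hcr]; exact hcz x hx'
    · exact fun h => hxy.ne (hinj' x y hx' hy' h)
  · intro φ hφr hφ x hx
    rcases hC x hx with rfl | hx'
    · exact hφr
    · have hφx : G.Adj r (φ x) := by
        have := φ.map_adj_iff.2 hx'
        rwa [hφr] at this
      exact hinj' _ _ hφx hx' (hφ x hx (mem_coloured_of_adj rfl hφx))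
  · rintro x rfl h; exact absurd rfl h
  · intro x hx hxr hxz
    rcases hC x hx with rfl | hx'
    · exact absurd rfl hxr
    · exact absurd hxz (hcz x hx')

/-- If a vertex `r` has degree less than `k` in a graph of maximum degree at most `k`, then the
level by level colouring from `r` succeeds, or it meets a pendant part whose vertices outside the
clique `D` are all in the orbit of `r`. -/
theorem labColorable_or_isPiece [Finite V] (hc : G.Connected) (hch : IsChordal G)
    (hdeg : ∀ v, deg G v ≤ k) {r : V} (hr : deg G r < k) : LabColorable G lab k ∨
    ∃ p D U τ, IsPiece G k p D U τ ∧ (∀ w ∈ U, InOrbit G lab r w) ∧ r ∉ D ∧ r ∉ U := by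
  by_contra! hcon
  obtain ⟨hcol, hpiece⟩ := hcon
  let z : Fin k := ⟨0, by omega⟩
  have main : ∀ n, ∀ (P : Set V) (c : V → Fin k), Pᶜ.ncard = n → State G lab r z P c → False := by
    intro n
    induction n using Nat.strong_induction_on with
    | _ n ih =>
    intro P c hP hs
    by_cases hall : ∀ v, v ∈ P
    · refine hcol ⟨c, fun a b hab => hs.proper a (mem_coloured_of_mem (hall a)) b
        (mem_coloured_of_mem (hall b)) hab, fun φ hlab hφ => ?_⟩
      -- the image of `r` has two neighbours of the same colour unless it is `r`
      have hφr : φ r = r := by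
        by_contra hne
        obtain ⟨a, b, hab, ha, hb, heq⟩ := hs.processed (φ r) (hall _) hne
          ((hφ r).trans hs.root_color) ⟨φ, hlab, rfl⟩
        have hsym : ∀ x, c (φ.symm x) = c x := fun x => by
          rw [← hφ (φ.symm x), φ.apply_symm_apply]
        have hadj : ∀ x, G.Adj (φ r) x → G.Adj r (φ.symm x) := fun x hx => by
          rw [← φ.map_adj_iff, φ.apply_symm_apply]; exact hx
        exact hab (φ.symm.injective (hs.root_inj _ _ (hadj a ha) (hadj b hb)
          (by rw [hsym, hsym, heq])))
      intro v
      exact hs.fix φ hφr (fun x _ _ => hφ x) v (mem_coloured_of_mem (hall v))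
    push Not at hall
    obtain ⟨v, hv, hmin⟩ := Set.exists_min_image (Pᶜ) (fun x => G.dist r x) (Set.toFinite _) hall
    have hn : IsNext G r P v := ⟨hs.root_mem, hs.down, hv, fun u hu => hmin u hu⟩
    have next : ∀ x, IsNext G r P x → ¬ ∃ c', State G lab r z (insert x P) c' := by
      rintro x hx ⟨c', hs'⟩
      refine ih _ ?_ _ c' rfl hs'
      rw [← hP]
      refine Set.ncard_lt_ncard ?_ (Set.toFinite _)
      rw [Set.ssubset_iff_of_subset (Set.compl_subset_compl.2 (Set.subset_insert x P))]
      exact ⟨x, hx.notMem, fun h => h (Set.mem_insert x P)⟩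
    have hno : ∀ x, IsNext G r P x → c x = z → ¬ InOrbit G lab r x := fun x hx hxz hxo =>
      next x hx (hs.step_of_eq hc hch hdeg hx hxz hxo)
    obtain ⟨p, D, U, τ, h1, h2, h3, h4⟩ := hn.isPiece_of_troubled hc hch hdeg fun x hx =>
      (hs.step_or_troubled hc hch hdeg hx hno).resolve_left (next x hx)
    exact h4 (hpiece p D U τ h1 h2 h3)
  obtain ⟨c, hs⟩ := exists_initial_state (lab := lab) z hr
  exact main _ _ c rfl hs

end Stuck

/-! ### Symmetric trees as levelled trees -/

section LevelTree

variable {V : Type u}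

theorem degree_eq_deg (G : SimpleGraph V) (v : V) [Fintype (G.neighborSet v)] :
    G.degree v = deg G v := by
  rw [deg, ← card_neighborSet_eq_degree, ← Nat.card_eq_fintype_card, Nat.card_coe_set_eq]

theorem deg_induce (G : SimpleGraph V) (S : Set V) (x : S) :
    deg (G.induce S) x = (G.neighborSet x.1 ∩ S).ncard := by
  have : G.neighborSet x.1 ∩ S = Subtype.val '' (G.induce S).neighborSet x := by
    ext y
    constructor
    · rintro ⟨h1, h2⟩; exact ⟨⟨y, h2⟩, h1, rfl⟩
    · rintro ⟨y, hy, rfl⟩; exact ⟨hy, y.2⟩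
  rw [this, Set.ncard_image_of_injective _ Subtype.val_injective, deg]

/-- A tree given by the distances `ℓ` of its vertices to a root: levels of adjacent vertices
differ by one, each vertex off the root has a unique neighbour in the previous level, the last level
is `h`, and the vertices before the last level have degree `k`. -/
structure IsLevelTree (T : SimpleGraph V) (ℓ : V → ℕ) (h k : ℕ) : Prop where
  root : ∃ r, ℓ r = 0 ∧ ∀ v, ℓ v = 0 → v = r
  adj : ∀ a b, T.Adj a b → ℓ a = ℓ b + 1 ∨ ℓ b = ℓ a + 1
  parent : ∀ v, 0 < ℓ v → ∃ p, (T.Adj v p ∧ ℓ v = ℓ p + 1) ∧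
    ∀ q, T.Adj v q → ℓ v = ℓ q + 1 → q = p
  le : ∀ v, ℓ v ≤ h
  deg_eq : ∀ v, ℓ v < h → deg T v = k

namespace IsLevelTree

variable {T : SimpleGraph V} {ℓ : V → ℕ} {h k : ℕ}

theorem exists_neighborSet_eq (hT : IsLevelTree T ℓ h k) (hh : 1 ≤ h) {v : V} (hv : ℓ v = h) :
    ∃ p, T.neighborSet v = {p} ∧ ℓ p + 1 = h := by
  obtain ⟨p, ⟨hvp, hlp⟩, huniq⟩ := hT.parent v (by omega)
  refine ⟨p, ?_, by omega⟩
  ext q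
  rw [mem_neighborSet, Set.mem_singleton_iff]
  constructor
  · intro hvq
    rcases hT.adj v q hvq with h1 | h1
    · exact huniq q hvq h1
    · have := hT.le q; omega
  · rintro rfl; exact hvp

theorem deg_eq_one (hT : IsLevelTree T ℓ h k) (hh : 1 ≤ h) {v : V} (hv : ℓ v = h) :
    deg T v = 1 := by
  obtain ⟨p, hp, -⟩ := hT.exists_neighborSet_eq hh hv
  rw [deg, hp, Set.ncard_singleton]

theorem deg_le (hT : IsLevelTree T ℓ h k) (hh : 1 ≤ h) (hk : 1 ≤ k) (v : V) : deg T v ≤ k := by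
  rcases (hT.le v).lt_or_eq with h1 | h1
  · exact (hT.deg_eq v h1).le
  · rw [hT.deg_eq_one hh h1]; exact hk

theorem deg_lt_iff (hT : IsLevelTree T ℓ h k) (hh : 1 ≤ h) (hk : 2 ≤ k) (v : V) :
    deg T v < k ↔ ℓ v = h := by
  rcases (hT.le v).lt_or_eq with h1 | h1
  · rw [hT.deg_eq v h1]; omega
  · rw [hT.deg_eq_one hh h1]; omega

theorem isLeaf_iff [Fintype V] (hT : IsLevelTree T ℓ h k) (hh : 1 ≤ h) (hk : 2 ≤ k) (v : V) :
    IsLeaf T v ↔ ℓ v = h := by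
  rw [IsLeaf, degree_eq_deg]
  rcases (hT.le v).lt_or_eq with h1 | h1
  · rw [hT.deg_eq v h1]; omega
  · rw [hT.deg_eq_one hh h1]; omega

theorem isSupport_iff [Fintype V] (hT : IsLevelTree T ℓ h k) (hh : 1 ≤ h) (hk : 2 ≤ k) (v : V) :
    IsSupport T v ↔ ∃ u, T.Adj v u ∧ ℓ u = h := by
  simp only [IsSupport, hT.isLeaf_iff hh hk]

theorem exists_child [Finite V] (hT : IsLevelTree T ℓ h k) (hk : 2 ≤ k) {v : V} (hv : ℓ v < h) :
    ∃ u, T.Adj v u ∧ ℓ u = ℓ v + 1 := by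
  have hd := hT.deg_eq v hv
  obtain ⟨a, b, ha, hb, hab⟩ := (Set.one_lt_ncard_iff (Set.toFinite (T.neighborSet v))).1
    (show 1 < (T.neighborSet v).ncard by rw [deg] at hd; omega)
  have ha' : T.Adj v a := ha
  have hb' : T.Adj v b := hb
  rcases hT.adj v a ha' with h1 | h1
  · rcases hT.adj v b hb' with h2 | h2
    · obtain ⟨p, -, hp⟩ := hT.parent v (by omega)
      exact absurd ((hp a ha' h1).trans (hp b hb' h2).symm) hab
    · exact ⟨b, hb', h2⟩
  · exact ⟨a, ha', h1⟩

theorem exists_walk_root (hT : IsLevelTree T ℓ h k) {r : V} (hr : ∀ v, ℓ v = 0 → v = r) (n : ℕ)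
    (v : V) (hv : ℓ v = n) : ∃ p : T.Walk r v, p.length = n := by
  induction n generalizing v with
  | zero => rw [hr v hv]; exact ⟨Walk.nil, rfl⟩
  | succ n ih =>
    obtain ⟨p, ⟨hvp, hlp⟩, -⟩ := hT.parent v (by omega)
    obtain ⟨w, hw⟩ := ih p (by omega)
    exact ⟨w.concat hvp.symm, by rw [Walk.length_concat, hw]⟩

theorem le_add_length (hT : IsLevelTree T ℓ h k) {a b : V} (w : T.Walk a b) :
    ℓ b ≤ ℓ a + w.length := by
  induction w with
  | nil => simp
  | cons hab w ih =>
    rw [Walk.length_cons]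
    rcases hT.adj _ _ hab with h1 | h1 <;> omega

theorem isAcyclic (hT : IsLevelTree T ℓ h k) : T.IsAcyclic := by
  classical
  intro v c hc
  -- the two cycle neighbours of a vertex of maximal level would both be its parent
  obtain ⟨u, hu, hmax⟩ := Finset.exists_max_image c.support.toFinset ℓ
    ⟨v, List.mem_toFinset.2 c.start_mem_support⟩
  rw [List.mem_toFinset] at hu
  have hc' := hc.rotate hu
  have hmem : ∀ x ∈ (c.rotate u hu).support, ℓ x ≤ ℓ u := fun x hx =>
    hmax x (List.mem_toFinset.2 ((c.mem_support_rotate_iff u hu).1 hx))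
  have h1 := (c.rotate u hu).adj_snd hc'.not_nil
  have h2 := (c.rotate u hu).adj_penultimate hc'.not_nil
  have hl1 := hmem _ ((c.rotate u hu).getVert_mem_support 1)
  have hl2 := hmem _ ((c.rotate u hu).getVert_mem_support ((c.rotate u hu).length - 1))
  change ℓ (c.rotate u hu).snd ≤ _ at hl1
  change ℓ (c.rotate u hu).penultimate ≤ _ at hl2
  have h3 := (hT.adj _ _ h1).resolve_right (by omega)
  have h4 := (hT.adj _ _ h2.symm).resolve_right (by omega)
  obtain ⟨p, -, hp⟩ := hT.parent u (by omega)
  exact hc'.snd_ne_penultimate ((hp _ h1 h3).trans (hp _ h2.symm h4).symm)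

theorem isSymmetricTree [Fintype V] (hT : IsLevelTree T ℓ h k) (hh : 1 ≤ h) (hk : 2 ≤ k) :
    IsSymmetricTree T := by
  classical
  obtain ⟨r, hr0, hr⟩ := hT.root
  have hreach : ∀ v, T.Reachable r v := fun v => ⟨(hT.exists_walk_root hr _ v rfl).choose⟩
  have hconn : T.Connected :=
    { preconnected := fun a b => (hreach a).symm.trans (hreach b), nonempty := ⟨r⟩ }
  have hdist : ∀ v, T.dist r v = ℓ v := by
    intro v
    apply le_antisymm
    · obtain ⟨w, hw⟩ := hT.exists_walk_root hr _ v rfl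
      exact hw ▸ dist_le w
    · obtain ⟨w, hw⟩ := (hreach v).exists_walk_length_eq_dist
      have := hT.le_add_length w
      omega
  have hmax : ∀ [DecidableRel T.Adj], T.maxDegree = k := by
    intro _
    apply le_antisymm
    · refine T.maxDegree_le_of_forall_degree_le k fun v => ?_
      rw [degree_eq_deg]; exact hT.deg_le hh (by omega) v
    · rw [← hT.deg_eq r (by omega), ← degree_eq_deg]
      exact T.degree_le_maxDegree r
  refine ⟨⟨hconn, hT.isAcyclic⟩, ?_, r, ?_, ⟨h, ?_⟩, h, ?_⟩
  · intro v hv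
    rw [hT.isLeaf_iff hh hk] at hv
    rw [hmax, degree_eq_deg]
    exact hT.deg_eq v (lt_of_le_of_ne (hT.le v) hv)
  · rw [hT.isLeaf_iff hh hk]; omega
  · intro v _ hv
    rw [hmax, degree_eq_deg, hT.deg_lt_iff hh hk] at hv
    rw [hdist, hv]
  · intro v hv
    rw [hT.isLeaf_iff hh hk] at hv
    rw [hdist, hv]

/-- Removing the last level of a levelled tree. -/
theorem prune (hT : IsLevelTree T ℓ (h + 1) k) :
    IsLevelTree (T.induce {v | ℓ v < h + 1}) (fun v => ℓ v.1) h k := by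
  refine ⟨?_, fun a b hab => hT.adj _ _ hab, ?_, fun v => ?_, ?_⟩
  · obtain ⟨r, hr0, hr⟩ := hT.root
    exact ⟨⟨r, by simp [hr0]⟩, hr0, fun v hv => Subtype.ext (hr _ hv)⟩
  · intro v hv
    obtain ⟨p, ⟨hvp, hlp⟩, hu⟩ := hT.parent v.1 hv
    have hv2 : ℓ v.1 < h + 1 := v.2
    refine ⟨⟨p, show ℓ p < h + 1 by omega⟩, ⟨hvp, hlp⟩, fun q hq hlq => Subtype.ext (hu _ hq hlq)⟩
  · have : ℓ v.1 < h + 1 := v.2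
    omega
  · intro v hv
    rw [deg_induce, Set.inter_eq_left.2, ← hT.deg_eq v.1 (by omega), deg]
    intro q hq
    have hq' : T.Adj v.1 q := hq
    change ℓ q < h + 1
    rcases hT.adj _ _ hq' with h1 | h1 <;> omega

end IsLevelTree

/-- A symmetric tree is a single vertex or a levelled tree of positive height and of maximum degree
at least two. -/
theorem IsSymmetricTree.exists_isLevelTree [Fintype V] {T : SimpleGraph V}
    (hT : IsSymmetricTree T) :
    Subsingleton V ∨ ∃ ℓ h k, 1 ≤ h ∧ 2 ≤ k ∧ IsLevelTree T ℓ h k := by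
  classical
  by_cases hs : Subsingleton V
  · exact Or.inl hs
  right
  obtain ⟨htree, hdeg, r, hr, -, d, hd⟩ := hT
  have hc := htree.connected
  have : Nontrivial V := not_subsingleton_iff_nontrivial.1 hs
  have hadj : ∀ a b, T.Adj a b → T.dist r a = T.dist r b + 1 ∨ T.dist r b = T.dist r a + 1 := by
    intro a b hab
    rcases htree.dist_eq_dist_add_one_of_adj r hab with h | h
    · exact Or.inl h
    · exact Or.inr h
  have huniq : ∀ v p q, T.Adj v p → T.Adj v q → T.dist r v = T.dist r p + 1 →
      T.dist r v = T.dist r q + 1 → p = q := by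
    intro v p q hp hq hdp hdq
    obtain ⟨wp, hwp, hlp⟩ := hc.exists_path_of_dist r p
    obtain ⟨wq, hwq, hlq⟩ := hc.exists_path_of_dist r q
    have h1 : (wp.concat hp.symm).IsPath :=
      Walk.isPath_of_length_eq_dist _ (by rw [Walk.length_concat]; omega)
    have h2 : (wq.concat hq.symm).IsPath :=
      Walk.isPath_of_length_eq_dist _ (by rw [Walk.length_concat]; omega)
    have h3 := congrArg Subtype.val ((htree.isAcyclic.subsingleton_path r v).elim ⟨_, h1⟩ ⟨_, h2⟩)
    have h4 := congrArg Walk.penultimate h3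
    simpa using h4
  have hpar : ∀ v, 0 < T.dist r v → ∃ p, (T.Adj v p ∧ T.dist r v = T.dist r p + 1) ∧
      ∀ q, T.Adj v q → T.dist r v = T.dist r q + 1 → q = p := by
    intro v hv
    obtain ⟨p, hp, hdp⟩ := exists_parent hc (r := r) (x := v) fun e => by
      rw [e, dist_self] at hv; omega
    exact ⟨p, ⟨hp, hdp⟩, fun q hq hdq => huniq v q p hq hp hdq hdp⟩
  -- the vertices farthest from the root are leaves
  obtain ⟨m, -, hm⟩ := Finset.exists_max_image Finset.univ (fun v => T.dist r v)
    ⟨r, Finset.mem_univ r⟩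
  obtain ⟨s, hsr⟩ := exists_ne r
  have hmpos : 0 < T.dist r m :=
    lt_of_lt_of_le (hc.pos_dist_of_ne hsr.symm) (hm s (Finset.mem_univ s))
  have hmleaf : IsLeaf T m := by
    obtain ⟨p, ⟨hp, hdp⟩, hu⟩ := hpar m hmpos
    have : T.neighborSet m = {p} := by
      ext q
      rw [mem_neighborSet, Set.mem_singleton_iff]
      constructor
      · intro hq
        have h1 := hm q (Finset.mem_univ q)
        exact hu q hq ((hadj m q hq).resolve_right (by omega))
      · rintro rfl; exact hp
    rw [IsLeaf, degree_eq_deg, deg, this, Set.ncard_singleton]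
  have hdm : T.dist r m = d := hd m hmleaf
  have hdegr : 0 < T.degree r := by
    have := hc.preconnected.minDegree_pos_of_nontrivial
    exact lt_of_lt_of_le this (T.minDegree_le_degree r)
  have hr' : T.degree r ≠ 1 := fun h => hr (by rw [IsLeaf]; convert h)
  have hk : T.degree r = T.maxDegree := by convert hdeg r hr
  refine ⟨fun v => T.dist r v, d, T.maxDegree, by omega, by omega,
    ⟨⟨r, dist_self, fun v hv => (hc.dist_eq_zero_iff.1 hv).symm⟩, hadj, hpar,
      fun v => hdm ▸ hm v (Finset.mem_univ v), fun v hv => ?_⟩⟩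
  have hvl : ¬ IsLeaf T v := fun h => by have := hd v h; omega
  rw [← degree_eq_deg]
  convert hdeg v hvl

end LevelTree

/-! ### Pendant parts -/

section Pieces

variable {V L : Type*} {G : SimpleGraph V} {lab : V → L} {k : ℕ}

namespace IsPiece

variable {p : V} {D U : Set V} {τ : Prop}

theorem adj_mem_D (h : IsPiece G k p D U τ) {x y : V} (hx : x ∈ D) (hy : y ∈ D) (hxy : x ≠ y) :
    G.Adj x y :=
  (h.adj_D x hx y).2 ⟨hxy.symm, Or.inr (Or.inl hy)⟩

theorem adj_D_U (h : IsPiece G k p D U τ) {x w : V} (hx : x ∈ D) (hw : w ∈ U) : G.Adj w x :=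
  (h.adj_U w hw x).2 (Or.inl hx)

theorem adj_D_p (h : IsPiece G k p D U τ) {x : V} (hx : x ∈ D) : G.Adj x p :=
  (h.adj_D x hx p).2 ⟨fun e => h.notMem_D (e ▸ hx), Or.inl rfl⟩

theorem not_adj_U_p (h : IsPiece G k p D U τ) {w : V} (hw : w ∈ U) : ¬ G.Adj w p := by
  rw [h.adj_U w hw]
  rintro (h1 | h1)
  · exact h.notMem_D h1
  · exact h.notMem_U h1.1

theorem deg_D [Finite V] (h : IsPiece G k p D U τ) {x : V} (hx : x ∈ D) : deg G x = k := by
  have hN : G.neighborSet x = insert p ((D \ {x}) ∪ U) := by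
    ext y
    rw [mem_neighborSet, h.adj_D x hx]
    have h1 : p ≠ x := fun e => h.notMem_D (e ▸ hx)
    have h2 : x ∉ U := Set.disjoint_left.1 h.disj hx
    simp only [Set.mem_insert_iff, Set.mem_union, Set.mem_sdiff, Set.mem_singleton_iff]
    constructor
    · tauto
    · rintro (rfl | hy | hy)
      · tauto
      · tauto
      · exact ⟨fun e => h2 (e ▸ hy), by tauto⟩
  have h3 : p ∉ (D \ {x}) ∪ U := by
    rintro (h4 | h4)
    · exact h.notMem_D h4.1
    · exact h.notMem_U h4
  rw [deg, hN, Set.ncard_insert_of_notMem h3,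
    Set.ncard_union_eq (h.disj.mono_left Set.sdiff_subset), ← h.card,
    ← Set.ncard_sdiff_singleton_add_one hx (Set.toFinite _)]
  omega

theorem isSimplicial_U (h : IsPiece G k p D U τ) {w : V} (hw : w ∈ U) : IsSimplicial G w := by
  intro a b ha hb hab
  rw [h.adj_U w hw] at ha hb
  rcases ha with ha | ha <;> rcases hb with hb | hb
  · exact h.adj_mem_D ha hb hab
  · exact (h.adj_D_U ha hb.1).symm
  · exact h.adj_D_U hb ha.1
  · exact (h.adj_U a ha.1 b).2 (Or.inr ⟨hb.1, hab.symm, ha.2.2⟩)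

theorem preimage (h : IsPiece G k p D U τ) (γ : G ≃g G) :
    IsPiece G k (γ.symm p) (γ ⁻¹' D) (γ ⁻¹' U) τ := by
  have hne : ∀ y x, y ≠ x ↔ γ y ≠ γ x := fun y x => γ.injective.ne_iff.symm
  have hp : ∀ y, y = γ.symm p ↔ γ y = p := fun y =>
    ⟨fun e => e ▸ γ.apply_symm_apply p, fun e => e ▸ (γ.symm_apply_apply y).symm⟩
  have hcard : ∀ X : Set V, (γ ⁻¹' X).ncard = X.ncard := fun X =>
    Set.ncard_preimage_of_injective_subset_range γ.injective
      (by rw [γ.surjective.range_eq]; exact Set.subset_univ X)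
  refine ⟨h.nonempty_D.preimage γ.surjective, h.nonempty_U.preimage γ.surjective, ?_, ?_,
    h.disj.preimage γ, ?_, ?_, by rw [hcard, hcard, h.card]⟩
  · rw [Set.mem_preimage, γ.apply_symm_apply]; exact h.notMem_D
  · rw [Set.mem_preimage, γ.apply_symm_apply]; exact h.notMem_U
  · intro x hx y
    rw [← γ.map_adj_iff, h.adj_D _ hx, hne y x, hp]; rfl
  · intro w hw y
    rw [← γ.map_adj_iff, h.adj_U _ hw, hne y w]; rfl

end IsPiece

/-- Complete split graphs: the vertices in some nonempty set `I` are pairwise nonadjacent, all other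
pairs of vertices are adjacent. -/
def IsSplit (G : SimpleGraph V) : Prop :=
  ∃ I : Set V, I.Nonempty ∧ ∀ a b, a ≠ b → (G.Adj a b ↔ ¬ (a ∈ I ∧ b ∈ I))

/-- If the pendant part met from the root `r` is attached to `r`, then the graph is complete
split. -/
theorem IsPiece.isSplit [Finite V] (hc : G.Connected) {r : V} {D U : Set V} {τ : Prop}
    (h : IsPiece G k r D U τ) (ho : ∀ w ∈ U, InOrbit G lab r w) :
    IsSplit G ∧ ∀ x y, deg G x < k → deg G y < k → lab x = lab y := by
  have hDN : D ⊆ G.neighborSet r := fun x hx => (h.adj_D_p hx).symm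
  have hUU : ∀ w ∈ U, ∀ y ∈ U, ¬ G.Adj w y := by
    -- adjacent vertices in `U` would be true twins, but `r` has no true twin
    intro w hw y hy hwy
    obtain ⟨-, -, hτ⟩ : y ∈ U ∧ y ≠ w ∧ τ :=
      ((h.adj_U w hw y).1 hwy).resolve_left fun hyD => Set.disjoint_left.1 h.disj hyD hy
    obtain ⟨γ, -, hγ⟩ := ho w hw
    have htwin : ∀ a, a ≠ w → a ≠ y → (G.Adj w a ↔ G.Adj y a) := by
      intro a h1 h2
      rw [h.adj_U w hw, h.adj_U y hy]
      tauto
    have htwin' : ∀ a, a ≠ r → a ≠ γ.symm y → (G.Adj r a ↔ G.Adj (γ.symm y) a) := by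
      intro a h1 h2
      rw [← γ.map_adj_iff (v := r), ← γ.map_adj_iff (v := γ.symm y), γ.apply_symm_apply, hγ]
      refine htwin _ (fun e => h1 (γ.injective (e.trans hγ.symm))) fun e => h2 ?_
      rw [← e, γ.symm_apply_apply]
    have hrr : G.Adj r (γ.symm y) := by
      rw [← γ.map_adj_iff, γ.apply_symm_apply, hγ]; exact hwy
    have hwr : w ≠ r := fun e => h.notMem_U (e ▸ hw)
    have hrw : ¬ G.Adj r w := fun e => h.not_adj_U_p hw e.symm
    have hD : ∀ x ∈ D, x ≠ γ.symm y := by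
      rintro x hx rfl
      exact hrw ((htwin' w hwr (h.adj_D_U hx hw).ne).2 (h.adj_D_U hx hw).symm)
    obtain ⟨x, hx⟩ := h.nonempty_D
    have h1 := (htwin' x (h.adj_D_p hx).ne (hD x hx)).1 (h.adj_D_p hx).symm
    rcases ((h.adj_D x hx _).1 h1.symm).2 with h2 | h2 | h2
    · exact hrr.ne h2.symm
    · exact hD _ h2 rfl
    · exact h.not_adj_U_p h2 hrr.symm
  have hNU : ∀ w ∈ U, G.neighborSet w = D := by
    intro w hw
    ext y
    rw [mem_neighborSet]
    constructor
    · intro hwy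
      rcases (h.adj_U w hw y).1 hwy with h1 | h1
      · exact h1
      · exact absurd hwy (hUU w hw y h1.1)
    · exact fun hy => h.adj_D_U hy hw
  obtain ⟨w, hw⟩ := h.nonempty_U
  have hNr : G.neighborSet r = D := by
    refine (Set.eq_of_subset_of_ncard_le hDN ?_).symm
    have := (ho w hw).deg_eq
    rw [deg, deg, hNU w hw] at this
    exact this.ge
  have hcov : ∀ a, a = r ∨ a ∈ D ∨ a ∈ U := by
    refine fun a => mem_of_connected_of_closed hc (S := {a | a = r ∨ a ∈ D ∨ a ∈ U}) ?_
      (x := r) (Or.inl rfl) a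
    rintro a (rfl | ha | ha) b hab
    · exact Or.inr (Or.inl (hNr ▸ hab))
    · exact ((h.adj_D a ha b).1 hab).2
    · exact Or.inr (Or.inl (hNU a ha ▸ hab))
  have hND : ∀ w, w = r ∨ w ∈ U → G.neighborSet w = D := by
    rintro w (rfl | hw)
    · exact hNr
    · exact hNU w hw
  refine ⟨⟨{a | a = r ∨ a ∈ U}, ⟨r, Or.inl rfl⟩, fun a b hab => ?_⟩, ?_⟩
  · have hDr : ∀ a ∈ D, ¬ (a = r ∨ a ∈ U) := by
      rintro a ha (rfl | h1)
      · exact h.notMem_D ha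
      · exact Set.disjoint_left.1 h.disj ha h1
    by_cases ha : a ∈ D
    · have : a ∉ {a | a = r ∨ a ∈ U} := hDr a ha
      rw [h.adj_D a ha]
      have := hcov b
      tauto
    · have ha' : a = r ∨ a ∈ U := by have := hcov a; tauto
      have h1 : G.Adj a b ↔ b ∈ D := by rw [← mem_neighborSet, hND a ha']
      rw [h1]
      constructor
      · intro hb h2; exact hDr b hb h2.2
      · intro h2
        have := hcov b
        have h3 : ¬ (b = r ∨ b ∈ U) := fun h4 => h2 ⟨ha', h4⟩
        tauto
  · have key : ∀ x, deg G x < k → lab x = lab r := by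
      intro x hx
      rcases hcov x with rfl | h1 | h1
      · rfl
      · rw [h.deg_D h1] at hx; omega
      · obtain ⟨γ, hγ, rfl⟩ := ho x h1
        exact hγ r
    intro x y hx hy
    rw [key x hx, key y hy]

theorem InOrbit.isSimplicial {r w : V} (h : InOrbit G lab r w) (hw : IsSimplicial G w) :
    IsSimplicial G r := by
  obtain ⟨γ, -, rfl⟩ := h
  intro a b ha hb hab
  rw [← γ.map_adj_iff] at ha hb ⊢
  exact hw ha hb (γ.injective.ne hab)

/-- A vertex of degree less than `k` in a pendant part attached to a vertex of degree `k`. -/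
def InPiece (G : SimpleGraph V) (lab : V → L) (k : ℕ) (u : V) : Prop :=
  ∃ p D U τ, IsPiece G k p D U τ ∧ u ∈ U ∧ deg G p = k ∧ ∀ w ∈ U, deg G w < k ∧ lab w = lab u

/-- If the labelled graph cannot be coloured, it is complete split, or all its vertices of degree
less than `k` lie in pendant parts. -/
theorem isSplit_or_inPiece [Finite V] (hc : G.Connected) (hch : IsChordal G)
    (hdeg : ∀ v, deg G v ≤ k) (hcol : ¬ LabColorable G lab k) :
    (IsSplit G ∧ ∀ x y, deg G x < k → deg G y < k → lab x = lab y) ∨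
      ∀ u, deg G u < k → InPiece G lab k u := by
  have hpiece := fun (r : V) (hr : deg G r < k) =>
    (labColorable_or_isPiece (lab := lab) hc hch hdeg hr).resolve_left hcol
  -- with `s` as root, the colouring meets a pendant part with vertices in the orbit of `s`
  have hsim : ∀ s, deg G s < k → IsSimplicial G s := by
    intro s hs
    obtain ⟨p, D, U, τ, hp, ho, -, -⟩ := hpiece s hs
    obtain ⟨w, hw⟩ := hp.nonempty_U
    exact (ho w hw).isSimplicial (hp.isSimplicial_U hw)
  by_contra! hcon
  obtain ⟨hsplit, u, hu, hnot⟩ := hcon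
  obtain ⟨p, D, U, τ, hp, ho, huD, huU⟩ := hpiece u hu
  by_cases hpu : p = u
  · subst hpu
    obtain ⟨x, y, hx, hy, hxy⟩ := hsplit (hp.isSplit hc ho).1
    exact hxy ((hp.isSplit hc ho).2 x y hx hy)
  have hdp : deg G p = k := by
    by_contra hne
    -- the attachment vertex `p` separates the pendant part from `u`, so it is not simplicial
    have hps := hsim p (lt_of_le_of_ne (hdeg p) hne)
    have hex : ∃ b, G.Adj p b ∧ ¬ (b = p ∨ b ∈ D ∨ b ∈ U) := by
      by_contra! hall
      have := mem_of_connected_of_closed hc (S := {a | a = p ∨ a ∈ D ∨ a ∈ U}) (x := p) ?_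
        (Or.inl rfl) u
      · rcases this with h | h | h
        · exact hpu h.symm
        · exact huD h
        · exact huU h
      · rintro a (rfl | ha | ha) b hab
        · exact hall b hab
        · exact ((hp.adj_D a ha b).1 hab).2
        · rcases (hp.adj_U a ha b).1 hab with h | h
          · exact Or.inr (Or.inl h)
          · exact Or.inr (Or.inr h.1)
    obtain ⟨b, hpb, hb⟩ := hex
    obtain ⟨x, hx⟩ := hp.nonempty_D
    have hxb := hps (hp.adj_D_p hx).symm hpb fun e => hb (Or.inr (Or.inl (e ▸ hx)))
    exact hb ((hp.adj_D x hx b).1 hxb).2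
  obtain ⟨w, hw⟩ := hp.nonempty_U
  obtain ⟨γ, hγ, hγu⟩ := ho w hw
  have hu' : u ∈ γ ⁻¹' U := by rw [Set.mem_preimage, hγu]; exact hw
  refine hnot ⟨_, _, _, _, hp.preimage γ, hu', ?_, fun y hy => ?_⟩
  · rw [← deg_map γ, γ.apply_symm_apply, hdp]
  · have h1 := ho _ hy
    obtain ⟨δ, hδ, hδu⟩ := h1
    refine ⟨?_, ?_⟩
    · rw [← deg_map γ, ← hδu, deg_map]; exact hu
    · rw [← hγ y, ← hδu, hδ]

end Pieces

/-! ### Symmetric trees with cliques on sibling leaves -/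

section GraphA

variable {V : Type u} [Fintype V] {T : SimpleGraph V} {ℓ : V → ℕ} {h k : ℕ}

namespace IsLevelTree

theorem graphA_adj_of_lt (hT : IsLevelTree T ℓ h k) (hh : 1 ≤ h) (hk : 2 ≤ k) {x y : V}
    (hx : ℓ x < h) : (graphA T).Adj x y ↔ T.Adj x y := by
  refine ⟨?_, Or.inl⟩
  rintro (h1 | ⟨-, h1, -⟩)
  · exact h1
  · rw [hT.isLeaf_iff hh hk] at h1; omega

theorem graphA_adj_leaf (hT : IsLevelTree T ℓ h k) (hh : 1 ≤ h) (hk : 2 ≤ k) {x q y : V}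
    (hx : ℓ x = h) (hq : T.Adj x q) :
    (graphA T).Adj x y ↔ y = q ∨ (y ≠ x ∧ ℓ y = h ∧ T.Adj q y) := by
  obtain ⟨p, hp, -⟩ := hT.exists_neighborSet_eq hh hx
  have hmem : ∀ z, T.Adj x z ↔ z = p := fun z => by
    rw [← mem_neighborSet, hp, Set.mem_singleton_iff]
  have hqp := (hmem q).1 hq
  subst hqp
  constructor
  · rintro (h1 | ⟨hne, -, hy, v, hvx, hvy⟩)
    · exact Or.inl ((hmem y).1 h1)
    · rw [hT.isLeaf_iff hh hk] at hy
      rw [(hmem v).1 hvx.symm] at hvy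
      exact Or.inr ⟨hne.symm, hy, hvy⟩
  · rintro (rfl | ⟨hne, hy, hqy⟩)
    · exact Or.inl hq
    · exact Or.inr ⟨hne.symm, (hT.isLeaf_iff hh hk x).2 hx, (hT.isLeaf_iff hh hk y).2 hy, q,
        hq.symm, hqy⟩

theorem ncard_leaves (hT : IsLevelTree T ℓ h k) (hh : 2 ≤ h) {q : V} (hq : ℓ q + 1 = h) :
    {y | ℓ y = h ∧ T.Adj q y}.ncard + 1 = k := by
  obtain ⟨g, ⟨hqg, hlg⟩, hu⟩ := hT.parent q (by omega)
  have hN : T.neighborSet q = insert g {y | ℓ y = h ∧ T.Adj q y} := by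
    ext y
    rw [mem_neighborSet]
    constructor
    · intro hqy
      rcases hT.adj q y hqy with h1 | h1
      · exact Or.inl (hu y hqy h1)
      · exact Or.inr ⟨by omega, hqy⟩
    · rintro (rfl | hy)
      · exact hqg
      · exact hy.2
  have hg : g ∉ {y | ℓ y = h ∧ T.Adj q y} := fun h1 => by have := h1.1; omega
  rw [← hT.deg_eq q (by omega), deg, hN, Set.ncard_insert_of_notMem hg]

theorem deg_graphA_leaf (hT : IsLevelTree T ℓ h k) (hh : 2 ≤ h) (hk : 2 ≤ k) {x : V}
    (hx : ℓ x = h) : deg (graphA T) x + 1 = k := by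
  obtain ⟨q, ⟨hxq, hlq⟩, -⟩ := hT.parent x (by omega)
  have hN : (graphA T).neighborSet x = insert q ({y | ℓ y = h ∧ T.Adj q y} \ {x}) := by
    ext y
    rw [mem_neighborSet, hT.graphA_adj_leaf (by omega) hk hx hxq]
    simp only [Set.mem_insert_iff, Set.mem_sdiff, Set.mem_ofPred_eq, Set.mem_singleton_iff]
    tauto
  have hq : q ∉ {y | ℓ y = h ∧ T.Adj q y} \ {x} := fun h1 => h1.1.2.ne rfl
  rw [deg, hN, Set.ncard_insert_of_notMem hq,
    Set.ncard_sdiff_singleton_add_one (s := {y | ℓ y = h ∧ T.Adj q y}) ⟨hx, hxq.symm⟩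
      (Set.toFinite _), hT.ncard_leaves hh (by omega)]

theorem deg_graphA_of_lt (hT : IsLevelTree T ℓ h k) (hh : 1 ≤ h) (hk : 2 ≤ k) {x : V}
    (hx : ℓ x < h) : deg (graphA T) x = k := by
  rw [← hT.deg_eq x hx, deg, deg]
  congr 1
  ext y
  exact hT.graphA_adj_of_lt hh hk hx

end IsLevelTree

end GraphA

/-! ### Pruning -/

section Prune

/-- The shapes that remain if `k` colours do not suffice, where `k` is the maximum degree. For `T_A`
the height is at least two, as otherwise the graph is complete, and `k` is at least three, as
otherwise it is a path. For the graphs `T_B`, two properties of the vertices of degree less than `k`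
are recorded. -/
def Exceptional {V : Type u} [Fintype V] (G : SimpleGraph V) (k : ℕ) : Prop :=
  IsSplit G ∨
  (∃ ℓ h, 1 ≤ h ∧ 2 ≤ k ∧ IsLevelTree G ℓ h k) ∨
  (∃ T ℓ h, 2 ≤ h ∧ 3 ≤ k ∧ IsLevelTree T ℓ h k ∧ G = graphA T) ∨
  ((∃ (W : Type u) (_ : Fintype W) (T : SimpleGraph W),
      IsSymmetricTree T ∧ Nonempty (G ≃g graphB T)) ∧
    (∀ x, deg G x < k → 2 ≤ deg G x) ∧ ∀ x y, deg G x < k → deg G y < k → ¬ G.Adj x y)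

/-- The vertices of degree `k`; in use, `k` is the maximum degree. -/
def core {V : Type*} (G : SimpleGraph V) (k : ℕ) : Set V := {x | deg G x = k}

variable {V : Type u} {L : Type*} {G : SimpleGraph V} {lab : V → L} {k : ℕ}

theorem lt_card_of_not_labColorable [Fintype V] (hcol : ¬ LabColorable G lab k) :
    k < Fintype.card V := by
  by_contra hle
  obtain ⟨e⟩ : Nonempty (V ↪ Fin k) :=
    Function.Embedding.nonempty_of_card_le (by rw [Fintype.card_fin]; omega)
  exact hcol ⟨e, fun a b hab => e.injective.ne hab.ne, fun φ _ hφ v => e.injective (hφ v)⟩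

/-- The description of a vertex outside the core, in terms of the core. -/
theorem InPiece.exists_core [Finite V] {u : V} (hu : InPiece G lab k u) :
    ∃ p D U τ, IsPiece G k p D U τ ∧ u ∈ U ∧ p ∈ core G k ∧ D ⊆ core G k ∧
      (∀ w, w ∈ U ↔ w ∉ core G k ∧ G.neighborSet w ∩ core G k = D) ∧ ∀ w ∈ U, lab w = lab u := by
  obtain ⟨p, D, U, τ, h, huU, hp, hU⟩ := hu
  have hD : D ⊆ core G k := fun x hx => h.deg_D hx
  have hU' : ∀ w ∈ U, w ∉ core G k := fun w hw hc => (hU w hw).1.ne hc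
  refine ⟨p, D, U, τ, h, huU, hp, hD, fun w => ⟨fun hw => ⟨hU' w hw, ?_⟩, ?_⟩,
    fun w hw => (hU w hw).2⟩
  · ext y
    constructor
    · rintro ⟨hwy, hy⟩
      rcases (h.adj_U w hw y).1 hwy with h1 | h1
      · exact h1
      · exact absurd hy (hU' y h1.1)
    · exact fun hy => ⟨h.adj_D_U hy hw, hD hy⟩
  · rintro ⟨hw, hN⟩
    obtain ⟨x, hx⟩ := h.nonempty_D
    have hwx : G.Adj w x := (hN.symm ▸ hx : x ∈ G.neighborSet w ∩ core G k).1
    rcases ((h.adj_D x hx w).1 hwx.symm).2 with rfl | h1 | h1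
    · exact absurd hp hw
    · exact absurd (hD h1) hw
    · exact h1

theorem notMem_core (hdeg : ∀ v, deg G v ≤ k) {u : V} : u ∉ core G k ↔ deg G u < k :=
  ⟨fun h => lt_of_le_of_ne (hdeg u) h, fun h => h.ne⟩

/-- A path through a vertex outside the core can be rerouted through a clique in the core. -/
theorem core_connected [Finite V] (hdeg : ∀ v, deg G v ≤ k)
    (hp : ∀ u, deg G u < k → InPiece G lab k u) (hc : G.Connected) :
    (G.induce (core G k)).Connected := by
  have hex : ∀ u, ∃ x : core G k, (u ∈ core G k → x.1 = u) ∧ (u ∉ core G k → G.Adj u x.1) := by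
    intro u
    by_cases hu : u ∈ core G k
    · exact ⟨⟨u, hu⟩, fun _ => rfl, fun h => absurd hu h⟩
    · obtain ⟨p, D, U, τ, h, huU, -, hD, -, -⟩ := (hp u ((notMem_core hdeg).1 hu)).exists_core
      obtain ⟨x, hx⟩ := h.nonempty_D
      exact ⟨⟨x, hD hx⟩, fun h => absurd h hu, fun _ => h.adj_D_U hx huU⟩
  choose f hf1 hf2 using hex
  -- the neighbours in the core of a vertex outside it form a clique
  have hcl : ∀ u, u ∉ core G k → ∀ x y : core G k, G.Adj u x → G.Adj u y →
      (G.induce (core G k)).Reachable x y := by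
    intro u hu x y hx hy
    obtain ⟨p, D, U, τ, h, huU, -, hD, hU, -⟩ := (hp u ((notMem_core hdeg).1 hu)).exists_core
    by_cases hxy : x = y
    · rw [hxy]
    have hN := ((hU u).1 huU).2
    have hxD : x.1 ∈ D := hN ▸ ⟨hx, x.2⟩
    have hyD : y.1 ∈ D := hN ▸ ⟨hy, y.2⟩
    exact Adj.reachable (h.adj_mem_D hxD hyD fun e => hxy (Subtype.ext e))
  have hstep : ∀ a b, G.Adj a b → (G.induce (core G k)).Reachable (f a) (f b) := by
    intro a b hab
    by_cases ha : a ∈ core G k <;> by_cases hb : b ∈ core G k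
    · refine Adj.reachable ?_
      change G.Adj (f a).1 (f b).1
      rw [hf1 a ha, hf1 b hb]; exact hab
    · refine hcl b hb _ _ ?_ (hf2 b hb)
      rw [hf1 a ha]; exact hab.symm
    · refine hcl a ha _ _ (hf2 a ha) ?_
      rw [hf1 b hb]; exact hab
    · obtain ⟨p, D, U, τ, h, haU, -, hD, hU, -⟩ := (hp a ((notMem_core hdeg).1 ha)).exists_core
      have hbU : b ∈ U := by
        rcases (h.adj_U a haU b).1 hab with h1 | h1
        · exact absurd (hD h1) hb
        · exact h1.1
      have hN : G.neighborSet b ∩ core G k = G.neighborSet a ∩ core G k := by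
        rw [((hU a).1 haU).2, ((hU b).1 hbU).2]
      have : (f b).1 ∈ G.neighborSet a ∩ core G k := hN ▸ ⟨hf2 b hb, (f b).2⟩
      exact hcl a ha _ _ (hf2 a ha) this.1
  obtain ⟨v⟩ := hc.nonempty
  refine { preconnected := fun x y => ?_, nonempty := ⟨f v⟩ }
  obtain ⟨w⟩ := hc.preconnected x.1 y.1
  have hfx : ∀ z : core G k, f z.1 = z := fun z => Subtype.ext (hf1 z.1 z.2)
  rw [← hfx x, ← hfx y]
  generalize x.1 = a at w
  generalize y.1 = b at w
  induction w with
  | nil => exact Reachable.refl _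
  | cons hab w ih => exact (hstep _ _ hab).trans ih

/-- A colouring of the core extends: the colours missing on the clique of a pendant part are
distributed to the other vertices of this part. -/
theorem labColorable_of_core [Finite V] (hdeg : ∀ v, deg G v ≤ k)
    (hp : ∀ u, deg G u < k → InPiece G lab k u) (hk : 0 < k)
    (h : LabColorable (G.induce (core G k))
      (fun x : core G k => {y | InOrbit G lab x.1 y}) k) : LabColorable G lab k := by
  classical
  obtain ⟨c, hprop, hdist⟩ := h
  let c₀ : V → Fin k := fun x => if hx : x ∈ core G k then c ⟨x, hx⟩ else ⟨0, hk⟩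
  -- colours for the vertices outside the core whose neighbourhood in the core is `D`
  have hex : ∀ D : Set V, ∃ f : V → Fin k, ∀ u, u ∉ core G k → G.neighborSet u ∩ core G k = D →
      Set.InjOn f {w | w ∉ core G k ∧ G.neighborSet w ∩ core G k = D} ∧
      ∀ w, w ∉ core G k → G.neighborSet w ∩ core G k = D → f w ∉ c₀ '' D := by
    intro D
    by_cases hu : ∃ u, u ∉ core G k ∧ G.neighborSet u ∩ core G k = D
    · obtain ⟨u, hu, huD⟩ := hu
      obtain ⟨p, D', U, τ, h, huU, -, hD, hU, -⟩ := (hp u ((notMem_core hdeg).1 hu)).exists_core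
      have hDD : D' = D := by rw [← ((hU u).1 huU).2, huD]
      subst hDD
      have h1 : (c₀ '' D').ncard ≤ D'.ncard := Set.ncard_image_le (Set.toFinite _)
      have h2 := h.card
      obtain ⟨f, hf1, hf2⟩ := exists_injOn_avoid ⟨0, hk⟩ U (c₀ '' D') (by omega)
      refine ⟨f, fun _ _ _ => ⟨?_, fun w hw hwD => hf2 w ((hU w).2 ⟨hw, hwD⟩)⟩⟩
      exact fun a ha b hb hab => hf1 ((hU a).2 ha) ((hU b).2 hb) hab
    · exact ⟨fun _ => ⟨0, hk⟩, fun u h1 h2 => absurd ⟨u, h1, h2⟩ hu⟩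
  choose F hF using hex
  let c' : V → Fin k := fun x =>
    if x ∈ core G k then c₀ x else F (G.neighborSet x ∩ core G k) x
  have hc'1 : ∀ x : core G k, c' x.1 = c x := fun x => by
    change (if x.1 ∈ core G k then
      (if hx : x.1 ∈ core G k then c ⟨x.1, hx⟩ else ⟨0, hk⟩) else _) = _
    rw [if_pos x.2, dif_pos x.2]
  have hc'0 : ∀ x, x ∈ core G k → c' x = c₀ x := fun x hx => if_pos hx
  have hc'2 : ∀ x, x ∉ core G k → c' x = F (G.neighborSet x ∩ core G k) x := fun x hx => if_neg hx
  have hc'3 : ∀ x y, x ∈ core G k → y ∉ core G k → G.Adj x y → c' x ≠ c' y := by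
    intro x y hx hy hxy he
    rw [hc'0 x hx, hc'2 y hy] at he
    exact ((hF _ y hy rfl).2 y hy rfl) ⟨x, ⟨hxy.symm, hx⟩, he⟩
  have hinj : ∀ x y, x ∉ core G k → y ∉ core G k →
      G.neighborSet x ∩ core G k = G.neighborSet y ∩ core G k → c' x = c' y → x = y := by
    intro x y hx hy hxy he
    rw [hc'2 x hx, hc'2 y hy, hxy] at he
    exact (hF _ y hy rfl).1 ⟨hx, hxy⟩ ⟨hy, rfl⟩ he
  refine ⟨c', ?_, ?_⟩
  · intro a b hab
    by_cases ha : a ∈ core G k <;> by_cases hb : b ∈ core G k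
    · rw [hc'1 ⟨a, ha⟩, hc'1 ⟨b, hb⟩]
      exact hprop ⟨a, ha⟩ ⟨b, hb⟩ hab
    · exact hc'3 a b ha hb hab
    · exact (hc'3 b a hb ha hab.symm).symm
    · obtain ⟨p, D, U, τ, h, haU, -, hD, hU, -⟩ := (hp a ((notMem_core hdeg).1 ha)).exists_core
      have hbU : b ∈ U := by
        rcases (h.adj_U a haU b).1 hab with h1 | h1
        · exact absurd (hD h1) hb
        · exact h1.1
      exact fun he => hab.ne (hinj a b ha hb
        (by rw [((hU a).1 haU).2, ((hU b).1 hbU).2]) he)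
  · intro φ hlab hφ
    have hcore : ∀ x, φ x ∈ core G k ↔ x ∈ core G k := fun x => by
      change deg G (φ x) = k ↔ deg G x = k
      rw [deg_map]
    have hbij : Set.BijOn φ (core G k) (core G k) := by
      refine ⟨fun x hx => (hcore x).2 hx, φ.injective.injOn, fun y hy => ?_⟩
      refine ⟨φ.symm y, ?_, φ.apply_symm_apply y⟩
      rw [← hcore, φ.apply_symm_apply]; exact hy
    have hfix : ∀ x : core G k, φ x.1 = x.1 := by
      intro x
      have h1 := hdist (φ.induce hbij) (fun x => ?_) (fun x => ?_) x
      · exact congrArg Subtype.val h1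
      · ext y
        have hstep : ∀ y, InOrbit G lab (φ x.1) y ↔ InOrbit G lab x.1 y := by
          intro y
          constructor
          · rintro ⟨γ, hγ, rfl⟩
            exact ⟨φ.trans γ, fun v => (hγ (φ v)).trans (hlab v), rfl⟩
          · rintro ⟨γ, hγ, rfl⟩
            refine ⟨φ.symm.trans γ, fun v => (hγ (φ.symm v)).trans ?_, ?_⟩
            · rw [← hlab (φ.symm v), φ.apply_symm_apply]
            · change γ (φ.symm (φ x.1)) = γ x.1
              rw [φ.symm_apply_apply]
        exact hstep y
      · rw [← hc'1, ← hc'1]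
        exact hφ x.1
    intro x
    by_cases hx : x ∈ core G k
    · exact hfix ⟨x, hx⟩
    · refine hinj _ _ (fun h => hx ((hcore x).1 h)) hx ?_ (hφ x)
      ext y
      constructor
      · rintro ⟨h1, h2⟩
        refine ⟨?_, h2⟩
        rw [mem_neighborSet, ← φ.map_adj_iff, hfix ⟨y, h2⟩]; exact h1
      · rintro ⟨h1, h2⟩
        refine ⟨?_, h2⟩
        rw [mem_neighborSet, ← show φ y = y from hfix ⟨y, h2⟩, φ.map_adj_iff]; exact h1

theorem deg_core_lt_iff [Finite V] (hdeg : ∀ v, deg G v ≤ k) (x : core G k) :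
    deg (G.induce (core G k)) x < k ↔ ∃ u, deg G u < k ∧ G.Adj u x.1 := by
  have hx : deg G x.1 = k := x.2
  rw [deg_induce]
  constructor
  · intro hlt
    by_contra! hno
    have : G.neighborSet x.1 ∩ core G k = G.neighborSet x.1 := by
      refine Set.inter_eq_left.2 fun y hy => ?_
      by_contra hyc
      exact hno y ((notMem_core hdeg).1 hyc) (G.adj_symm hy)
    rw [this] at hlt
    rw [deg] at hx
    omega
  · rintro ⟨u, hu, hux⟩
    refine lt_of_lt_of_eq (Set.ncard_lt_ncard ?_ (Set.toFinite _)) hx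
    rw [Set.ssubset_iff_of_subset Set.inter_subset_left]
    exact ⟨u, hux.symm, fun h => (notMem_core hdeg).2 hu h.2⟩

end Prune

/-! ### Graphs whose core is exceptional -/

section Regrow

variable {V : Type u} {L : Type*} [Fintype V] {G : SimpleGraph V} {lab : V → L} {k : ℕ}

/-- Growing the next level of a symmetric tree. The clique `D` of a pendant part is a single leaf of
the old tree, so `k - 1` new vertices are attached to each leaf, and by `hom` the sets of new
vertices are either all independent or all complete. -/
theorem exceptional_of_core_levelTree
    (hdeg : ∀ v, deg G v ≤ k) (hp : ∀ u, deg G u < k → InPiece G lab k u)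
    (hom : ∀ a b, deg G a < k → deg G b < k → G.Adj a b → ∀ u w, deg G u < k → deg G w < k →
      G.neighborSet u ∩ core G k = G.neighborSet w ∩ core G k → u ≠ w → G.Adj u w)
    {ℓ : core G k → ℕ} {h : ℕ} (hh : 1 ≤ h) (hk : 2 ≤ k)
    (hT : IsLevelTree (G.induce (core G k)) ℓ h k) : Exceptional G k := by
  classical
  have hex : ∀ u, u ∉ core G k → ∃ x : core G k, ℓ x = h ∧ G.neighborSet u ∩ core G k = {x.1} ∧
      ∃ U : Set V, U.ncard + 1 = k ∧ u ∈ U ∧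
        (∀ w, w ∈ U ↔ w ∉ core G k ∧ G.neighborSet w ∩ core G k = {x.1}) ∧
        ∀ w, w ∉ core G k → G.Adj u w → w ∈ U := by
    intro u hu
    obtain ⟨p, D, U, τ, hpc, huU, -, hD, hU, -⟩ := (hp u ((notMem_core hdeg).1 hu)).exists_core
    have hlev : ∀ x : core G k, x.1 ∈ D → ℓ x = h := fun x hx => by
      rw [← hT.deg_lt_iff hh hk, deg_core_lt_iff hdeg]
      exact ⟨u, (notMem_core hdeg).1 hu, hpc.adj_D_U hx huU⟩
    obtain ⟨x, hx⟩ := hpc.nonempty_D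
    have hDx : D = {x} := by
      refine Set.eq_singleton_iff_unique_mem.2 ⟨hx, fun y hy => ?_⟩
      by_contra hyx
      have h1 := hlev ⟨x, hD hx⟩ hx
      have h2 := hlev ⟨y, hD hy⟩ hy
      rcases hT.adj ⟨x, hD hx⟩ ⟨y, hD hy⟩ (hpc.adj_mem_D hx hy (Ne.symm hyx)) with h3 | h3 <;> omega
    subst hDx
    refine ⟨⟨x, hD hx⟩, hlev ⟨x, hD hx⟩ hx, ((hU u).1 huU).2, U, ?_, huU, hU, fun w hw huw => ?_⟩
    · have := hpc.card
      rw [Set.ncard_singleton] at this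
      omega
    · rcases (hpc.adj_U u huU w).1 huw with h1 | h1
      · exact absurd (hD h1) hw
      · exact h1.1
  -- the tree obtained by deleting the edges between new vertices, with its levels `l`
  let T : SimpleGraph V :=
    { Adj := fun a b => G.Adj a b ∧ (a ∈ core G k ∨ b ∈ core G k)
      symm := ⟨fun a b hab => ⟨hab.1.symm, hab.2.symm⟩⟩
      loopless := ⟨fun a ha => ha.1.ne rfl⟩ }
  have hTadj : ∀ a b, T.Adj a b ↔ G.Adj a b ∧ (a ∈ core G k ∨ b ∈ core G k) := fun a b => Iff.rfl
  let l : V → ℕ := fun a => if ha : a ∈ core G k then ℓ ⟨a, ha⟩ else h + 1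
  have hl1 : ∀ x : core G k, l x.1 = ℓ x := fun x => dif_pos x.2
  have hl2 : ∀ x, x ∉ core G k → l x = h + 1 := fun x hx => dif_neg hx
  have hle : ∀ x : core G k, l x.1 ≤ h := fun x => (hl1 x).trans_le (hT.le x)
  have hout : ∀ u x, u ∉ core G k → x ∈ core G k → G.Adj u x → l x = h := by
    intro u x hu hx hux
    obtain ⟨y, hy, hN, -⟩ := hex u hu
    have : x ∈ G.neighborSet u ∩ core G k := ⟨hux, hx⟩
    rw [hN, Set.mem_singleton_iff] at this
    rw [this, hl1, hy]
  have hTl : IsLevelTree T l (h + 1) k := by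
    refine ⟨?_, ?_, ?_, ?_, ?_⟩
    · obtain ⟨r, hr0, hr⟩ := hT.root
      refine ⟨r.1, (hl1 r).trans hr0, fun v hv => ?_⟩
      by_cases hvc : v ∈ core G k
      · rw [hl1 ⟨v, hvc⟩] at hv
        exact congrArg Subtype.val (hr ⟨v, hvc⟩ hv)
      · rw [hl2 v hvc] at hv; omega
    · rintro a b ⟨hab, hc⟩
      by_cases ha : a ∈ core G k <;> by_cases hb : b ∈ core G k
      · rw [hl1 ⟨a, ha⟩, hl1 ⟨b, hb⟩]
        exact hT.adj ⟨a, ha⟩ ⟨b, hb⟩ hab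
      · rw [hl2 b hb, hout b a hb ha hab.symm]; simp
      · rw [hl2 a ha, hout a b ha hb hab]; simp
      · tauto
    · intro v hv
      by_cases hvc : v ∈ core G k
      · rw [hl1 ⟨v, hvc⟩] at hv
        obtain ⟨p, ⟨hvp, hlp⟩, hu⟩ := hT.parent _ hv
        refine ⟨p.1, ⟨⟨hvp, Or.inl hvc⟩, by rw [hl1 ⟨v, hvc⟩, hl1]; exact hlp⟩, fun q hq hlq => ?_⟩
        have hqc : q ∈ core G k := by
          by_contra hqc
          rw [hl2 q hqc] at hlq
          have := hle ⟨v, hvc⟩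
          simp only at this
          omega
        rw [hl1 ⟨v, hvc⟩, hl1 ⟨q, hqc⟩] at hlq
        exact congrArg Subtype.val (hu ⟨q, hqc⟩ hq.1 hlq)
      · obtain ⟨x, hx, hN, -⟩ := hex v hvc
        have hvx : x.1 ∈ G.neighborSet v ∩ core G k := by rw [hN]; rfl
        refine ⟨x.1, ⟨⟨hvx.1, Or.inr x.2⟩, by rw [hl2 v hvc, hl1, hx]⟩, fun q hq _ => ?_⟩
        have : q ∈ G.neighborSet v ∩ core G k := ⟨hq.1, hq.2.resolve_left hvc⟩
        rwa [hN] at this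
    · intro v
      by_cases hvc : v ∈ core G k
      · have := hle ⟨v, hvc⟩
        simp only at this
        omega
      · exact (hl2 v hvc).le
    · intro v hv
      have hvc : v ∈ core G k := by
        by_contra hvc
        rw [hl2 v hvc] at hv; omega
      have hd : deg G v = k := hvc
      rw [← hd, deg, deg]
      congr 1
      ext y
      exact ⟨fun hy => hy.1, fun hy => ⟨hy, Or.inl hvc⟩⟩
  by_cases hτ : ∃ a b, a ∉ core G k ∧ b ∉ core G k ∧ G.Adj a b
  · obtain ⟨a, b, ha, hb, hab⟩ := hτ
    have hk3 : 3 ≤ k := by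
      obtain ⟨x, -, -, U, hUk, haU, -, hU⟩ := hex a ha
      have : 1 < U.ncard := (Set.one_lt_ncard_iff (Set.toFinite U)).2
        ⟨a, b, haU, hU b hb hab, hab.ne⟩
      omega
    refine Or.inr (Or.inr (Or.inl ⟨T, l, h + 1, by omega, hk3, hTl, ?_⟩))
    have hleaf : ∀ v, IsLeaf T v ↔ v ∉ core G k := by
      intro v
      rw [hTl.isLeaf_iff (by omega) hk]
      refine ⟨fun hv hvc => ?_, hl2 v⟩
      have := hle ⟨v, hvc⟩
      simp only at this
      omega
    ext u w
    constructor
    · intro huw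
      by_cases hc : u ∈ core G k ∨ w ∈ core G k
      · exact Or.inl ⟨huw, hc⟩
      · have hu : u ∉ core G k := fun h => hc (Or.inl h)
        have hw : w ∉ core G k := fun h => hc (Or.inr h)
        obtain ⟨x, -, hN, U, -, -, hU, hU'⟩ := hex u hu
        have hNw := ((hU w).1 (hU' w hw huw)).2
        have hux : x.1 ∈ G.neighborSet u ∩ core G k := by rw [hN]; rfl
        have hwx : x.1 ∈ G.neighborSet w ∩ core G k := by rw [hNw]; rfl
        exact Or.inr ⟨huw.ne, (hleaf u).2 hu, (hleaf w).2 hw, x.1,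
          ⟨G.adj_symm hux.1, Or.inl x.2⟩, ⟨G.adj_symm hwx.1, Or.inl x.2⟩⟩
    · rintro (huw | ⟨hne, hu, hw, v, hvu, hvw⟩)
      · exact huw.1
      · rw [hleaf] at hu hw
        obtain ⟨x, -, hN, -⟩ := hex u hu
        obtain ⟨y, -, hN', -⟩ := hex w hw
        have h1 : v ∈ G.neighborSet u ∩ core G k := ⟨hvu.1.symm, hvu.2.resolve_right hu⟩
        have h2 : v ∈ G.neighborSet w ∩ core G k := ⟨hvw.1.symm, hvw.2.resolve_right hw⟩
        rw [hN, Set.mem_singleton_iff] at h1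
        rw [hN', Set.mem_singleton_iff] at h2
        refine hom a b ((notMem_core hdeg).1 ha) ((notMem_core hdeg).1 hb) hab u w
          ((notMem_core hdeg).1 hu) ((notMem_core hdeg).1 hw) ?_ hne
        rw [hN, hN', ← h1, ← h2]
  · refine Or.inr (Or.inl ⟨l, h + 1, by omega, hk, ?_⟩)
    have : T = G := by
      ext a b
      refine ⟨fun hab => hab.1, fun hab => ⟨hab, ?_⟩⟩
      by_contra! hc
      exact hτ ⟨a, b, hc.1, hc.2, hab⟩
    rwa [this] at hTl

/-- Growing the last vertices of `T_B` from `T_A`: the clique `D` of a pendant part consists of all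
`k - 1` leaves at a support, so a single new vertex is attached to them. -/
theorem exceptional_of_core_graphA [Fintype (core G k)]
    (hdeg : ∀ v, deg G v ≤ k) (hp : ∀ u, deg G u < k → InPiece G lab k u)
    {T : SimpleGraph (core G k)}
    {ℓ : core G k → ℕ} {h : ℕ} (hh : 2 ≤ h) (hk : 3 ≤ k) (hT : IsLevelTree T ℓ h k)
    (hG : G.induce (core G k) = graphA T) : Exceptional G k := by
  classical
  have hadjA : ∀ x y : core G k, G.Adj x.1 y.1 ↔ (graphA T).Adj x y := fun x y => by
    rw [← hG]; rfl
  have hleaf : ∀ x : core G k, ℓ x = h ↔ ∃ u, u ∉ core G k ∧ G.Adj u x.1 := by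
    intro x
    have h1 := deg_core_lt_iff hdeg x
    simp only [notMem_core hdeg]
    rw [← h1, hG]
    rcases (hT.le x).lt_or_eq with h2 | h2
    · rw [hT.deg_graphA_of_lt (by omega) (by omega) h2]; omega
    · have := hT.deg_graphA_leaf hh (by omega) h2; omega
  -- the pendant part of `u` consists of `u` and the leaves at a support `q`
  have hex : ∀ u, u ∉ core G k → ∃ q : core G k, IsSupport T q ∧
      (∀ x : core G k, G.Adj u x.1 ↔ ℓ x = h ∧ T.Adj q x) ∧
      (∀ w, w ∉ core G k → ¬ G.Adj u w) ∧
      (∀ w, w ∉ core G k → (∃ x : core G k, G.Adj u x.1 ∧ G.Adj w x.1) → w = u) ∧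
      deg G u + 1 = k := by
    intro u hu
    obtain ⟨p, D, U, τ, hpc, huU, hpS, hD, hU, -⟩ := (hp u ((notMem_core hdeg).1 hu)).exists_core
    have hlev : ∀ x : core G k, x.1 ∈ D → ℓ x = h := fun x hx =>
      (hleaf x).2 ⟨u, hu, hpc.adj_D_U hx huU⟩
    obtain ⟨x, hx⟩ := hpc.nonempty_D
    have hlx := hlev ⟨x, hD hx⟩ hx
    obtain ⟨q, ⟨hxq, hlq⟩, -⟩ := hT.parent ⟨x, hD hx⟩ (by omega)
    have hadj := fun y => hT.graphA_adj_leaf (by omega) (by omega) hlx hxq (y := y)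
    have hUc : ∀ w ∈ U, w ∉ core G k := fun w hw => ((hU w).1 hw).1
    have hqp : q.1 = p := by
      have h1 : G.Adj x q.1 := (hadjA ⟨x, hD hx⟩ q).2 ((hadj q).2 (Or.inl rfl))
      rcases ((hpc.adj_D x hx q.1).1 h1).2 with h2 | h2 | h2
      · exact h2
      · have := hlev q h2; omega
      · exact absurd q.2 (hUc _ h2)
    have hDq : ∀ y : core G k, y.1 ∈ D ↔ ℓ y = h ∧ T.Adj q y := by
      intro y
      by_cases hyx : y.1 = x
      · have : y = ⟨x, hD hx⟩ := Subtype.ext hyx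
        subst this
        exact iff_of_true hx ⟨hlx, hxq.symm⟩
      have hyx' : y ≠ ⟨x, hD hx⟩ := fun e => hyx (congrArg Subtype.val e)
      constructor
      · intro hy
        have h1 := (hadjA ⟨x, hD hx⟩ y).1 (hpc.adj_mem_D hx hy (Ne.symm hyx))
        rcases (hadj y).1 h1 with h2 | h2
        · have := hlev y hy
          rw [h2] at this; omega
        · exact h2.2
      · intro hy
        have h1 := (hadjA ⟨x, hD hx⟩ y).2 ((hadj y).2 (Or.inr ⟨hyx', hy⟩))
        rcases ((hpc.adj_D x hx y.1).1 h1).2 with h2 | h2 | h2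
        · have : y = q := Subtype.ext (h2.trans hqp.symm)
          rw [this] at hy; omega
        · exact h2
        · exact absurd y.2 (hUc _ h2)
    have hDcard : D.ncard + 1 = k := by
      rw [← hT.ncard_leaves hh (q := q) (by omega)]
      congr 1
      have : D = Subtype.val '' {y : core G k | ℓ y = h ∧ T.Adj q y} := by
        ext y
        constructor
        · exact fun hy => ⟨⟨y, hD hy⟩, (hDq ⟨y, hD hy⟩).1 hy, rfl⟩
        · rintro ⟨y, hy, rfl⟩
          exact (hDq y).2 hy
      rw [this, Set.ncard_image_of_injective _ Subtype.val_injective]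
    have hUu : ∀ w ∈ U, w = u := by
      have := hpc.card
      obtain ⟨a, ha⟩ := Set.ncard_eq_one.1 (show U.ncard = 1 by omega)
      rw [ha] at huU ⊢
      rintro w rfl
      exact huU.symm
    have hNu : G.neighborSet u = D := by
      ext y
      rw [mem_neighborSet, hpc.adj_U u huU]
      exact ⟨fun h1 => h1.resolve_right fun h2 => h2.2.1 (hUu y h2.1), Or.inl⟩
    have hNu' : ∀ y, G.Adj u y ↔ y ∈ D := fun y => by rw [← hNu, mem_neighborSet]
    refine ⟨q, (hT.isSupport_iff (by omega) (by omega) q).2 ⟨_, hxq.symm, hlx⟩, ?_, ?_, ?_, ?_⟩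
    · intro y
      rw [hNu', hDq]
    · intro w hw huw
      exact hw (hD ((hNu' w).1 huw))
    · rintro w hw ⟨y, huy, hwy⟩
      refine hUu w ?_
      rcases ((hpc.adj_D y.1 ((hNu' _).1 huy) w).1 hwy.symm).2 with h1 | h1 | h1
      · exact absurd (h1 ▸ hpS) hw
      · exact absurd (hD h1) hw
      · exact h1
    · rw [deg, hNu, hDcard]
  refine Or.inr (Or.inr (Or.inr ⟨⟨core G k, inferInstance, T, ?_, ?_⟩, ?_, ?_⟩))
  · exact hT.isSymmetricTree (by omega) (by omega)
  · have hq : ∀ q : {q : core G k // IsSupport T q}, ∃ u, u ∉ core G k ∧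
        ∀ x : core G k, G.Adj u x.1 ↔ ℓ x = h ∧ T.Adj q.1 x := by
      intro q
      obtain ⟨x, hqx, hx⟩ := (hT.isSupport_iff (by omega) (by omega) q.1).1 q.2
      obtain ⟨u, hu, hux⟩ := (hleaf x).1 hx
      obtain ⟨q', -, h1, -⟩ := hex u hu
      obtain ⟨s, hs, -⟩ := hT.exists_neighborSet_eq (by omega) hx
      have h2 : q' ∈ T.neighborSet x := (((h1 x).1 hux).2).symm
      have h3 : q.1 ∈ T.neighborSet x := hqx.symm
      rw [hs, Set.mem_singleton_iff] at h2 h3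
      refine ⟨u, hu, ?_⟩
      rw [h3, ← h2]; exact h1
    -- `g q` is the new vertex at the support `q`
    choose g hg1 hg2 using hq
    let f : core G k ⊕ {q : core G k // IsSupport T q} → V := Sum.elim Subtype.val g
    have hsup : ∀ q : {q : core G k // IsSupport T q}, ∃ x, ℓ x = h ∧ T.Adj q.1 x := fun q => by
      obtain ⟨x, hqx, hx⟩ := (hT.isSupport_iff (by omega) (by omega) q.1).1 q.2
      exact ⟨x, hx, hqx⟩
    have hbij : Function.Bijective f := by
      constructor
      · rintro (a | q) (b | q') hab
        · exact congrArg Sum.inl (Subtype.ext hab)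
        · exact absurd (show g q' ∈ core G k from (show a.1 = g q' from hab) ▸ a.2) (hg1 q')
        · exact absurd (show g q ∈ core G k from (show g q = b.1 from hab) ▸ b.2) (hg1 q)
        · obtain ⟨x, hx, hqx⟩ := hsup q
          have hab' : g q = g q' := hab
          have h1 := (hg2 q x).2 ⟨hx, hqx⟩
          rw [hab'] at h1
          have h2 := ((hg2 q' x).1 h1).2
          obtain ⟨s, hs, -⟩ := hT.exists_neighborSet_eq (by omega) hx
          have h3 : q.1 ∈ T.neighborSet x := hqx.symm
          have h4 : q'.1 ∈ T.neighborSet x := h2.symm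
          rw [hs, Set.mem_singleton_iff] at h3 h4
          exact congrArg Sum.inr (Subtype.ext (h3.trans h4.symm))
      · intro u
        by_cases hu : u ∈ core G k
        · exact ⟨Sum.inl ⟨u, hu⟩, rfl⟩
        · obtain ⟨q, hq, h1, -, h3, -⟩ := hex u hu
          refine ⟨Sum.inr ⟨q, hq⟩, h3 _ (hg1 _) ?_⟩
          obtain ⟨x, hx, hqx⟩ := hsup ⟨q, hq⟩
          exact ⟨x, (h1 x).2 ⟨hx, hqx⟩, (hg2 ⟨q, hq⟩ x).2 ⟨hx, hqx⟩⟩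
    refine ⟨(⟨Equiv.ofBijective f hbij, ?_⟩ : graphB T ≃g G).symm⟩
    have hleaf' : ∀ (q : {q : core G k // IsSupport T q}) (x : core G k),
        G.Adj (g q) x.1 ↔ T.Adj q.1 x ∧ IsLeaf T x := fun q x => by
      rw [hg2, hT.isLeaf_iff (by omega) (by omega)]; tauto
    rintro (a | q) (b | q')
    · exact hadjA a b
    · exact (G.adj_comm _ _).trans (hleaf' q' a)
    · exact hleaf' q b
    · obtain ⟨-, -, -, h2, -⟩ := hex (g q) (hg1 q)
      exact iff_of_false (h2 _ (hg1 q')) id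
  · intro u hu
    obtain ⟨-, -, -, -, -, h4⟩ := hex u ((notMem_core hdeg).2 hu)
    omega
  · intro u w hu hw
    obtain ⟨-, -, -, h2, -⟩ := hex u ((notMem_core hdeg).2 hu)
    exact h2 w ((notMem_core hdeg).2 hw)

end Regrow

/-! ### The graphs that need more colours -/

section Main

open Classical in
theorem isLevelTree_star {W : Type*} [Fintype W] {H : SimpleGraph W} {p : W} {k : ℕ}
    (hadj : ∀ a b, H.Adj a b ↔ a ≠ b ∧ (a = p ∨ b = p)) (hk : Fintype.card W = k + 1) :
    IsLevelTree H (fun y => if y = p then 0 else 1) 1 k := by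
  refine ⟨⟨p, if_pos rfl, ?_⟩, ?_, ?_, ?_, ?_⟩
  · intro v hv
    by_contra h
    rw [if_neg h] at hv; omega
  · intro a b hab
    obtain ⟨hne, rfl | rfl⟩ := (hadj a b).1 hab
    · right; rw [if_pos rfl, if_neg hne.symm]
    · left; rw [if_pos rfl, if_neg hne]
  · intro v hv
    have hvp : v ≠ p := fun h => by rw [if_pos h] at hv; omega
    refine ⟨p, ⟨(hadj _ _).2 ⟨hvp, Or.inr rfl⟩, by rw [if_pos rfl, if_neg hvp]⟩, ?_⟩
    intro q hq _
    exact ((hadj v q).1 hq).2.resolve_left hvp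
  · intro v
    split_ifs <;> omega
  · intro v hv
    have hvp : v = p := by
      by_contra h
      rw [if_neg h] at hv; omega
    have hN : H.neighborSet v = {v}ᶜ := by
      ext z
      rw [mem_neighborSet, Set.mem_compl_singleton_iff, hadj]
      exact ⟨fun h => h.1.symm, fun h => ⟨h.symm, Or.inl hvp⟩⟩
    have h2 := Set.ncard_add_ncard_compl ({v} : Set W)
    rw [Set.ncard_singleton, Nat.card_eq_fintype_card] at h2
    rw [deg, hN]
    omega

/-- A connected chordal labelled graph of maximum degree at most `k` that has no colouring with `k`
colours is exceptional, and its vertices of degree less than `k` have the same label. The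
induction removes these vertices and labels the others by their orbits. -/
theorem exceptional_of_not_labColorable (k n : ℕ) : ∀ {V : Type u} [Fintype V]
    {G : SimpleGraph V} {L : Type u} {lab : V → L}, Fintype.card V = n → G.Connected →
    IsChordal G → (∀ v, deg G v ≤ k) → ¬ LabColorable G lab k →
    Exceptional G k ∧ ∀ x y, deg G x < k → deg G y < k → lab x = lab y := by
  induction n using Nat.strong_induction_on with
  | _ n ih =>
  intro V _ G L lab hn hc hch hdeg hcol
  classical
  by_cases hreg : ∀ v, deg G v = k
  · obtain ⟨v⟩ := hc.nonempty
    refine ⟨Or.inl ⟨{v}, ⟨v, rfl⟩, fun a b hab => iff_of_true ?_ ?_⟩, fun x _ hx => ?_⟩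
    · exact hch.adj_of_regular hc hreg hab
    · rintro ⟨h1, h2⟩
      exact hab (h1.trans h2.symm)
    · exact absurd (hreg x) hx.ne
  push Not at hreg
  obtain ⟨u₀, hu₀⟩ := hreg
  have hu₀' : deg G u₀ < k := lt_of_le_of_ne (hdeg u₀) hu₀
  rcases isSplit_or_inPiece hc hch hdeg hcol with ⟨h1, h2⟩ | hp
  · exact ⟨Or.inl h1, h2⟩
  have hcard : Fintype.card (core G k) < n := by
    rw [← hn]; exact Fintype.card_subtype_lt (x := u₀) hu₀
  have hcolS := fun h => hcol (labColorable_of_core hdeg hp (by omega) h)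
  have hdegS : ∀ x, deg (G.induce (core G k)) x ≤ k := fun x => by
    rw [deg_induce]
    exact (Set.ncard_le_ncard Set.inter_subset_left (Set.toFinite _)).trans (hdeg x.1)
  obtain ⟨hE, hlabS⟩ := ih _ hcard rfl (core_connected hdeg hp hc) (hch.induce _) hdegS hcolS
  have hsame : ∀ x y : core G k, (∃ u, deg G u < k ∧ G.Adj u x.1) →
      (∃ u, deg G u < k ∧ G.Adj u y.1) → InOrbit G lab x.1 y.1 := by
    intro x y hx hy
    rw [← deg_core_lt_iff hdeg] at hx hy
    have h1 := hlabS x y hx hy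
    have h2 : y.1 ∈ {z | InOrbit G lab y.1 z} := ⟨Iso.refl, fun _ => rfl, rfl⟩
    rw [← h1] at h2
    exact h2
  -- all pendant parts are equivalent under automorphisms
  have hmove : ∀ u w, deg G u < k → deg G w < k → ∃ γ : G ≃g G, (∀ v, lab (γ v) = lab v) ∧
      ∃ p D U τ, IsPiece G k p D U τ ∧ w ∈ U ∧ γ u ∈ U ∧ D ⊆ core G k ∧
        (∀ w, w ∈ U ↔ w ∉ core G k ∧ G.neighborSet w ∩ core G k = D) ∧
        ∀ y ∈ U, lab y = lab w := by
    intro u w hu hw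
    obtain ⟨p₁, D₁, U₁, τ₁, h₁, huU, -, hD₁, -, -⟩ := (hp u hu).exists_core
    obtain ⟨p₂, D₂, U₂, τ₂, h₂, hwU, hp₂, hD₂, hU₂, hl₂⟩ := (hp w hw).exists_core
    obtain ⟨x, hx⟩ := h₁.nonempty_D
    obtain ⟨y, hy⟩ := h₂.nonempty_D
    obtain ⟨γ, hγ, hxy⟩ := hsame ⟨x, hD₁ hx⟩ ⟨y, hD₂ hy⟩ ⟨u, hu, h₁.adj_D_U hx huU⟩
      ⟨w, hw, h₂.adj_D_U hy hwU⟩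
    refine ⟨γ, hγ, p₂, D₂, U₂, τ₂, h₂, hwU, ?_, hD₂, hU₂, hl₂⟩
    have h1 : G.Adj y (γ u) := by
      have h2 : γ x = y := hxy
      rw [← h2]
      exact γ.map_adj_iff.2 (h₁.adj_D_U hx huU).symm
    have h2 : γ u ∉ core G k := by
      rw [notMem_core hdeg, deg_map]; exact hu
    rcases ((h₂.adj_D y hy _).1 h1).2 with h3 | h3 | h3
    · exact absurd (h3 ▸ hp₂) h2
    · exact absurd (hD₂ h3) h2
    · exact h3
  refine ⟨?_, fun u w hu hw => ?_⟩
  swap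
  · obtain ⟨γ, hγ, p, D, U, τ, -, -, hγu, -, -, hl⟩ := hmove u w hu hw
    rw [← hγ u, hl _ hγu]
  -- hence the sets `U` are either all independent or all complete
  have hom : ∀ a b, deg G a < k → deg G b < k → G.Adj a b → ∀ u w, deg G u < k → deg G w < k →
      G.neighborSet u ∩ core G k = G.neighborSet w ∩ core G k → u ≠ w → G.Adj u w := by
    intro a b ha hb hab u w hu hw huw hne
    obtain ⟨γ, hγ, p, D, U, τ, h, huU, hγa, hD, hU, -⟩ := hmove a u ha hu
    have h1 : G.Adj (γ a) (γ b) := γ.map_adj_iff.2 hab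
    have hwU : w ∈ U := (hU w).2 ⟨(notMem_core hdeg).2 hw, by rw [← huw]; exact ((hU u).1 huU).2⟩
    have hτ : τ := by
      rcases (h.adj_U _ hγa _).1 h1 with h2 | h2
      · have h3 : deg G (γ b) = k := hD h2
        rw [deg_map] at h3; omega
      · exact h2.2.2
    exact (h.adj_U u huU w).2 (Or.inr ⟨hwU, hne.symm, hτ⟩)
  obtain ⟨p, D, U, τ, hpc, huU, hpS, hD, hU, -⟩ := (hp u₀ hu₀').exists_core
  obtain ⟨x, hx⟩ := hpc.nonempty_D
  have hlt : ∀ y : core G k, y.1 ∈ D → deg (G.induce (core G k)) y < k := fun y hy =>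
    (deg_core_lt_iff hdeg y).2 ⟨u₀, hu₀', hpc.adj_D_U hy huU⟩
  have hk2 : 2 ≤ k := by
    have h1 := hpc.card
    have h2 := (Set.ncard_pos (Set.toFinite _)).2 hpc.nonempty_D
    have h3 := (Set.ncard_pos (Set.toFinite _)).2 hpc.nonempty_U
    omega
  have hxN : ∀ y : core G k, G.Adj x y.1 ↔ y.1 ≠ x ∧ (y.1 = p ∨ y.1 ∈ D) := by
    intro y
    have : y.1 ∉ U := fun h => ((hU y.1).1 h).1 y.2
    rw [hpc.adj_D x hx]; tauto
  rcases hE with ⟨I, -, hI⟩ | ⟨ℓ, h, hh, -, hT⟩ | ⟨T, ℓ, h, hh, hk, hT, hG⟩ | ⟨-, hE1, hE2⟩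
  · -- a complete split core is a star: the clique `D` is a single vertex of `I`
    have hkS := lt_card_of_not_labColorable hcolS
    have hDI : ∀ y : core G k, y.1 ∈ D → y ∈ I := by
      intro y hy
      by_contra hyI
      have hN : (G.induce (core G k)).neighborSet y = {y}ᶜ := by
        ext z
        rw [mem_neighborSet, Set.mem_compl_singleton_iff]
        exact ⟨fun h => h.ne', fun h => (hI y z h.symm).2 fun h' => hyI h'.1⟩
      have h1 := hlt y hy
      have h2 := Set.ncard_add_ncard_compl ({y} : Set (core G k))
      rw [Set.ncard_singleton, Nat.card_eq_fintype_card] at h2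
      rw [deg, hN] at h1
      omega
    have hDx : ∀ y ∈ D, y = x := by
      intro y hy
      by_contra hyx
      exact (hI ⟨y, hD hy⟩ ⟨x, hD hx⟩ fun e => hyx (congrArg Subtype.val e)).1
        (hpc.adj_mem_D hy hx hyx) ⟨hDI ⟨y, hD hy⟩ hy, hDI ⟨x, hD hx⟩ hx⟩
    have hxp : x ≠ p := fun e => hpc.notMem_D (e ▸ hx)
    have hIp : ∀ y : core G k, y ∈ I ↔ y.1 ≠ p := by
      intro y
      by_cases hyx : y.1 = x
      · have : y = ⟨x, hD hx⟩ := Subtype.ext hyx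
        subst this
        exact iff_of_true (hDI ⟨x, hD hx⟩ hx) hxp
      · have h1 := hI ⟨x, hD hx⟩ y fun e => hyx (congrArg Subtype.val e).symm
        have h2 : G.Adj x y.1 ↔ ¬ (⟨x, hD hx⟩ ∈ I ∧ y ∈ I) := h1
        have h3 := hDI ⟨x, hD hx⟩ hx
        have h4 := hxN y
        have h5 : y.1 ∈ D → y.1 = x := hDx y.1
        tauto
    have hadj : ∀ a b : core G k, (G.induce (core G k)).Adj a b ↔
        a ≠ b ∧ (a = ⟨p, hpS⟩ ∨ b = ⟨p, hpS⟩) := by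
      intro a b
      have hval : ∀ z : core G k, z = ⟨p, hpS⟩ ↔ z.1 = p := fun z => Subtype.ext_iff
      by_cases hab : a = b
      · subst hab; exact iff_of_false (SimpleGraph.irrefl _) fun h => h.1 rfl
      · rw [hI a b hab, hIp, hIp, hval, hval]; tauto
    have hcardS : Fintype.card (core G k) = k + 1 := by
      have hN : (G.induce (core G k)).neighborSet ⟨p, hpS⟩ = {⟨p, hpS⟩}ᶜ := by
        ext z
        rw [mem_neighborSet, Set.mem_compl_singleton_iff, hadj]
        exact ⟨fun h => h.1.symm, fun h => ⟨h.symm, Or.inl rfl⟩⟩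
      have h1 := hdegS ⟨p, hpS⟩
      have h2 := Set.ncard_add_ncard_compl ({⟨p, hpS⟩} : Set (core G k))
      rw [Set.ncard_singleton, Nat.card_eq_fintype_card] at h2
      rw [deg, hN] at h1
      omega
    exact exceptional_of_core_levelTree hdeg hp hom le_rfl hk2 (isLevelTree_star hadj hcardS)
  · exact exceptional_of_core_levelTree hdeg hp hom hh hk2 hT
  · exact exceptional_of_core_graphA hdeg hp hh hk hT hG
  · -- in the core `D` would be a single vertex with `p` as its only neighbour
    exfalso
    have h1 := hE1 ⟨x, hD hx⟩ (hlt ⟨x, hD hx⟩ hx)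
    have hN : (G.induce (core G k)).neighborSet ⟨x, hD hx⟩ ⊆ {⟨p, hpS⟩} := by
      intro y hy
      obtain ⟨hyx, h2 | h2⟩ := (hxN y).1 hy
      · exact Subtype.ext h2
      · exact absurd hy (hE2 _ _ (hlt ⟨x, hD hx⟩ hx) (hlt y h2))
    have h2 := Set.ncard_le_ncard hN (Set.toFinite _)
    rw [Set.ncard_singleton] at h2
    rw [deg] at h1
    omega

end Main

/-! ### Graphs without a distinguishing colouring -/

section Lower

/-- No proper colouring with `k` colours is distinguishing. -/
def NoDist {V : Type*} (G : SimpleGraph V) (k : ℕ) : Prop :=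
  ∀ c : V → Fin k, (∀ a b, G.Adj a b → c a ≠ c b) →
    ∃ φ : G ≃g G, (∀ v, c (φ v) = c v) ∧ ∃ v, φ v ≠ v

section

variable {V W : Type*} {G : SimpleGraph V} {H : SimpleGraph W} {k : ℕ}

theorem NoDist.of_iso (h : NoDist H k) (e : G ≃g H) : NoDist G k := by
  intro c hc
  obtain ⟨φ, hφ, v, hv⟩ := h (fun w => c (e.symm w)) fun a b hab =>
    hc _ _ (e.symm.map_adj_iff.2 hab)
  refine ⟨(e.trans φ).trans e.symm, fun x => ?_, e.symm v, fun h => hv ?_⟩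
  · have := hφ (e x)
    rwa [e.symm_apply_apply] at this
  · have h1 : e.symm (φ (e (e.symm v))) = e.symm v := h
    rw [e.apply_symm_apply] at h1
    exact e.symm.injective h1

/-- Exchanging two vertices with the same neighbours. -/
theorem exists_aut_of_twins {κ : Type*} {c : V → κ} {a b : V} (hab : a ≠ b)
    (htw : ∀ x, G.Adj a x ↔ G.Adj b x) (hc : c a = c b) :
    ∃ φ : G ≃g G, (∀ v, c (φ v) = c v) ∧ ∃ v, φ v ≠ v := by
  classical
  have hnab : ¬ G.Adj a b := fun h => SimpleGraph.irrefl _ ((htw b).1 h)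
  refine ⟨⟨Equiv.swap a b, ?_⟩, fun v => ?_, a, ?_⟩
  · intro x y
    simp only [Equiv.swap_apply_def]
    have h1 := htw x
    have h2 := htw y
    have h3 := G.adj_comm
    split_ifs <;> simp_all
  · change c (Equiv.swap a b v) = c v
    rw [Equiv.swap_apply_def]
    split_ifs <;> simp_all
  · change Equiv.swap a b a ≠ a
    rw [Equiv.swap_apply_left]; exact hab.symm

/-- Two vertices of the same colour are nonadjacent, so they can be exchanged. -/
theorem IsSplit.noDist [Fintype V] (h : IsSplit G) (hk : k < Fintype.card V) : NoDist G k := by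
  intro c hc
  obtain ⟨a, b, hab, heq⟩ := Fintype.exists_ne_map_eq_of_card_lt c (by simpa using hk)
  obtain ⟨I, -, hI⟩ := h
  have hI' : a ∈ I ∧ b ∈ I := by
    by_contra hn
    exact hc a b ((hI a b hab).2 hn) heq
  refine exists_aut_of_twins hab (fun x => ?_) heq
  have key : ∀ a ∈ I, G.Adj a x ↔ x ∉ I := by
    intro a ha
    by_cases hax : a = x
    · subst hax; exact iff_of_false (SimpleGraph.irrefl _) fun h => h ha
    · rw [hI a x hax]; tauto
  rw [key a hI'.1, key b hI'.2]

/-- Suppose that `G` arises from `H` by adding vertices, each of which is joined to a clique of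
`H` and which together with all new vertices joined to the same clique needs all remaining colours.
Then a colour-preserving automorphism of `H` extends to `G`. -/
theorem NoDist.extend [Finite V] [Finite W] (hH : NoDist H k) (f : H ↪g G) (τ : Prop)
    (hcl : ∀ u, u ∉ Set.range f → ∀ x y, G.Adj u (f x) → G.Adj u (f y) → x ≠ y → H.Adj x y)
    (hcard : ∀ u, u ∉ Set.range f → {x | G.Adj u (f x)}.ncard +
      {w | w ∉ Set.range f ∧ {x | G.Adj w (f x)} = {x | G.Adj u (f x)}}.ncard = k)
    (hτ : ∀ u w, u ∉ Set.range f → w ∉ Set.range f →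
      (G.Adj u w ↔ u ≠ w ∧ {x | G.Adj u (f x)} = {x | G.Adj w (f x)} ∧ τ))
    (hmap : ∀ φ : H ≃g H, ∀ u, u ∉ Set.range f →
      ∃ w, w ∉ Set.range f ∧ {x | G.Adj w (f x)} = φ '' {x | G.Adj u (f x)}) : NoDist G k := by
  classical
  intro c hc
  let A : V → Set W := fun u => {x | G.Adj u (f x)}
  -- two new vertices of the same colour that are joined to the same clique can be exchanged
  by_cases htw : ∃ u w, u ∉ Set.range f ∧ w ∉ Set.range f ∧ u ≠ w ∧ A u = A w ∧ c u = c w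
  · obtain ⟨u, w, hu, hw, huw, hA, hcuw⟩ := htw
    refine exists_aut_of_twins huw (fun x => ?_) hcuw
    by_cases hx : x ∈ Set.range f
    · obtain ⟨y, rfl⟩ := hx
      change y ∈ A u ↔ y ∈ A w
      rw [hA]
    · have hnτ : ¬ τ := fun h => hc u w ((hτ u w hu hw).2 ⟨huw, hA, h⟩) hcuw
      rw [hτ u x hu hx, hτ w x hw hx]
      tauto
  have hinj : ∀ u w, u ∉ Set.range f → w ∉ Set.range f → A u = A w → c u = c w → u = w := by
    intro u w hu hw hA hcuw
    by_contra h
    exact htw ⟨u, w, hu, hw, h, hA, hcuw⟩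
  obtain ⟨φ, hφ, x₀, hx₀⟩ := hH (fun x => c (f x)) fun a b hab => hc _ _ (f.map_adj_iff.2 hab)
  have hex : ∀ u, u ∉ Set.range f → ∃ w, w ∉ Set.range f ∧ A w = φ '' A u ∧ c w = c u := by
    intro u hu
    obtain ⟨w, hw, hAw⟩ := hmap φ u hu
    -- the colours of the new vertices with neighbourhood `A w` are those missing on `A w`
    let U : Set V := {v | v ∉ Set.range f ∧ A v = A w}
    have h1 : (c '' U).ncard = U.ncard := Set.InjOn.ncard_image fun a ha b hb hab =>
      hinj a b ha.1 hb.1 (ha.2.trans hb.2.symm) hab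
    have h2 : ((fun x => c (f x)) '' A w).ncard = (A w).ncard :=
      Set.InjOn.ncard_image fun a ha b hb hab => by
        by_contra hne
        exact hc _ _ (f.map_adj_iff.2 (hcl w hw a b ha hb hne)) hab
    have h3 : Disjoint ((fun x => c (f x)) '' A w) (c '' U) := by
      rw [Set.disjoint_left]
      rintro _ ⟨x, hx, rfl⟩ ⟨v, hv, hvx⟩
      have hvx' : x ∈ A v := hv.2 ▸ hx
      exact hc v (f x) hvx' hvx
    have h4 : ((fun x => c (f x)) '' A w ∪ c '' U) = Set.univ := by
      refine Set.eq_of_subset_of_ncard_le (Set.subset_univ _) ?_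
      rw [Set.ncard_union_eq h3, h1, h2, Set.ncard_univ, Nat.card_eq_fintype_card,
        Fintype.card_fin]
      exact (hcard w hw).ge
    have h5 : c u ∈ (fun x => c (f x)) '' A w ∪ c '' U := by rw [h4]; exact Set.mem_univ _
    rcases h5 with ⟨x, hx, hxu⟩ | ⟨v, hv, hvu⟩
    · have hx' : x ∈ φ '' A u := hAw ▸ hx
      obtain ⟨y, hy, rfl⟩ := hx'
      exact absurd ((hφ y).symm.trans hxu).symm (hc u (f y) hy)
    · exact ⟨v, hv.1, hv.2.trans hAw, hvu⟩
  choose g hg1 hg2 hg3 using hex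
  -- the extension of `φ`, through `g` on the new vertices
  let ψ : V → V := fun v => if hv : v ∈ Set.range f then f (φ hv.choose) else g v hv
  have hψ1 : ∀ x, ψ (f x) = f (φ x) := fun x => by
    have hx : f x ∈ Set.range f := ⟨x, rfl⟩
    change (if hv : f x ∈ Set.range f then f (φ hv.choose) else g (f x) hv) = _
    rw [dif_pos hx, f.injective hx.choose_spec]
  have hψ2 : ∀ v (hv : v ∉ Set.range f), ψ v = g v hv := fun v hv => dif_neg hv
  have hadj1 : ∀ x v, v ∉ Set.range f → (G.Adj (ψ v) (ψ (f x)) ↔ G.Adj v (f x)) := by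
    intro x v hv
    rw [hψ1, hψ2 v hv]
    change φ x ∈ A (g v hv) ↔ x ∈ A v
    rw [hg2, φ.injective.mem_set_image]
  have hψinj : Function.Injective ψ := by
    intro a b hab
    by_cases ha : a ∈ Set.range f <;> by_cases hb : b ∈ Set.range f
    · obtain ⟨x, rfl⟩ := ha
      obtain ⟨y, rfl⟩ := hb
      rw [hψ1, hψ1] at hab
      rw [φ.injective (f.injective hab)]
    · obtain ⟨x, rfl⟩ := ha
      rw [hψ1, hψ2 b hb] at hab
      exact absurd ⟨_, hab⟩ (hg1 b hb)
    · obtain ⟨y, rfl⟩ := hb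
      rw [hψ1, hψ2 a ha] at hab
      exact absurd ⟨_, hab.symm⟩ (hg1 a ha)
    · rw [hψ2 a ha, hψ2 b hb] at hab
      refine hinj a b ha hb (φ.injective.image_injective ?_) ?_
      · rw [← hg2 a ha, ← hg2 b hb, hab]
      · rw [← hg3 a ha, ← hg3 b hb, hab]
  have hadj : ∀ a b, G.Adj (ψ a) (ψ b) ↔ G.Adj a b := by
    intro a b
    by_cases ha : a ∈ Set.range f <;> by_cases hb : b ∈ Set.range f
    · obtain ⟨x, rfl⟩ := ha
      obtain ⟨y, rfl⟩ := hb
      rw [hψ1, hψ1, f.map_adj_iff, f.map_adj_iff, φ.map_adj_iff]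
    · obtain ⟨x, rfl⟩ := ha
      rw [G.adj_comm, hadj1 x b hb, G.adj_comm]
    · obtain ⟨y, rfl⟩ := hb
      exact hadj1 y a ha
    · have h1 : ψ a ∉ Set.range f := by rw [hψ2 a ha]; exact hg1 a ha
      have h2 : ψ b ∉ Set.range f := by rw [hψ2 b hb]; exact hg1 b hb
      have h3 : A (ψ a) = φ '' A a := by rw [hψ2 a ha]; exact hg2 a ha
      have h4 : A (ψ b) = φ '' A b := by rw [hψ2 b hb]; exact hg2 b hb
      rw [hτ _ _ h1 h2, hτ _ _ ha hb, hψinj.ne_iff]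
      change a ≠ b ∧ A (ψ a) = A (ψ b) ∧ τ ↔ a ≠ b ∧ A a = A b ∧ τ
      rw [h3, h4, φ.injective.image_injective.eq_iff]
  refine ⟨⟨Equiv.ofBijective ψ (Finite.injective_iff_bijective.1 hψinj), fun {a b} => hadj a b⟩,
    fun v => ?_, f x₀, ?_⟩
  · change c (ψ v) = c v
    by_cases hv : v ∈ Set.range f
    · obtain ⟨x, rfl⟩ := hv
      rw [hψ1]; exact hφ x
    · rw [hψ2 v hv, hg3]
  · change ψ (f x₀) ≠ f x₀
    rw [hψ1]
    exact fun h => hx₀ (f.injective h)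

end

namespace IsLevelTree

variable {V : Type u} {T : SimpleGraph V} {ℓ : V → ℕ} {h k : ℕ}

theorem star_adj (hT : IsLevelTree T ℓ 1 k) (a b : V) :
    T.Adj a b ↔ (ℓ a = 0 ∧ ℓ b = 1) ∨ (ℓ a = 1 ∧ ℓ b = 0) := by
  obtain ⟨r, hr0, hr⟩ := hT.root
  have h1 : ∀ a b, ℓ a = 0 → ℓ b = 1 → T.Adj b a := by
    intro a b ha hb
    obtain ⟨p, ⟨hp, hlp⟩, -⟩ := hT.parent b (by omega)
    rw [hr a ha, ← hr p (by omega)]; exact hp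
  constructor
  · intro hab
    have := hT.adj a b hab
    have := hT.le a
    have := hT.le b
    omega
  · rintro (⟨ha, hb⟩ | ⟨ha, hb⟩)
    · exact (h1 a b ha hb).symm
    · exact h1 b a hb ha

variable [Fintype V]

/-- Adding the last level, in which the `k - 1` children of each vertex form an independent set, or
a clique if `τ` holds. -/
theorem noDist_step {G : SimpleGraph V} (τ : Prop) (hT : IsLevelTree T ℓ (h + 1) k) (hh : 1 ≤ h)
    (hk : 2 ≤ k) (hG : ∀ x y, ℓ x < h + 1 → (G.Adj x y ↔ T.Adj x y))
    (hG' : ∀ u w q, ℓ u = h + 1 → ℓ w = h + 1 → T.Adj q u →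
      (G.Adj u w ↔ u ≠ w ∧ T.Adj q w ∧ τ))
    (hH : NoDist (T.induce {v | ℓ v < h + 1}) k) : NoDist G k := by
  have hTp := hT.prune
  let f : T.induce {v | ℓ v < h + 1} ↪g G :=
    ⟨⟨Subtype.val, Subtype.val_injective⟩, fun {a b} => hG a.1 b.1 a.2⟩
  have hr : ∀ u, u ∉ Set.range f ↔ ℓ u = h + 1 := by
    intro u
    have hle := hT.le u
    constructor
    · intro hu
      by_contra hne
      exact hu ⟨⟨u, show ℓ u < h + 1 by omega⟩, rfl⟩
    · rintro hu ⟨x, rfl⟩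
      have : ℓ x.1 < h + 1 := x.2
      have hu' : ℓ x.1 = h + 1 := hu
      omega
  have hA : ∀ u, ℓ u = h + 1 → ∃ q : {v | ℓ v < h + 1}, T.Adj q.1 u ∧ ℓ q.1 = h ∧
      {x | G.Adj u (f x)} = {q} := by
    intro u hu
    obtain ⟨q, hq, hlq⟩ := hT.exists_neighborSet_eq (by omega) hu
    have hq' : ∀ y, T.Adj u y ↔ y = q := fun y => by
      rw [← mem_neighborSet, hq, Set.mem_singleton_iff]
    refine ⟨⟨q, show ℓ q < h + 1 by omega⟩, ((hq' q).2 rfl).symm, by simpa using hlq, ?_⟩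
    ext x
    change G.Adj u x.1 ↔ x = _
    rw [G.adj_comm, hG x.1 u x.2, T.adj_comm, hq', Subtype.ext_iff]
  have hAiff : ∀ (q : {v | ℓ v < h + 1}) w, ℓ w = h + 1 →
      ({x | G.Adj w (f x)} = {q} ↔ T.Adj q.1 w) := by
    intro q w hw
    obtain ⟨q', h1, -, h2⟩ := hA w hw
    rw [h2, Set.singleton_eq_singleton_iff]
    constructor
    · rintro rfl; exact h1
    · intro h3
      have h4 : q ∈ {x | G.Adj w (f x)} := ((hG q.1 w q.2).2 h3).symm
      rw [h2] at h4
      exact (Set.mem_singleton_iff.1 h4).symm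
  refine hH.extend f τ ?_ ?_ ?_ ?_
  · intro u hu x y hx hy hxy
    obtain ⟨q, -, -, hq⟩ := hA u ((hr u).1 hu)
    have h1 : x ∈ {x | G.Adj u (f x)} := hx
    have h2 : y ∈ {x | G.Adj u (f x)} := hy
    rw [hq, Set.mem_singleton_iff] at h1 h2
    exact absurd (h1.trans h2.symm) hxy
  · intro u hu
    obtain ⟨q, -, hlq, hq⟩ := hA u ((hr u).1 hu)
    rw [hq, Set.ncard_singleton, ← hT.ncard_leaves (by omega) (q := q.1) (by omega), add_comm]
    congr 2
    ext w
    constructor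
    · rintro ⟨h1, h2⟩
      rw [hr] at h1
      exact ⟨h1, (hAiff q w h1).1 h2⟩
    · rintro ⟨h1, h2⟩
      exact ⟨(hr w).2 h1, (hAiff q w h1).2 h2⟩
  · intro u w hu hw
    rw [hr] at hu hw
    obtain ⟨q, hqu, -, hq⟩ := hA u hu
    rw [hG' u w q.1 hu hw hqu, hq, eq_comm (a := ({q} : Set _)), hAiff q w hw]
  · intro φ u hu
    obtain ⟨q, hqu, hlq, hq⟩ := hA u ((hr u).1 hu)
    have h1 : ℓ (φ q).1 = h := by
      rw [← hTp.deg_lt_iff hh hk, deg_map, hTp.deg_lt_iff hh hk]; exact hlq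
    obtain ⟨w, hw, hlw⟩ := hT.exists_child hk (v := (φ q).1) (by omega)
    have hlw' : ℓ w = h + 1 := by omega
    refine ⟨w, (hr w).2 hlw', ?_⟩
    rw [hq, Set.image_singleton]
    exact (hAiff (φ q) w hlw').2 hw

theorem isSplit_star (hT : IsLevelTree T ℓ 1 k) (hk : 2 ≤ k) : IsSplit T := by
  obtain ⟨r, hr0, hr⟩ := hT.root
  obtain ⟨u, -, hu⟩ := hT.exists_child hk (v := r) (by omega)
  refine ⟨{a | ℓ a = 1}, ⟨u, show ℓ u = 1 by omega⟩, fun a b hab => ?_⟩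
  have h1 := hT.le a
  have h2 := hT.le b
  have h3 : ¬ (ℓ a = 0 ∧ ℓ b = 0) := fun h => hab ((hr a h.1).trans (hr b h.2).symm)
  rw [hT.star_adj]
  change _ ↔ ¬ (ℓ a = 1 ∧ ℓ b = 1)
  omega

theorem noDist (hk : 2 ≤ k) (n : ℕ) : ∀ {V : Type u} [Fintype V] {T : SimpleGraph V} {ℓ : V → ℕ},
    IsLevelTree T ℓ (n + 1) k → NoDist T k := by
  induction n with
  | zero =>
    intro V _ T ℓ hT
    obtain ⟨r, hr0, hr⟩ := hT.root
    refine (hT.isSplit_star hk).noDist ?_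
    rw [← hT.deg_eq r (by omega), deg, ← Nat.card_eq_fintype_card, ← Set.ncard_univ]
    refine Set.ncard_lt_ncard ?_ (Set.toFinite _)
    rw [Set.ssubset_univ_iff]
    exact fun h => SimpleGraph.irrefl T (v := r) (h ▸ Set.mem_univ r : r ∈ T.neighborSet r)
  | succ n ih =>
    intro V _ T ℓ hT
    classical
    refine hT.noDist_step False (by omega) hk (fun _ _ _ => Iff.rfl) ?_ (ih hT.prune)
    intro u w q hu hw _
    refine iff_of_false (fun h => ?_) fun h => h.2.2
    have := hT.adj u w h
    omega

theorem noDist_graphA (hT : IsLevelTree T ℓ h k) (hh : 2 ≤ h) (hk : 2 ≤ k) :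
    NoDist (graphA T) k := by
  classical
  obtain ⟨h, rfl⟩ : ∃ n, h = n + 1 + 1 := ⟨h - 2, by omega⟩
  refine hT.noDist_step True (by omega) hk
    (fun x y hx => hT.graphA_adj_of_lt (by omega) hk hx) ?_ (noDist hk _ hT.prune)
  intro u w q hu hw hqu
  have hwq : w ≠ q := fun e => by
    have h1 := hT.adj q u hqu
    have := hT.le u
    rw [e] at hw; omega
  rw [hT.graphA_adj_leaf (by omega) hk hu hqu.symm]
  constructor
  · rintro (h1 | ⟨h1, -, h2⟩)
    · exact absurd h1 hwq
    · exact ⟨h1.symm, h2, trivial⟩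
  · rintro ⟨h1, h2, -⟩
    exact Or.inr ⟨h1.symm, hw, h2⟩

/-- The new vertices of `T_B` are joined to cliques of `k - 1` leaves of `T_A`. -/
theorem noDist_graphB (hT : IsLevelTree T ℓ h k) (hh : 2 ≤ h) (hk : 2 ≤ k) :
    NoDist (graphB T) k := by
  classical
  let f : graphA T ↪g graphB T := ⟨⟨Sum.inl, Sum.inl_injective⟩, Iff.rfl⟩
  have hleaf := fun x => hT.isLeaf_iff (by omega) hk x
  have hr : ∀ u, u ∉ Set.range f → ∃ q, u = Sum.inr q := by
    rintro (a | q) hu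
    · exact absurd ⟨a, rfl⟩ hu
    · exact ⟨q, rfl⟩
  have hr' : ∀ q, Sum.inr q ∉ Set.range f := by
    rintro q ⟨a, ha⟩
    cases (show Sum.inl a = Sum.inr q from ha)
  have hA : ∀ q, {x | (graphB T).Adj (Sum.inr q) (f x)} = {x | ℓ x = h ∧ T.Adj q.1 x} := by
    intro q
    ext x
    change T.Adj q.1 x ∧ IsLeaf T x ↔ ℓ x = h ∧ T.Adj q.1 x
    rw [hleaf]; tauto
  have huniq : ∀ q q' x, ℓ x = h → T.Adj q x → T.Adj q' x → q = q' := by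
    intro q q' x hx hq hq'
    obtain ⟨p, hp, -⟩ := hT.exists_neighborSet_eq (by omega) hx
    have h1 : q ∈ T.neighborSet x := hq.symm
    have h2 : q' ∈ T.neighborSet x := hq'.symm
    rw [hp, Set.mem_singleton_iff] at h1 h2
    exact h1.trans h2.symm
  have hsup : ∀ q : {v // IsSupport T v}, ∃ x, T.Adj q.1 x ∧ ℓ x = h := fun q =>
    (hT.isSupport_iff (by omega) hk q.1).1 q.2
  have hlt : ∀ q x, ℓ x = h → T.Adj q x → ℓ q + 1 = h := fun q x hx hq => by
    have := hT.adj q x hq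
    have := hT.le q
    omega
  have hφ : ∀ (φ : graphA T ≃g graphA T) x, ℓ (φ x) = h ↔ ℓ x = h := by
    intro φ x
    have h1 := deg_map φ x
    rcases (hT.le x).lt_or_eq with h2 | h2 <;> rcases (hT.le (φ x)).lt_or_eq with h3 | h3
    · omega
    · rw [hT.deg_graphA_of_lt (by omega) hk h2] at h1
      have := hT.deg_graphA_leaf hh hk h3
      omega
    · rw [hT.deg_graphA_of_lt (by omega) hk h3] at h1
      have := hT.deg_graphA_leaf hh hk h2
      omega
    · omega
  have hφ' : ∀ (φ : graphA T ≃g graphA T) q x, ℓ x = h → T.Adj q x → T.Adj (φ q) (φ x) := by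
    intro φ q x hx hqx
    have h1 : (graphA T).Adj (φ q) (φ x) := φ.map_adj_iff.2 (Or.inl hqx)
    have h2 : ℓ (φ q) ≠ h := fun h2 => by
      have := hlt q x hx hqx
      rw [hφ] at h2; omega
    exact (hT.graphA_adj_of_lt (by omega) hk (lt_of_le_of_ne (hT.le _) h2)).1 h1
  refine (hT.noDist_graphA hh hk).extend f False ?_ ?_ ?_ ?_
  · intro u hu x y hx hy hxy
    obtain ⟨q, rfl⟩ := hr u hu
    have hx' : x ∈ {x | (graphB T).Adj (Sum.inr q) (f x)} := hx
    have hy' : y ∈ {x | (graphB T).Adj (Sum.inr q) (f x)} := hy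
    rw [hA] at hx' hy'
    exact Or.inr ⟨hxy, (hleaf x).2 hx'.1, (hleaf y).2 hy'.1, q.1, hx'.2, hy'.2⟩
  · intro u hu
    obtain ⟨q, rfl⟩ := hr u hu
    obtain ⟨x, hqx, hx⟩ := hsup q
    have h1 : {w | w ∉ Set.range f ∧ {x | (graphB T).Adj w (f x)} =
        {x | (graphB T).Adj (Sum.inr q) (f x)}} = {Sum.inr q} := by
      refine Set.eq_singleton_iff_unique_mem.2 ⟨⟨hr' q, rfl⟩, ?_⟩
      rintro w ⟨hw, hw'⟩
      obtain ⟨q', rfl⟩ := hr w hw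
      rw [hA, hA] at hw'
      have h2 : x ∈ {x | ℓ x = h ∧ T.Adj q'.1 x} := by rw [hw']; exact ⟨hx, hqx⟩
      exact congrArg Sum.inr (Subtype.ext (huniq _ _ x hx h2.2 hqx))
    rw [h1, Set.ncard_singleton, hA]
    exact hT.ncard_leaves hh (hlt _ x hx hqx)
  · intro u w hu hw
    obtain ⟨q, rfl⟩ := hr u hu
    obtain ⟨q', rfl⟩ := hr w hw
    exact iff_of_false id fun h => h.2.2
  · intro φ u hu
    obtain ⟨q, rfl⟩ := hr u hu
    obtain ⟨x, hqx, hx⟩ := hsup q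
    refine ⟨Sum.inr ⟨φ q.1, (hT.isSupport_iff (by omega) hk _).2
      ⟨φ x, hφ' φ _ _ hx hqx, (hφ φ x).2 hx⟩⟩, hr' _, ?_⟩
    rw [hA, hA]
    ext y
    constructor
    · rintro ⟨h1, h2⟩
      refine ⟨φ.symm y, ⟨(hφ φ.symm y).2 h1, ?_⟩, φ.apply_symm_apply y⟩
      have := hφ' φ.symm _ _ h1 h2
      rwa [show φ.symm (φ q.1) = q.1 from φ.symm_apply_apply _] at this
    · rintro ⟨y, ⟨h1, h2⟩, rfl⟩
      exact ⟨(hφ φ y).2 h1, hφ' φ _ _ h1 h2⟩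

end IsLevelTree

end Lower

/-! ### The distinguishing chromatic number and the exceptional graphs -/

section Final

variable {V : Type u} {G : SimpleGraph V}

theorem exists_coloring_iff_labColorable {n : ℕ} :
    (∃ c : G.Coloring (Fin n), IsDistinguishing c) ↔
      LabColorable G (fun _ => PUnit.unit.{u + 1}) n := by
  constructor
  · rintro ⟨c, hc⟩
    exact ⟨c, fun a b h => c.valid h, fun φ _ h => hc φ h⟩
  · rintro ⟨c, h1, h2⟩
    exact ⟨Coloring.mk c fun {a b} h => h1 a b h, fun φ h => h2 φ (fun _ => rfl) h⟩

theorem IsSplit.of_iso {W : Type*} {H : SimpleGraph W} (h : IsSplit H) (e : G ≃g H) :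
    IsSplit G := by
  obtain ⟨I, ⟨x, hx⟩, hI⟩ := h
  refine ⟨e ⁻¹' I, ⟨e.symm x, by simpa using hx⟩, fun a b hab => ?_⟩
  rw [← e.map_adj_iff, hI _ _ (e.injective.ne hab)]; rfl

theorem isSplit_of_iso_join {α β : Type*} [Nonempty α]
    (e : G ≃g join (⊥ : SimpleGraph α) (⊤ : SimpleGraph β)) : IsSplit G := by
  have hs : IsSplit (join (⊥ : SimpleGraph α) (⊤ : SimpleGraph β)) := by
    obtain ⟨a⟩ := ‹Nonempty α›
    refine ⟨Set.range Sum.inl, ⟨_, a, rfl⟩, ?_⟩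
    rintro (a | a) (b | b) hab <;> simp_all [join]
  exact hs.of_iso e

theorem isSplit_of_subsingleton [Subsingleton V] [Nonempty V] : IsSplit G :=
  ⟨Set.univ, Set.univ_nonempty, fun a b hab => absurd (Subsingleton.elim a b) hab⟩

variable [Fintype V]

theorem exists_coloring_distChromaticNumber (G : SimpleGraph V) :
    ∃ c : G.Coloring (Fin (distChromaticNumber G)), IsDistinguishing c :=
  Nat.sInf_mem (s := {n : ℕ | ∃ c : G.Coloring (Fin n), IsDistinguishing c})
    ⟨_, exists_isDistinguishing G⟩

theorem distChromaticNumber_le_iff {k : ℕ} : distChromaticNumber G ≤ k ↔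
    LabColorable G (fun _ => PUnit.unit.{u + 1}) k := by
  constructor
  · intro hle
    obtain ⟨c, hc⟩ := exists_coloring_distChromaticNumber G
    refine ⟨fun v => Fin.castLE hle (c v), fun a b h e => ?_, fun φ _ h => hc φ fun v => ?_⟩
    · exact c.valid h (Fin.castLE_injective hle e)
    · exact Fin.castLE_injective hle (h v)
  · intro h
    exact Nat.sInf_le (exists_coloring_iff_labColorable.2 h)

theorem NoDist.lt_distChromaticNumber {k : ℕ} (h : NoDist G k) : k < distChromaticNumber G := by
  by_contra! hle
  obtain ⟨c, h1, h2⟩ := distChromaticNumber_le_iff.1 hle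
  obtain ⟨φ, h3, v, h4⟩ := h c h1
  exact h4 (h2 φ (fun _ => rfl) h3 v)

/-- With one colour more than the degrees, any vertex can be the root, and there are no pendant
parts, as these contain vertices of degree `k + 1`. -/
theorem distChromaticNumber_le {k : ℕ} (hc : G.Connected) (hch : IsChordal G)
    (hdeg : ∀ v, deg G v ≤ k) : distChromaticNumber G ≤ k + 1 := by
  obtain ⟨r⟩ := hc.nonempty
  rw [distChromaticNumber_le_iff]
  refine (labColorable_or_isPiece hc hch (fun v => (hdeg v).trans k.le_succ)
    (r := r) (Nat.lt_succ_of_le (hdeg r))).resolve_right ?_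
  rintro ⟨p, D, U, τ, hp, -⟩
  obtain ⟨x, hx⟩ := hp.nonempty_D
  have := hp.deg_D hx
  have := hdeg x
  omega

/-- A maximum independent set is the set `I` of a complete split graph, and a maximum clique is its
complement together with one vertex of `I`. -/
theorem IsSplit.nonempty_iso_join (h : IsSplit G) :
    Nonempty (G ≃g join (⊥ : SimpleGraph (Fin G.indepNum))
      (⊤ : SimpleGraph (Fin (G.cliqueNum - 1)))) := by
  classical
  obtain ⟨I, ⟨i, hi⟩, hI⟩ := h
  have hα : G.indepNum = Fintype.card I := by
    rw [← Set.toFinset_card]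
    apply le_antisymm
    · obtain ⟨s, hs, hcard⟩ := G.exists_isNIndepSet_indepNum
      rw [← hcard]
      by_cases hsI : s ⊆ I.toFinset
      · exact Finset.card_le_card hsI
      · obtain ⟨a, has, haI⟩ := Finset.not_subset.1 hsI
        rw [Set.mem_toFinset] at haI
        have : s ⊆ {a} := fun b hb => by
          rw [Finset.mem_singleton]
          by_contra hne
          exact hs hb has hne ((hI b a hne).2 fun h => haI h.2)
        refine (Finset.card_le_card this).trans ?_
        rw [Finset.card_singleton, Nat.one_le_iff_ne_zero, ← Nat.pos_iff_ne_zero, Finset.card_pos]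
        exact ⟨i, Set.mem_toFinset.2 hi⟩
    · refine IsIndepSet.card_le_indepNum (t := I.toFinset) ?_
      intro a ha b hb hab
      rw [hI a b hab, not_not]
      exact ⟨by simpa using ha, by simpa using hb⟩
  have hω : G.cliqueNum = Fintype.card (Iᶜ : Set V) + 1 := by
    rw [← Set.toFinset_card]
    apply le_antisymm
    · obtain ⟨s, hs⟩ := G.exists_isNClique_cliqueNum
      have hone : (s.filter (· ∈ I)).card ≤ 1 := by
        rw [Finset.card_le_one]
        intro a ha b hb
        rw [Finset.mem_filter] at ha hb
        by_contra hne
        exact (hI a b hne).1 (hs.1 ha.1 hb.1 hne) ⟨ha.2, hb.2⟩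
      rw [← hs.2, ← Finset.card_filter_add_card_filter_not (s := s) (· ∈ I), add_comm]
      refine add_le_add (Finset.card_le_card fun a ha => ?_) hone
      rw [Set.mem_toFinset]
      exact (Finset.mem_filter.1 ha).2
    · have hni : i ∉ (Iᶜ : Set V).toFinset := by simpa using hi
      rw [← Finset.card_insert_of_notMem hni]
      refine IsClique.card_le_cliqueNum (t := insert i (Iᶜ : Set V).toFinset) (tc := ?_)
      intro a ha b hb hab
      rw [hI a b hab]
      rintro ⟨h1, h2⟩
      simp only [Finset.coe_insert, Set.coe_toFinset, Set.mem_insert_iff,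
        Set.mem_compl_iff] at ha hb
      exact hab ((ha.resolve_right (not_not.2 h1)).trans (hb.resolve_right (not_not.2 h2)).symm)
  have e1 : I ≃ Fin G.indepNum := (Fintype.equivFin I).trans (finCongr hα.symm)
  have e2 : (Iᶜ : Set V) ≃ Fin (G.cliqueNum - 1) :=
    (Fintype.equivFin (Iᶜ : Set V)).trans (finCongr (by omega))
  refine ⟨(RelIso.symm ⟨(Equiv.sumCongr e1.symm e2.symm).trans (Equiv.Set.sumCompl I), ?_⟩)⟩
  rintro (a | a) (b | b)
  · have hab : ¬ G.Adj (e1.symm a : V) (e1.symm b) := fun h =>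
      (hI _ _ h.ne).1 h ⟨(e1.symm a).2, (e1.symm b).2⟩
    simpa [join] using hab
  · have hab : G.Adj (e1.symm a : V) (e2.symm b) := by
      refine (hI _ _ fun h : (e1.symm a : V) = e2.symm b => (e2.symm b).2 (h ▸ (e1.symm a).2)).2 ?_
      exact fun h => (e2.symm b).2 h.2
    simpa [join] using hab
  · have hab : G.Adj (e2.symm a : V) (e1.symm b) := by
      refine (hI _ _ fun h : (e2.symm a : V) = e1.symm b => (e2.symm a).2 (h ▸ (e1.symm b).2)).2 ?_
      exact fun h => (e2.symm a).2 h.1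
    simpa [join] using hab
  · have hab : G.Adj (e2.symm a : V) (e2.symm b) ↔ a ≠ b := by
      refine ⟨fun h e => h.ne (by rw [e]), fun h => (hI _ _ ?_).2 fun h => (e2.symm a).2 h.1⟩
      exact fun h' => h (e2.symm.injective (Subtype.ext h'))
    simpa [join] using hab

theorem indepNum_pos [Nonempty V] (G : SimpleGraph V) : 0 < G.indepNum := by
  obtain ⟨v⟩ := ‹Nonempty V›
  have : G.IsIndepSet (({v} : Finset V) : Set V) := by
    rw [Finset.coe_singleton]; exact Set.pairwise_singleton _ _
  exact this.card_le_indepNum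

theorem IsSplit.noDist_maxDegree [DecidableRel G.Adj] [Nonempty V] (h : IsSplit G) :
    NoDist G G.maxDegree := h.noDist G.maxDegree_lt_card_verts

namespace IsLevelTree

variable {T : SimpleGraph V} {ℓ : V → ℕ} {h k : ℕ}

theorem isLeaf_star (hT : IsLevelTree T ℓ 1 k) (hk : 2 ≤ k) (v : V) : IsLeaf T v ↔ ℓ v = 1 :=
  hT.isLeaf_iff le_rfl hk v

theorem graphA_star (hT : IsLevelTree T ℓ 1 k) (hk : 2 ≤ k) : graphA T = ⊤ := by
  obtain ⟨r, hr0, hr⟩ := hT.root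
  ext a b
  rw [top_adj]
  refine ⟨fun h => h.ne, fun hab => ?_⟩
  have ha := hT.le a
  have hb := hT.le b
  have h0 : ¬ (ℓ a = 0 ∧ ℓ b = 0) := fun h => hab ((hr a h.1).trans (hr b h.2).symm)
  by_cases h1 : ℓ a = 1 ∧ ℓ b = 1
  · refine Or.inr ⟨hab, (hT.isLeaf_star hk a).2 h1.1, (hT.isLeaf_star hk b).2 h1.2, r, ?_, ?_⟩
    · exact (hT.star_adj r a).2 (Or.inl ⟨hr0, h1.1⟩)
    · exact (hT.star_adj r b).2 (Or.inl ⟨hr0, h1.2⟩)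
  · exact Or.inl ((hT.star_adj a b).2 (by omega))

theorem isSplit_graphB_star (hT : IsLevelTree T ℓ 1 k) (hk : 2 ≤ k) : IsSplit (graphB T) := by
  obtain ⟨r, hr0, hr⟩ := hT.root
  have hsup : ∀ q : {v // IsSupport T v}, q.1 = r := fun q => by
    obtain ⟨u, hqu, hu⟩ := (hT.isSupport_iff le_rfl hk _).1 q.2
    exact hr _ (by have := (hT.star_adj _ _).1 hqu; omega)
  have hlr : ∀ a, a ≠ r ↔ ℓ a = 1 := fun a => by
    have := hT.le a
    constructor
    · intro h
      have : ℓ a ≠ 0 := fun h0 => h (hr a h0)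
      omega
    · rintro h rfl; omega
  have hB : ∀ a (q : {v // IsSupport T v}), (T.Adj q.1 a ∧ IsLeaf T a) ↔ a ≠ r := fun a q => by
    rw [hsup q, hT.isLeaf_star hk, hlr, hT.star_adj]; omega
  -- the independent set consists of the centre `r` of the star and the new vertex
  refine ⟨{x | ∀ a, x = Sum.inl a → a = r}, ⟨Sum.inl r, ?_⟩, ?_⟩
  · rintro a ha; exact (Sum.inl_injective ha).symm
  have hl : ∀ a : V, (Sum.inl a : V ⊕ {v // IsSupport T v}) ∈
      {x : V ⊕ {v // IsSupport T v} | ∀ a, x = Sum.inl a → a = r} ↔ a = r := fun a =>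
    ⟨fun h => h a rfl, fun h b hb => Sum.inl_injective hb ▸ h⟩
  have hq : ∀ q : {v // IsSupport T v}, (Sum.inr q : V ⊕ {v // IsSupport T v}) ∈
      {x : V ⊕ {v // IsSupport T v} | ∀ a, x = Sum.inl a → a = r} := fun q a h => by cases h
  rintro (a | p) (b | q) hab
  · change (graphA T).Adj a b ↔ _
    have hab' : a ≠ b := fun h => hab (h ▸ rfl)
    rw [hT.graphA_star hk, top_adj, hl, hl]
    exact iff_of_true hab' fun h => hab' (h.1.trans h.2.symm)
  · change (T.Adj q.1 a ∧ IsLeaf T a) ↔ _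
    rw [hB, hl, not_and]
    exact ⟨fun h1 h2 => absurd h2 h1, fun h1 h2 => h1 h2 (hq q)⟩
  · change (T.Adj p.1 b ∧ IsLeaf T b) ↔ _
    rw [hB, hl, not_and]
    exact ⟨fun h1 _ => h1, fun h1 => h1 (hq p)⟩
  · exact absurd (by rw [Subtype.ext ((hsup p).trans (hsup q).symm)]) hab

theorem deg_graphA_le (hT : IsLevelTree T ℓ h k) (hh : 2 ≤ h) (hk : 2 ≤ k) (v : V) :
    deg (graphA T) v ≤ k := by
  rcases (hT.le v).lt_or_eq with h1 | h1
  · exact (hT.deg_graphA_of_lt (by omega) hk h1).le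
  · have := hT.deg_graphA_leaf hh hk h1
    omega

theorem deg_graphB_le (hT : IsLevelTree T ℓ h k) (hh : 2 ≤ h) (hk : 2 ≤ k)
    (v : V ⊕ {v // IsSupport T v}) : deg (graphB T) v ≤ k := by
  have hleaf := fun x => hT.isLeaf_iff (by omega) hk x
  have himg : ∀ S : Set V, ((Sum.inl : V → V ⊕ {v // IsSupport T v}) '' S).ncard = S.ncard :=
    fun S => Sum.inl_injective.injOn.ncard_image
  rcases v with x | q
  · rcases (hT.le x).lt_or_eq with hx | hx
    · rw [← hT.deg_graphA_of_lt (by omega) hk hx, deg, deg, ← himg ((graphA T).neighborSet x)]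
      refine Set.ncard_le_ncard ?_ (Set.toFinite _)
      rintro (y | q) h1
      · exact ⟨y, h1, rfl⟩
      · have := (hleaf x).1 (show T.Adj q.1 x ∧ IsLeaf T x from h1).2
        omega
    · obtain ⟨p, hp, -⟩ := hT.exists_neighborSet_eq (by omega) hx
      have huniq : ∀ q, T.Adj q x → q = p := fun q hq => by
        have : q ∈ T.neighborSet x := hq.symm
        rwa [hp] at this
      have hps : IsSupport T p := (hT.isSupport_iff (by omega) hk _).2
        ⟨x, by have : p ∈ T.neighborSet x := hp ▸ rfl
               exact this.symm, hx⟩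
      rw [← hT.deg_graphA_leaf hh hk hx, deg, deg, ← himg ((graphA T).neighborSet x)]
      refine (Set.ncard_le_ncard ?_ (Set.toFinite _)).trans
        (Set.ncard_insert_le (Sum.inr ⟨p, hps⟩ : V ⊕ {v // IsSupport T v}) _)
      rintro (y | q) h1
      · exact Or.inr ⟨y, h1, rfl⟩
      · exact Or.inl (congrArg Sum.inr
          (Subtype.ext (huniq _ (show T.Adj q.1 x ∧ IsLeaf T x from h1).1)))
  · obtain ⟨u, hqu, hu⟩ := (hT.isSupport_iff (by omega) hk _).1 q.2
    have hlq : ℓ q.1 < h := by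
      have := hT.adj _ _ hqu
      have := hT.le q.1
      omega
    rw [← hT.deg_eq q.1 hlq, deg, deg, ← himg (T.neighborSet q.1)]
    refine Set.ncard_le_ncard ?_ (Set.toFinite _)
    rintro (y | q') h1
    · exact ⟨y, (show T.Adj q.1 y ∧ IsLeaf T y from h1).1, rfl⟩
    · exact h1.elim

end IsLevelTree

theorem not_isSupport_of_subsingleton [Subsingleton V] (v : V) : ¬ IsSupport G v :=
  fun ⟨u, h, _⟩ => h.ne (Subsingleton.elim v u)

/-- A symmetric graph is a split graph or has no distinguishing colouring with `k` colours for
some bound `k` on its degrees. -/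
theorem IsSymmetricGraph.isSplit_or_noDist [Nonempty V] (h : IsSymmetricGraph G) :
    IsSplit G ∨ ∃ k, (∀ v, deg G v ≤ k) ∧ NoDist G k := by
  have transfer : ∀ {W : Type u} {H : SimpleGraph W} {k : ℕ}, (G ≃g H) → (∀ v, deg H v ≤ k) →
      NoDist H k → ∃ k, (∀ v, deg G v ≤ k) ∧ NoDist G k := fun e h1 h2 =>
    ⟨_, fun v => deg_map e v ▸ h1 (e v), h2.of_iso e⟩
  rcases h with hT | ⟨W, _, T, hT, ⟨⟨e⟩⟩ | ⟨⟨e⟩⟩⟩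
  · rcases hT.exists_isLevelTree with _ | ⟨ℓ, h, k, hh, hk, hL⟩
    · exact Or.inl isSplit_of_subsingleton
    · obtain ⟨n, rfl⟩ : ∃ n, h = n + 1 := ⟨h - 1, by omega⟩
      exact Or.inr ⟨k, hL.deg_le hh (by omega), hL.noDist hk n⟩
  · rcases hT.exists_isLevelTree with _ | ⟨ℓ, h, k, hh, hk, hL⟩
    · have := e.toEquiv.subsingleton
      exact Or.inl isSplit_of_subsingleton
    · rcases hh.eq_or_lt with rfl | hh
      · rw [hL.graphA_star hk] at e
        obtain ⟨v⟩ := ‹Nonempty V›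
        exact Or.inl ⟨{v}, ⟨v, rfl⟩, fun a b hab => by
          rw [← e.map_adj_iff, top_adj, e.injective.ne_iff]
          exact iff_of_true hab fun h => hab (h.1.trans h.2.symm)⟩
      · exact Or.inr (transfer e (hL.deg_graphA_le hh hk) (hL.noDist_graphA hh hk))
  · rcases hT.exists_isLevelTree with _ | ⟨ℓ, h, k, hh, hk, hL⟩
    · have : Subsingleton (W ⊕ {v // IsSupport T v}) := ⟨by
        rintro (a | a) (b | b)
        · rw [Subsingleton.elim a b]
        all_goals first
          | exact absurd a.2 (not_isSupport_of_subsingleton _)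
          | exact absurd b.2 (not_isSupport_of_subsingleton _)⟩
      have := e.toEquiv.subsingleton
      exact Or.inl isSplit_of_subsingleton
    · rcases hh.eq_or_lt with rfl | hh
      · exact Or.inl ((hL.isSplit_graphB_star hk).of_iso e)
      · exact Or.inr (transfer e (hL.deg_graphB_le hh hk) (hL.noDist_graphB hh hk))

theorem Exceptional.isSymmetricGraph_or_isSplit {k : ℕ} (h : Exceptional G k) :
    IsSymmetricGraph G ∨ IsSplit G := by
  rcases h with h | ⟨ℓ, h, hh, hk, hL⟩ | ⟨T, ℓ, h, hh, hk, hL, e⟩ | ⟨⟨W, i, T, hT, e⟩, -⟩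
  · exact Or.inr h
  · exact Or.inl (Or.inl (hL.isSymmetricTree hh hk))
  · subst e
    exact Or.inl (Or.inr ⟨V, _, T, hL.isSymmetricTree (by omega) (by omega), Or.inl ⟨Iso.refl⟩⟩)
  · exact Or.inl (Or.inr ⟨W, i, T, hT, Or.inr e⟩)

end Final
end ChordalDist

theorem mainTheorem2 {V : Type u} [Fintype V] (G : SimpleGraph V) [DecidableRel G.Adj]
    (hconn : G.Connected) (hchordal : ChordalDist.IsChordal G) :
    ChordalDist.distChromaticNumber G ≤ G.maxDegree + 1 ∧
    (ChordalDist.distChromaticNumber G = G.maxDegree + 1 ↔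
      ChordalDist.IsSymmetricGraph G ∨
      Nonempty (G ≃g ChordalDist.join (⊥ : SimpleGraph (Fin G.indepNum))
        (⊤ : SimpleGraph (Fin (G.cliqueNum - 1))))) := by
  have := hconn.nonempty
  have hdeg : ∀ v, ChordalDist.deg G v ≤ G.maxDegree := fun v => by
    rw [← ChordalDist.degree_eq_deg]
    exact G.degree_le_maxDegree v
  have hle := ChordalDist.distChromaticNumber_le hconn hchordal hdeg
  refine ⟨hle, fun heq => ?_, fun h => le_antisymm hle ?_⟩
  · have hnot : ¬ ChordalDist.LabColorable G (fun _ => PUnit.unit.{u + 1}) G.maxDegree := by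
      rw [← ChordalDist.distChromaticNumber_le_iff]; omega
    exact (ChordalDist.exceptional_of_not_labColorable _ _ rfl hconn hchordal hdeg
      hnot).1.isSymmetricGraph_or_isSplit.imp_right fun h => h.nonempty_iso_join
  · have hcase : ChordalDist.IsSplit G ∨
        ∃ k, (∀ v, ChordalDist.deg G v ≤ k) ∧ ChordalDist.NoDist G k := by
      rcases h with h | ⟨⟨e⟩⟩
      · exact h.isSplit_or_noDist
      · have : Nonempty (Fin G.indepNum) := ⟨⟨0, ChordalDist.indepNum_pos G⟩⟩
        exact Or.inl (ChordalDist.isSplit_of_iso_join e)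
    rcases hcase with hs | ⟨k, hk, hno⟩
    · exact hs.noDist_maxDegree.lt_distChromaticNumber
    · refine lt_of_le_of_lt ?_ hno.lt_distChromaticNumber
      refine G.maxDegree_le_of_forall_degree_le k fun v => ?_
      rw [ChordalDist.degree_eq_deg]
      exact hk v
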